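/- Let $\Gamma$ be a countably infinite connected graph (loops permitted) with symmetric edge weights $\mu_{x,y}=\mu_{y,x}\ge 0$, where $\mu_{x,y}>0$ exactly when $x\sim y$, and assume that $\mu(x)=\sum_{y}\mu_{x,y}$ is finite for every $x$. Write $d$ for the graph distance, $B(x,R)=\{y: d(x,y)<R\}$ for real $R$, and $V(x,R)=\sum_{y\in B(x,R)}\mu(y)$. Let $(X_n)_{n\ge 0}$ be the random walk with one-step transition probabilities $P(x,y)=\mu_{x,y}/\mu(x)$; put $P_n(x,y)=\mathbb P(X_n=y\mid X_0=x)$ and $p_n(x,y)=P_n(x,y)/\mu(y)$. Let $E(x,R)=\mathbb E(T_{B(x,R)}\mid X_0=x)$, where $T_A=\min\{k\ge 0: X_k\notin A\}$, and let $e(x,n)=\min\{R\in\mathbb N: E(x,R)\ge n\}$. Assume $(p_0)$: there is $p_0>0$ such that $\mu_{x,y}/\mu(x)\ge p_0$ whenever $x\sim y$. Then the following four conditions are equivalent: 1. the skewed parabolic mean value inequality holds; 2. $(VD)$, $(TC)$ and $(MV)$ hold; 3. $(VD)$, $(TC)$ and $(DUE)$ hold; 4. $(VD)$, $(TC)$ and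 $(UE)$ hold. Here the conditions are as follows. * Skewed parabolic mean value inequality: for all constants $0<c_1<c_2$ there is $C\ge 1$ such that for all $R>0$, $x\in\Gamma$ and $y\in B=B(x,R)$, writing $E=E(x,R)$, $m=\lfloor c_1E\rfloor$, $n=\lfloor c_2E\rfloor$, every nonnegative Dirichlet solution $u_0,\dots,u_n$ of the heat equation on $B$ (that is, functions $u_k\ge 0$ on $\Gamma$ vanishing outside $B$ with $u_{k+1}(z)=\sum_{w\in B}P(z,w)u_k(w)$ for $z\in B$ and $0\le k<n$) satisfies $$u_n(x)\le \frac{C}{V(y,2R)\,E(y,2R)}\sum_{i=m}^{n}\ \sum_{z\in B(x,R)}u_i(z)\mu(z).$$ * $(VD)$: there is $D_V>0$ with $V(x,2R)\le D_V V(x,R)$ for all $x\in\Gamma$, $R>0$. * $(TC)$: there is $C_T>1$ with $E(x,2R)/E(y,R)\le C_T$ for all $x\in\Gamma$, $R>0$, $y\in B(x,R)$. * $(MV)$: there is $C>0$ such that for all $x\in\Gamma$, $R>0$ and every function $u$ that is nonnegative on $B=B(x,R)$ and on the neighbours of points of $B$ and harmonic on $B$ (that is, $\sum_y P(z,y)u(y)=u(z)$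 for $z\in B$), $$u(x)\le\frac{C}{V(x,R)}\sum_{y\in B}u(y)\mu(y).$$ * $(DUE)$: there is $C>0$ such that for all $x\in\Gamma$ and integers $n>0$, $\ p_n(x,x)\le \dfrac{C}{V(x,e(x,n))}$. * $(UE)$: there are $C,\beta>1$ and $c>0$ such that for all $x,y\in\Gamma$ and integers $n>0$, $$p_n(x,y)\le\frac{C}{V(x,e(x,n))}\exp\left[-c\left(\frac{E(x,d(x,y))}{n}\right)^{\frac1{\beta-1}}\right].$$ -/

import Mathlib

open MeasureTheory ProbabilityTheory
open scoped ENNReal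

/-- A connected weighted graph with vertex set `Γ`: symmetric nonnegative weights `μ_{x,y}`, where
`x ∼ y` means `μ_{x,y} > 0` (a loop `x ∼ x` is permitted), with finite total weight at each vertex. -/
structure WeightedGraph (Γ : Type*) where
  weight : Γ → Γ → ℝ
  weight_symm : ∀ x y, weight x y = weight y x
  weight_nonneg : ∀ x y, 0 ≤ weight x y
  weight_summable : ∀ x, Summable (weight x)
  connected : (SimpleGraph.fromRel fun x y => 0 < weight x y).Connected

noncomputable section

namespace WeightedGraph

variable {Γ : Type*} (W : WeightedGraph Γ)

/-- The neighbour relation `x ∼ y`. -/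
def Adj (x y : Γ) : Prop := 0 < W.weight x y

/-- The underlying simple graph, which carries the graph distance. -/
def graph : SimpleGraph Γ := SimpleGraph.fromRel fun x y => 0 < W.weight x y

/-- The shortest path distance. -/
def dist (x y : Γ) : ℕ := W.graph.dist x y

/-- The measure `μ(x) = ∑_{y ∼ x} μ_{x,y}` of a vertex. -/
def mu (x : Γ) : ℝ := ∑' y, W.weight x y

/-- The open ball `B(x,R) = {y : d(x,y) < R}`. -/
def ball (x : Γ) (R : ℝ) : Set Γ := {y | (W.dist x y : ℝ) < R}

/-- The volume `V(x,R) = μ(B(x,R))`. -/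
def vol (x : Γ) (R : ℝ) : ℝ := ∑' y : W.ball x R, W.mu y

/-- The one step transition probability `P(x,y) = μ_{x,y} / μ(x)`. -/
def P (x y : Γ) : ℝ := W.weight x y / W.mu x

/-! ### The random walk -/

theorem mu_pos [Nontrivial Γ] (x : Γ) : 0 < W.mu x := by
  obtain ⟨y, hy⟩ := W.connected.preconnected.exists_adj_of_nontrivial x
  have h : 0 < W.weight x y := by
    rcases hy.2 with h | h
    · exact h
    · rw [W.weight_symm]; exact h
  exact lt_of_lt_of_le h ((W.weight_summable x).le_tsum y fun z _ => W.weight_nonneg x z)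

theorem hasSum_P [Nontrivial Γ] (x : Γ) :
    HasSum (fun y => ENNReal.ofReal (W.P x y)) 1 := by
  have h1 : HasSum (W.P x) 1 := by
    have h := (W.weight_summable x).hasSum.div_const (W.mu x)
    have h2 : (∑' y, W.weight x y) / W.mu x = 1 := div_self (W.mu_pos x).ne'
    rwa [h2] at h
  have h3 : ∀ y, 0 ≤ W.P x y := fun y => div_nonneg (W.weight_nonneg x y) (W.mu_pos x).le
  have h4 := ENNReal.ofReal_tsum_of_nonneg h3 h1.summable
  rw [h1.tsum_eq, ENNReal.ofReal_one] at h4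
  rw [h4]
  exact ENNReal.summable.hasSum

/-- The law of one step of the walk from `x`. -/
def stepLaw [Nontrivial Γ] (x : Γ) : PMF Γ :=
  ⟨fun y => ENNReal.ofReal (W.P x y), W.hasSum_P x⟩

section Walk

variable [Nontrivial Γ] [Countable Γ] [MeasurableSpace Γ] [MeasurableSingletonClass Γ]

/-- The conditional law of `X_{n+1}` given `(X_0, …, X_n)`: one step from `X_n`. -/
def stepKernel (n : ℕ) : Kernel (Π _ : Finset.Iic n, Γ) Γ :=
  (Kernel.ofFunOfCountable fun x => (W.stepLaw x).toMeasure).comap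
    (fun h => h ⟨n, Finset.mem_Iic.2 le_rfl⟩) (measurable_pi_apply _)

instance (n : ℕ) : IsMarkovKernel (W.stepKernel n) :=
  ⟨fun h => by
    change IsProbabilityMeasure (W.stepLaw (h ⟨n, Finset.mem_Iic.2 le_rfl⟩)).toMeasure
    infer_instance⟩

/-- The law `ℙ(· | X_0 = x)` of the random walk `(X_n)` on the path space `ℕ → Γ`, where
`X_n(ω) = ω n`. -/
def walkLaw (x : Γ) : Measure (ℕ → Γ) :=
  Kernel.traj (X := fun _ : ℕ => Γ) W.stepKernel 0 fun _ => x

/-- The `n`-step transition probability `P_n(x,y) = ℙ(X_n = y | X_0 = x)`. -/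
def Pn (n : ℕ) (x y : Γ) : ℝ := (W.walkLaw x).real {ω | ω n = y}

/-- The heat kernel `p_n(x,y) = P_n(x,y) / μ(y)`. -/
def pn (n : ℕ) (x y : Γ) : ℝ := W.Pn n x y / W.mu y

end Walk

/-- The exit time `T_A = min {k : X_k ∉ A}`, which is `∞` on paths that stay in `A`. -/
def exitTime {Γ : Type*} (A : Set Γ) (ω : ℕ → Γ) : ℝ≥0∞ :=
  ⨅ (k : ℕ) (_ : ω k ∉ A), (k : ℝ≥0∞)

section Conditions

variable [Nontrivial Γ] [Countable Γ] [MeasurableSpace Γ] [MeasurableSingletonClass Γ]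

/-- The mean exit time `E(x,R) = 𝔼(T_{B(x,R)} | X_0 = x)`. It is finite on every infinite graph
with controlled weights, so that no information is lost in passing to a real number. -/
def E (x : Γ) (R : ℝ) : ℝ := (∫⁻ ω, exitTime (W.ball x R) ω ∂(W.walkLaw x)).toReal

/-- The inverse of the mean exit time, `e(x,n) = min {R ∈ ℕ : E(x,R) ≥ n}`. -/
def e (x : Γ) (n : ℕ) : ℕ := sInf {R : ℕ | (n : ℝ) ≤ W.E x R}

/-- Volume doubling `(VD)`. -/
def VD : Prop := ∃ D : ℝ, 0 < D ∧ ∀ (x : Γ) (R : ℝ), 0 < R → W.vol x (2 * R) ≤ D * W.vol x R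

/-- The time comparison principle `(TC)`. -/
def TC : Prop := ∃ C : ℝ, 1 < C ∧ ∀ (x : Γ) (R : ℝ), 0 < R → ∀ y ∈ W.ball x R,
  W.E x (2 * R) / W.E y R ≤ C

/-- The controlled weights condition `(p₀)`. -/
def ControlledWeights : Prop := ∃ p₀ : ℝ, 0 < p₀ ∧ ∀ x y, W.Adj x y → p₀ ≤ W.weight x y / W.mu x

/-- A set together with all the neighbours of its points. -/
def closure (A : Set Γ) : Set Γ := A ∪ {y | ∃ x ∈ A, W.Adj x y}

/-- The Markov operator `Pf(x) = ∑_y P(x,y) f(y)`. -/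
def markovOp (f : Γ → ℝ) (x : Γ) : ℝ := ∑' y, W.P x y * f y

/-- `h` is harmonic on `A`; only its values on the closure of `A` matter. -/
def HarmonicOn (h : Γ → ℝ) (A : Set Γ) : Prop := ∀ x ∈ A, W.markovOp h x = h x

/-- The mean value inequality `(MV)`. -/
def MV : Prop := ∃ C : ℝ, 0 < C ∧ ∀ (x : Γ) (R : ℝ), 0 < R → ∀ u : Γ → ℝ,
  (∀ z ∈ W.closure (W.ball x R), 0 ≤ u z) → W.HarmonicOn u (W.ball x R) →
    u x ≤ C / W.vol x R * ∑' y : W.ball x R, u y * W.mu y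

/-- The diagonal upper estimate `(DUE)`. -/
def DUE : Prop := ∃ C : ℝ, 0 < C ∧ ∀ (x : Γ) (n : ℕ), 0 < n →
  W.pn n x x ≤ C / W.vol x (W.e x n)

/-- The upper estimate `(UE)`. -/
def UE : Prop := ∃ C β c : ℝ, 1 < C ∧ 1 < β ∧ 0 < c ∧ ∀ (x y : Γ) (n : ℕ), 0 < n →
  W.pn n x y ≤ C / W.vol x (W.e x n) *
    Real.exp (-(c * (W.E x (W.dist x y) / n) ^ (1 / (β - 1))))

open Classical in
/-- The Markov operator `P^A` of the walk killed on leaving `A`. -/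
def killedOp (A : Set Γ) (f : Γ → ℝ) (x : Γ) : ℝ :=
  if x ∈ A then ∑' y : A, W.P x y * f y else 0

/-- `u_0, …, u_n` is a nonnegative Dirichlet solution of the heat equation `P^A u_k = u_{k+1}`
on `[0,n] × A`: each `u_k` vanishes off `A`. -/
structure IsDirichletSolution (A : Set Γ) (n : ℕ) (u : ℕ → Γ → ℝ) : Prop where
  nonneg : ∀ k ≤ n, ∀ z, 0 ≤ u k z
  support : ∀ k ≤ n, ∀ z ∉ A, u k z = 0
  heat : ∀ k < n, W.killedOp A (u k) = u (k + 1)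

/-- The skewed parabolic mean value inequality: for any constants `0 < c₁ < c₂` there is `C ≥ 1`
as below. With `E = E(x,R)`, the times `c₁E` and `c₂E` are rounded down to integers. -/
def SkewedPMV : Prop := ∀ c₁ c₂ : ℝ, 0 < c₁ → c₁ < c₂ → ∃ C : ℝ, 1 ≤ C ∧
  ∀ (R : ℝ), 0 < R → ∀ x : Γ, ∀ y ∈ W.ball x R, ∀ u : ℕ → Γ → ℝ,
    W.IsDirichletSolution (W.ball x R) ⌊c₂ * W.E x R⌋₊ u →
      u ⌊c₂ * W.E x R⌋₊ x ≤ C / (W.vol y (2 * R) * W.E y (2 * R)) *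
        ∑ i ∈ Finset.Icc ⌊c₁ * W.E x R⌋₊ ⌊c₂ * W.E x R⌋₊,
          ∑' z : W.ball x R, u i z * W.mu z

end Conditions
end WeightedGraph
end

/-! Controlled weights make every ball finite, so the walk killed on leaving a ball is a finite
matrix `ker`. Survival probabilities, mean exit times, Green kernels and the heat kernel are all
read off from it; the path measure enters only through `pn_eq_pg` and `E_eq_meanExit`. The
implications proved are 1 → 3 → 4 → 2 → 3 → 1, and the hub is `LocalDUE`: the even-time diagonal of
the kernel killed outside B(x,R) is at most C / V(x,R) from times of order E(x,R) onwards.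

From local to global. Leaving B(x,R) within n steps requires leaving N successive balls of radius
about R/N; under (TC) the best N gives a tail that is a stretched exponential in E(x,R)/n
(`TC.exists_one_sub_surv_le`). This tail absorbs every polynomial factor produced by doubling. In
`pg_split` a heat kernel value is a killed main term plus exit probabilities times heat kernel
values. With one ball the error is a small multiple of the supremum being estimated, and a bootstrap
gives (DUE) (`DUE_of_localDUE`). With disjoint balls around x and y the main term vanishes, which
gives (UE) (`UE_of_DUE`).

Mean values. Under (UE) the Green kernel of B(x,R) between x and points at distance at least R/4 is
of order E/V. Balayage writes a harmonic function on the half ball as a Green potential of a measure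
on its inner boundary, and (MV) follows (`MV_of_UE`). Conversely, (MV) applied to Green functions
bounds the time sum of the difference between the kernels of two concentric balls. The inner kernel
has decayed exponentially by the times in question, so an induction on scales gives `LocalDUE`
(`localDUE_of_MV`).

The skewed inequality. From (DUE) it follows by bounding the kernel over the first half of the time
interval and averaging (`skewedPMV_of_DUE`). For the converse it is tested on time-shifted killed
kernels. Centred at a point maximising the mean exit time of a ball, where survival up to half the
maximum has probability at least 1/2, it gives (VD) and doubling of the maximal exit time. For (TC)
the centre must also do as well as the maximiser: `SkewedPMV.exists_maxExit_le` proves this by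
induction on scales, reverse volume doubling supplying the contradiction. -/

noncomputable section

namespace WeightedGraph

variable {Γ : Type*} (W : WeightedGraph Γ)

/-! ### The graph distance and balls -/

theorem dist_self (x : Γ) : W.dist x x = 0 := SimpleGraph.dist_self

theorem dist_comm (x y : Γ) : W.dist x y = W.dist y x := SimpleGraph.dist_comm

theorem dist_triangle (x y z : Γ) : W.dist x z ≤ W.dist x y + W.dist y z :=
  SimpleGraph.Connected.dist_triangle W.connected

theorem dist_triangle_real (x y z : Γ) : (W.dist x z : ℝ) ≤ W.dist x y + W.dist y z := by
  exact_mod_cast W.dist_triangle x y z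

theorem dist_eq_zero {x y : Γ} : W.dist x y = 0 ↔ x = y :=
  SimpleGraph.Connected.dist_eq_zero_iff W.connected

theorem adj_symm {x y : Γ} (h : W.Adj x y) : W.Adj y x := by
  unfold Adj at *
  rwa [W.weight_symm]

theorem adj_of_graph_adj {x y : Γ} (h : W.graph.Adj x y) : W.Adj x y := by
  rcases h.2 with h | h
  · exact h
  · exact W.adj_symm h

theorem dist_le_one {x y : Γ} (h : W.Adj x y) : W.dist x y ≤ 1 := by
  by_cases hxy : x = y
  · rw [hxy, W.dist_self]; exact zero_le_one
  · have : W.graph.Adj x y := ⟨hxy, Or.inl h⟩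
    exact (SimpleGraph.dist_eq_one_iff_adj.2 this).le

theorem exists_adj_dist {x y : Γ} {d : ℕ} (h : W.dist x y = d + 1) :
    ∃ z, W.Adj x z ∧ W.dist z y = d := by
  obtain ⟨p, hp⟩ := SimpleGraph.Connected.exists_walk_length_eq_dist
    (show W.graph.Connected from W.connected) x y
  change p.length = W.dist x y at hp
  rw [h] at hp
  cases p with
  | nil => simp at hp
  | @cons _ z _ hadj q =>
    refine ⟨z, W.adj_of_graph_adj hadj, le_antisymm ?_ ?_⟩
    · have h1 : W.dist z y ≤ q.length := SimpleGraph.dist_le q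
      simp at hp
      omega
    · have h1 := W.dist_triangle x z y
      have h2 := W.dist_le_one (W.adj_of_graph_adj hadj)
      omega

theorem P_nonneg (x y : Γ) : 0 ≤ W.P x y :=
  div_nonneg (W.weight_nonneg x y) (tsum_nonneg fun z => W.weight_nonneg x z)

theorem P_eq_zero {x y : Γ} (h : ¬ W.Adj x y) : W.P x y = 0 := by
  unfold P
  have : W.weight x y = 0 := le_antisymm (not_lt.1 h) (W.weight_nonneg x y)
  rw [this, zero_div]

theorem mu_mul_P [Nontrivial Γ] (x y : Γ) : W.mu x * W.P x y = W.weight x y := by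
  unfold P
  have := (W.mu_pos x).ne'
  field_simp

theorem mu_mul_P_comm [Nontrivial Γ] (x y : Γ) : W.mu x * W.P x y = W.mu y * W.P y x := by
  rw [mu_mul_P, mu_mul_P, W.weight_symm]

theorem hasSum_P_real [Nontrivial Γ] (x : Γ) : HasSum (W.P x) 1 := by
  have h := (W.weight_summable x).hasSum.div_const (W.mu x)
  have h2 : (∑' y, W.weight x y) / W.mu x = 1 := div_self (W.mu_pos x).ne'
  rwa [h2] at h

theorem sum_P_le_one [Nontrivial Γ] (x : Γ) (A : Finset Γ) : ∑ y ∈ A, W.P x y ≤ 1 :=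
  sum_le_hasSum A (fun y _ => W.P_nonneg x y) (W.hasSum_P_real x)

theorem sum_P_eq_one [Nontrivial Γ] {x : Γ} {A : Finset Γ} (h : ∀ y, W.Adj x y → y ∈ A) :
    ∑ y ∈ A, W.P x y = 1 := by
  refine HasSum.unique (hasSum_sum_of_ne_finset_zero fun y hy => ?_) (W.hasSum_P_real x)
  exact W.P_eq_zero fun h' => hy (h y h')

/-- Each neighbour takes at least p of a total mass 1, so there are at most 1/p of them. Local
finiteness is what allows balls to be treated as finite sets. -/
theorem finite_adj [Nontrivial Γ] (hp : W.ControlledWeights) (x : Γ) : {y | W.Adj x y}.Finite := by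
  obtain ⟨p, hp0, hp⟩ := hp
  by_contra hinf
  obtain ⟨n, hn⟩ := exists_nat_gt (1 / p)
  obtain ⟨A, hA, hcard⟩ := (show {y | W.Adj x y}.Infinite from hinf).exists_subset_card_eq n
  have h1 := W.sum_P_le_one x A
  have h2 : ∑ y ∈ A, p ≤ ∑ y ∈ A, W.P x y := Finset.sum_le_sum fun y hy => hp x y (hA hy)
  rw [Finset.sum_const, hcard, nsmul_eq_mul] at h2
  rw [div_lt_iff₀ hp0] at hn
  linarith

theorem finite_dist_le [Nontrivial Γ] (hp : W.ControlledWeights) (x : Γ) (n : ℕ) :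
    {y | W.dist x y ≤ n}.Finite := by
  induction n generalizing x with
  | zero =>
    refine (Set.finite_singleton x).subset fun y hy => ?_
    have : W.dist x y = 0 := Nat.le_zero.1 hy
    exact (W.dist_eq_zero.1 this).symm
  | succ n ih =>
    refine ((ih x).union ((W.finite_adj hp x).biUnion fun z _ => ih z)).subset fun y hy => ?_
    rcases Nat.lt_or_ge (W.dist x y) (n + 1) with h | h
    · exact Or.inl (Nat.lt_succ_iff.1 h)
    · have h1 : W.dist x y = n + 1 := le_antisymm hy h
      obtain ⟨z, hz, hd⟩ := W.exists_adj_dist h1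
      exact Or.inr (Set.mem_biUnion (show z ∈ {y | W.Adj x y} from hz) (show W.dist z y ≤ n from hd.le))

theorem finite_ball [Nontrivial Γ] (hp : W.ControlledWeights) (x : Γ) (R : ℝ) :
    (W.ball x R).Finite := by
  refine (W.finite_dist_le hp x ⌈R⌉₊).subset fun y hy => ?_
  have h1 : (W.dist x y : ℝ) < R := hy
  have h2 := Nat.le_ceil R
  exact_mod_cast (h1.le.trans h2)

open Classical in
/-- The ball `B(x,R)` as a finite set (empty if the ball is infinite). -/
def ballF (x : Γ) (R : ℝ) : Finset Γ :=
  if h : (W.ball x R).Finite then h.toFinset else ∅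

section Balls

variable [Nontrivial Γ] (hp : W.ControlledWeights)
include hp

theorem mem_ballF {x y : Γ} {R : ℝ} : y ∈ W.ballF x R ↔ (W.dist x y : ℝ) < R := by
  rw [ballF, dif_pos (W.finite_ball hp x R), Set.Finite.mem_toFinset]
  rfl

theorem coe_ballF (x : Γ) (R : ℝ) : (W.ballF x R : Set Γ) = W.ball x R := by
  rw [ballF, dif_pos (W.finite_ball hp x R), Set.Finite.coe_toFinset]

theorem self_mem_ballF {x : Γ} {R : ℝ} (hR : 0 < R) : x ∈ W.ballF x R := by
  rw [W.mem_ballF hp, W.dist_self]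
  exact_mod_cast hR

theorem mem_ballF_comm {x y : Γ} {R : ℝ} : y ∈ W.ballF x R ↔ x ∈ W.ballF y R := by
  rw [W.mem_ballF hp, W.mem_ballF hp, W.dist_comm]

theorem ballF_subset {x y : Γ} {R S : ℝ} (h : W.dist x y + R ≤ S) :
    W.ballF y R ⊆ W.ballF x S := by
  intro z hz
  rw [W.mem_ballF hp] at *
  have := W.dist_triangle_real x y z
  linarith

theorem ballF_mono {x : Γ} {R S : ℝ} (h : R ≤ S) : W.ballF x R ⊆ W.ballF x S :=
  W.ballF_subset hp (by rw [W.dist_self]; simpa using h)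

theorem ballF_subset_of_mem {x y : Γ} {R S : ℝ} (h : y ∈ W.ballF x S) :
    W.ballF x R ⊆ W.ballF y (R + S) := by
  refine W.ballF_subset hp ?_
  rw [W.mem_ballF hp, W.dist_comm] at h
  linarith

theorem ballF_one {x : Γ} {R : ℝ} (h0 : 0 < R) (h1 : R ≤ 1) : W.ballF x R = {x} := by
  ext y
  rw [W.mem_ballF hp, Finset.mem_singleton]
  constructor
  · intro h
    have : (W.dist x y : ℝ) < 1 := h.trans_le h1
    have h2 : W.dist x y < 1 := by exact_mod_cast this
    exact (W.dist_eq_zero.1 (Nat.lt_one_iff.1 h2)).symm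
  · rintro rfl
    rw [W.dist_self]; exact_mod_cast h0

theorem vol_eq (x : Γ) (R : ℝ) : W.vol x R = ∑ y ∈ W.ballF x R, W.mu y := by
  unfold vol
  rw [← Finset.tsum_subtype', W.coe_ballF hp]

theorem vol_mono_of_subset {x y : Γ} {R S : ℝ} (h : W.ballF x R ⊆ W.ballF y S) :
    W.vol x R ≤ W.vol y S := by
  rw [W.vol_eq hp, W.vol_eq hp]
  exact Finset.sum_le_sum_of_subset_of_nonneg h fun z _ _ => (W.mu_pos z).le

theorem vol_mono {x : Γ} {R S : ℝ} (h : R ≤ S) : W.vol x R ≤ W.vol x S :=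
  W.vol_mono_of_subset hp (W.ballF_mono hp h)

theorem vol_le_vol {x y : Γ} {R S : ℝ} (h : W.dist x y + R ≤ S) : W.vol y R ≤ W.vol x S :=
  W.vol_mono_of_subset hp (W.ballF_subset hp h)

theorem mu_le_vol {x : Γ} {R : ℝ} (hR : 0 < R) : W.mu x ≤ W.vol x R := by
  rw [W.vol_eq hp]
  exact Finset.single_le_sum (f := W.mu) (fun z _ => (W.mu_pos z).le) (W.self_mem_ballF hp hR)

theorem vol_pos {x : Γ} {R : ℝ} (hR : 0 < R) : 0 < W.vol x R :=
  (W.mu_pos x).trans_le (W.mu_le_vol hp hR)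

theorem vol_one {x : Γ} {R : ℝ} (h0 : 0 < R) (h1 : R ≤ 1) : W.vol x R = W.mu x := by
  rw [W.vol_eq hp, W.ballF_one hp h0 h1, Finset.sum_singleton]

theorem exists_dist_eq [Infinite Γ] (x : Γ) (d : ℕ) : ∃ y, W.dist x y = d := by
  have h1 : ∃ y, d ≤ W.dist x y := by
    by_contra h
    push Not at h
    exact Set.infinite_univ ((W.finite_dist_le hp x d).subset fun y _ => (h y).le)
  obtain ⟨y, hy⟩ := h1
  obtain ⟨k, hk⟩ := Nat.exists_eq_add_of_le hy
  induction k generalizing y with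
  | zero => exact ⟨y, hk⟩
  | succ k ih =>
    -- Step back from the far point towards `x` along a geodesic; the excess over `d` drops by one.
    rw [W.dist_comm] at hk
    obtain ⟨z, -, hz⟩ := W.exists_adj_dist (d := d + k) hk
    rw [W.dist_comm] at hz
    exact ih z (by omega) hz

end Balls

end WeightedGraph
end

noncomputable section

namespace WeightedGraph

variable {Γ : Type*} (W : WeightedGraph Γ)

/-! ### The kernel of the killed walk -/

open Classical in
/-- The `n`-step transition probability of the walk killed on leaving the finite set `A`. -/
def ker (A : Finset Γ) : ℕ → Γ → Γ → ℝ
  | 0, x, y => if x ∈ A ∧ x = y then 1 else 0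
  | n + 1, x, y => if x ∈ A then ∑ z ∈ A, W.P x z * ker A n z y else 0

/-- The probability `ℙ(T_A > n | X_0 = x)`. -/
def surv (A : Finset Γ) (n : ℕ) (x : Γ) : ℝ := ∑ y ∈ A, W.ker A n x y

theorem ker_zero_self {A : Finset Γ} {x : Γ} (hx : x ∈ A) : W.ker A 0 x x = 1 := by
  simp [ker, hx]

theorem ker_zero_ne {A : Finset Γ} {x y : Γ} (h : x ≠ y) : W.ker A 0 x y = 0 := by
  simp [ker, h]

theorem ker_succ {A : Finset Γ} {n : ℕ} {x y : Γ} (hx : x ∈ A) :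
    W.ker A (n + 1) x y = ∑ z ∈ A, W.P x z * W.ker A n z y := by
  rw [ker, if_pos hx]

theorem ker_nonneg (A : Finset Γ) (n : ℕ) (x y : Γ) : 0 ≤ W.ker A n x y := by
  induction n generalizing x with
  | zero => rw [ker]; split_ifs <;> norm_num
  | succ n ih =>
    rw [ker]
    split_ifs
    · exact Finset.sum_nonneg fun z _ => mul_nonneg (W.P_nonneg x z) (ih z)
    · exact le_rfl

theorem ker_eq_zero_left {A : Finset Γ} {x : Γ} (hx : x ∉ A) (n : ℕ) (y : Γ) :
    W.ker A n x y = 0 := by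
  cases n <;> simp [ker, hx]

theorem ker_eq_zero_right {A : Finset Γ} {y : Γ} (hy : y ∉ A) (n : ℕ) (x : Γ) :
    W.ker A n x y = 0 := by
  induction n generalizing x with
  | zero =>
    rw [ker, if_neg]
    rintro ⟨h, rfl⟩
    exact hy h
  | succ n ih =>
    rw [ker]
    split_ifs
    · exact Finset.sum_eq_zero fun z _ => by rw [ih, mul_zero]
    · rfl

theorem ker_add (A : Finset Γ) (m n : ℕ) (x y : Γ) :
    W.ker A (m + n) x y = ∑ z ∈ A, W.ker A m x z * W.ker A n z y := by
  classical
  by_cases hx : x ∈ A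
  swap
  · rw [W.ker_eq_zero_left hx]
    exact (Finset.sum_eq_zero fun z _ => by rw [W.ker_eq_zero_left hx, zero_mul]).symm
  induction m generalizing x with
  | zero =>
    rw [zero_add, Finset.sum_eq_single_of_mem x hx]
    · rw [W.ker_zero_self hx, one_mul]
    · intro z _ hz
      rw [W.ker_zero_ne hz.symm, zero_mul]
  | succ m ih =>
    rw [Nat.add_right_comm, W.ker_succ hx]
    simp_rw [W.ker_succ (n := m) hx, Finset.sum_mul]
    rw [Finset.sum_comm]
    refine Finset.sum_congr rfl fun w hw => ?_
    rw [ih w hw, Finset.mul_sum]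
    exact Finset.sum_congr rfl fun z _ => by ring

theorem ker_one {A : Finset Γ} {x y : Γ} (hx : x ∈ A) (hy : y ∈ A) : W.ker A 1 x y = W.P x y := by
  rw [W.ker_succ hx, Finset.sum_eq_single_of_mem y hy]
  · rw [W.ker_zero_self hy, mul_one]
  · intro z _ hz
    rw [W.ker_zero_ne hz, mul_zero]

/-- Expansion at the last step, where the definition expands at the first. Reversibility and the
comparison with the path measure need both. -/
theorem ker_succ' {A : Finset Γ} {n : ℕ} {x y : Γ} (hy : y ∈ A) :
    W.ker A (n + 1) x y = ∑ z ∈ A, W.ker A n x z * W.P z y := by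
  rw [ker_add]
  exact Finset.sum_congr rfl fun z hz => by rw [W.ker_one hz hy]

theorem ker_mono {A B : Finset Γ} (h : A ⊆ B) (n : ℕ) (x y : Γ) :
    W.ker A n x y ≤ W.ker B n x y := by
  by_cases hx : x ∈ A
  swap
  · rw [W.ker_eq_zero_left hx]; exact W.ker_nonneg _ _ _ _
  induction n generalizing x with
  | zero =>
    by_cases hxy : x = y
    · subst hxy
      rw [W.ker_zero_self hx, W.ker_zero_self (h hx)]
    · rw [W.ker_zero_ne hxy, W.ker_zero_ne hxy]
  | succ n ih =>
    rw [W.ker_succ hx, W.ker_succ (h hx)]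
    refine (Finset.sum_le_sum fun z hz => ?_).trans (Finset.sum_le_sum_of_subset_of_nonneg h
      fun z _ _ => mul_nonneg (W.P_nonneg x z) (W.ker_nonneg B n z y))
    exact mul_le_mul_of_nonneg_left (ih z hz) (W.P_nonneg x z)

theorem mu_mul_ker_comm [Nontrivial Γ] (A : Finset Γ) (n : ℕ) (x y : Γ) :
    W.mu x * W.ker A n x y = W.mu y * W.ker A n y x := by
  by_cases hx : x ∈ A
  swap
  · rw [W.ker_eq_zero_left hx, W.ker_eq_zero_right hx, mul_zero, mul_zero]
  by_cases hy : y ∈ A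
  swap
  · rw [W.ker_eq_zero_left hy, W.ker_eq_zero_right hy, mul_zero, mul_zero]
  induction n generalizing x with
  | zero =>
    by_cases hxy : x = y
    · rw [hxy]
    · rw [W.ker_zero_ne hxy, W.ker_zero_ne (Ne.symm hxy), mul_zero, mul_zero]
  | succ n ih =>
    rw [W.ker_succ hx, W.ker_succ' hx, Finset.mul_sum, Finset.mul_sum]
    refine Finset.sum_congr rfl fun z hz => ?_
    calc W.mu x * (W.P x z * W.ker A n z y) = (W.mu x * W.P x z) * W.ker A n z y := by ring
      _ = (W.mu z * W.ker A n z y) * W.P z x := by rw [W.mu_mul_P_comm]; ring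
      _ = W.mu y * (W.ker A n y z * W.P z x) := by rw [ih z hz]; ring

/-! ### Survival probabilities -/

theorem surv_nonneg (A : Finset Γ) (n : ℕ) (x : Γ) : 0 ≤ W.surv A n x :=
  Finset.sum_nonneg fun y _ => W.ker_nonneg A n x y

theorem surv_eq_zero {A : Finset Γ} {x : Γ} (hx : x ∉ A) (n : ℕ) : W.surv A n x = 0 :=
  Finset.sum_eq_zero fun y _ => W.ker_eq_zero_left hx n y

theorem surv_zero {A : Finset Γ} {x : Γ} (hx : x ∈ A) : W.surv A 0 x = 1 := by
  rw [surv, Finset.sum_eq_single_of_mem x hx]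
  · exact W.ker_zero_self hx
  · exact fun y _ hy => W.ker_zero_ne hy.symm

theorem surv_add (A : Finset Γ) (m n : ℕ) (x : Γ) :
    W.surv A (m + n) x = ∑ z ∈ A, W.ker A m x z * W.surv A n z := by
  unfold surv
  simp_rw [ker_add, Finset.mul_sum]
  rw [Finset.sum_comm]

theorem surv_succ {A : Finset Γ} {x : Γ} (hx : x ∈ A) (n : ℕ) :
    W.surv A (n + 1) x = ∑ z ∈ A, W.P x z * W.surv A n z := by
  rw [add_comm, surv_add]
  exact Finset.sum_congr rfl fun z hz => by rw [W.ker_one hx hz]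

theorem surv_le_one [Nontrivial Γ] (A : Finset Γ) (n : ℕ) (x : Γ) : W.surv A n x ≤ 1 := by
  by_cases hx : x ∈ A
  swap
  · rw [W.surv_eq_zero hx]; exact zero_le_one
  induction n generalizing x with
  | zero => rw [W.surv_zero hx]
  | succ n ih =>
    rw [W.surv_succ hx]
    refine (Finset.sum_le_sum fun z hz => ?_).trans (W.sum_P_le_one x A)
    exact mul_le_of_le_one_right (W.P_nonneg x z) (ih z hz)

theorem surv_antitone [Nontrivial Γ] (A : Finset Γ) (x : Γ) : Antitone fun n => W.surv A n x := by
  intro m n hmn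
  obtain ⟨k, rfl⟩ := Nat.exists_eq_add_of_le hmn
  change W.surv A (m + k) x ≤ W.surv A m x
  rw [surv_add]
  exact Finset.sum_le_sum fun z _ =>
    mul_le_of_le_one_right (W.ker_nonneg A m x z) (W.surv_le_one A k z)

theorem surv_mono {A B : Finset Γ} (h : A ⊆ B) (n : ℕ) (x : Γ) : W.surv A n x ≤ W.surv B n x :=
  (Finset.sum_le_sum fun y _ => W.ker_mono h n x y).trans
    (Finset.sum_le_sum_of_subset_of_nonneg h fun y _ _ => W.ker_nonneg B n x y)

theorem ker_le_surv (A : Finset Γ) (n : ℕ) (x y : Γ) : W.ker A n x y ≤ W.surv A n x := by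
  by_cases hy : y ∈ A
  · exact Finset.single_le_sum (f := fun y => W.ker A n x y) (fun z _ => W.ker_nonneg A n x z) hy
  · rw [W.ker_eq_zero_right hy]; exact W.surv_nonneg A n x

theorem ker_le_one [Nontrivial Γ] (A : Finset Γ) (n : ℕ) (x y : Γ) : W.ker A n x y ≤ 1 :=
  (W.ker_le_surv A n x y).trans (W.surv_le_one A n x)

theorem surv_add_le {A : Finset Γ} {n : ℕ} {c : ℝ} (h : ∀ z ∈ A, W.surv A n z ≤ c) (m : ℕ) (x : Γ) :
    W.surv A (m + n) x ≤ W.surv A m x * c := by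
  rw [surv_add, surv, Finset.sum_mul]
  exact Finset.sum_le_sum fun z hz => mul_le_mul_of_nonneg_left (h z hz) (W.ker_nonneg A m x z)

theorem sum_ker_mul_mu [Nontrivial Γ] (A : Finset Γ) (n : ℕ) (y : Γ) :
    ∑ z ∈ A, W.ker A n z y * W.mu z = W.mu y * W.surv A n y := by
  rw [surv, Finset.mul_sum]
  exact Finset.sum_congr rfl fun z _ => by rw [mul_comm, mu_mul_ker_comm]

/-- A function that is subcaloric on `U` is controlled by its initial values on `U` and its values
on the outer boundary of `U`. -/
theorem le_of_subcaloric [Nontrivial Γ] {U Ω : Finset Γ} (hU : U ⊆ Ω) {N : ℕ} {F : ℕ → Γ → ℝ}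
    {G : ℕ → ℝ} (hG : ∀ n < N, 0 ≤ G n)
    (hF : ∀ n < N, ∀ z ∈ U, F (n + 1) z ≤ ∑ y ∈ Ω, W.P z y * F n y)
    (hb : ∀ n < N, ∀ w, w ∉ U → (∃ z ∈ U, W.Adj z w) → F n w ≤ G n)
    {n : ℕ} (hn : n ≤ N) {x : Γ} (hx : x ∈ U) :
    F n x ≤ ∑ y ∈ U, W.ker U n x y * F 0 y +
      ∑ j ∈ Finset.range n, (W.surv U j x - W.surv U (j + 1) x) * G (n - 1 - j) := by
  classical
  induction n generalizing x with
  | zero =>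
    rw [Finset.sum_eq_single_of_mem x hx]
    · simp [W.ker_zero_self hx]
    · intro y _ hy
      rw [W.ker_zero_ne hy.symm, zero_mul]
  | succ n ih =>
    have h1 := hF n hn x hx
    have h2 : ∑ y ∈ Ω, W.P x y * F n y
        = ∑ y ∈ U, W.P x y * F n y + ∑ y ∈ Ω \ U, W.P x y * F n y := by
      rw [add_comm, Finset.sum_sdiff hU]
    have h3 : ∑ y ∈ Ω \ U, W.P x y * F n y ≤ ∑ y ∈ Ω \ U, W.P x y * G n := by
      refine Finset.sum_le_sum fun y hy => ?_
      by_cases hadj : W.Adj x y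
      · exact mul_le_mul_of_nonneg_left (hb n hn y (Finset.mem_sdiff.1 hy).2 ⟨x, hx, hadj⟩)
          (W.P_nonneg x y)
      · rw [W.P_eq_zero hadj, zero_mul, zero_mul]
    -- The mass that P(x,·) gives to Ω \ U is at most the probability of leaving U at once. This is
    -- only an inequality because Ω need not contain all neighbours, hence the sign condition on G.
    have h4 : ∑ y ∈ Ω \ U, W.P x y * G n ≤ (W.surv U 0 x - W.surv U 1 x) * G n := by
      rw [← Finset.sum_mul]
      refine mul_le_mul_of_nonneg_right ?_ (hG n hn)
      rw [W.surv_zero hx, W.surv_succ hx]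
      have h5 : ∑ z ∈ U, W.P x z * W.surv U 0 z = ∑ z ∈ U, W.P x z :=
        Finset.sum_congr rfl fun z hz => by rw [W.surv_zero hz, mul_one]
      have h6 := W.sum_P_le_one x Ω
      rw [← Finset.sum_sdiff hU] at h6
      linarith
    have h7 : ∑ y ∈ U, W.P x y * F n y ≤ ∑ y ∈ U, W.P x y * (∑ w ∈ U, W.ker U n y w * F 0 w +
        ∑ j ∈ Finset.range n, (W.surv U j y - W.surv U (j + 1) y) * G (n - 1 - j)) :=
      Finset.sum_le_sum fun y hy =>
        mul_le_mul_of_nonneg_left (ih (Nat.le_of_succ_le hn) hy) (W.P_nonneg x y)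
    have h8 : ∑ y ∈ U, W.P x y * (∑ w ∈ U, W.ker U n y w * F 0 w +
        ∑ j ∈ Finset.range n, (W.surv U j y - W.surv U (j + 1) y) * G (n - 1 - j))
        = ∑ w ∈ U, W.ker U (n + 1) x w * F 0 w + ∑ j ∈ Finset.range n,
          (W.surv U (j + 1) x - W.surv U (j + 1 + 1) x) * G (n - 1 - j) := by
      simp_rw [mul_add, Finset.sum_add_distrib, Finset.mul_sum]
      congr 1
      · rw [Finset.sum_comm]
        refine Finset.sum_congr rfl fun w _ => ?_
        rw [W.ker_succ hx, Finset.sum_mul]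
        exact Finset.sum_congr rfl fun z _ => by ring
      · rw [Finset.sum_comm]
        refine Finset.sum_congr rfl fun j _ => ?_
        rw [W.surv_succ hx, W.surv_succ hx (j + 1), ← Finset.sum_sub_distrib, Finset.sum_mul]
        exact Finset.sum_congr rfl fun z _ => by ring
    -- The term j = 0 is the exit at the first step, with n steps to go; the others are the
    -- inductive terms delayed by one step.
    rw [Finset.sum_range_succ']
    have h9 : ∀ j ∈ Finset.range n, (W.surv U (j + 1) x - W.surv U (j + 1 + 1) x) *
        G (n + 1 - 1 - (j + 1)) = (W.surv U (j + 1) x - W.surv U (j + 1 + 1) x) * G (n - 1 - j) := by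
      intro j _
      congr 2
      omega
    rw [Finset.sum_congr rfl h9]
    simp only [Nat.add_sub_cancel, Nat.sub_zero, zero_add] at *
    linarith

theorem sum_surv_sub (U : Finset Γ) (n : ℕ) {x : Γ} (hx : x ∈ U) :
    ∑ j ∈ Finset.range n, (W.surv U j x - W.surv U (j + 1) x) = 1 - W.surv U n x := by
  rw [Finset.sum_range_sub', W.surv_zero hx]

theorem le_of_subcaloric_const [Nontrivial Γ] {U Ω : Finset Γ} (hU : U ⊆ Ω) {N : ℕ}
    {F : ℕ → Γ → ℝ} {G : ℝ} (hG : 0 ≤ G)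
    (hF : ∀ n < N, ∀ z ∈ U, F (n + 1) z ≤ ∑ y ∈ Ω, W.P z y * F n y)
    (hb : ∀ n < N, ∀ w, w ∉ U → (∃ z ∈ U, W.Adj z w) → F n w ≤ G) {x : Γ} (hx : x ∈ U) :
    F N x ≤ ∑ y ∈ U, W.ker U N x y * F 0 y + (1 - W.surv U N x) * G := by
  have h := W.le_of_subcaloric hU (G := fun _ => G) (fun _ _ => hG) hF hb le_rfl hx
  rwa [← Finset.sum_mul, W.sum_surv_sub U N hx] at h

end WeightedGraph
end

noncomputable section

namespace WeightedGraph

variable {Γ : Type*} (W : WeightedGraph Γ)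

/-! ### Mean exit times and Green kernels of finite sets -/

/-- The mean exit time from `A` of the walk started at `x`. -/
def meanExit (A : Finset Γ) (x : Γ) : ℝ := ∑' n, W.surv A n x

/-- The Green kernel of the walk killed on leaving `A`. -/
def green (A : Finset Γ) (x y : Γ) : ℝ := ∑' n, W.ker A n x y

theorem le_one_of_le_P [Nontrivial Γ] {p : ℝ}
    (hp : ∀ x y, W.Adj x y → p ≤ W.weight x y / W.mu x) (x : Γ) : p ≤ 1 := by
  obtain ⟨w, hw⟩ := W.connected.preconnected.exists_adj_of_nontrivial x
  refine (hp x w (W.adj_of_graph_adj hw)).trans ?_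
  have := W.sum_P_le_one x {w}
  simpa [P] using this

/-- The walk follows a geodesic from z to y with probability at least p ^ d, and y lies outside A.
-/
theorem surv_le_of_path [Nontrivial Γ] {p : ℝ} (hp0 : 0 < p)
    (hp : ∀ x y, W.Adj x y → p ≤ W.weight x y / W.mu x) {A : Finset Γ} {y : Γ} (hy : y ∉ A)
    (d : ℕ) (z : Γ) (hd : W.dist z y = d) : W.surv A d z ≤ 1 - p ^ d := by
  classical
  have hp1 : p ≤ 1 := W.le_one_of_le_P hp z
  induction d generalizing z with
  | zero =>
    rw [W.dist_eq_zero.1 hd, W.surv_eq_zero hy]; simp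
  | succ d ih =>
    by_cases hz : z ∈ A
    swap
    · rw [W.surv_eq_zero hz]
      exact sub_nonneg.2 (pow_le_one₀ hp0.le hp1)
    obtain ⟨w, hw, hwd⟩ := W.exists_adj_dist hd
    have hPw : p ≤ W.P z w := hp z w hw
    rw [W.surv_succ hz]
    have h1 := W.sum_P_le_one z (insert w A)
    have h2 : ∑ u ∈ A, W.P z u * W.surv A d u
        ≤ ∑ u ∈ insert w A, W.P z u * W.surv A d u :=
      Finset.sum_le_sum_of_subset_of_nonneg (Finset.subset_insert w A)
        fun u _ _ => mul_nonneg (W.P_nonneg z u) (W.surv_nonneg A d u)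
    rw [← Finset.add_sum_erase _ _ (Finset.mem_insert_self w A)] at h1 h2
    have h3 : ∑ u ∈ (insert w A).erase w, W.P z u * W.surv A d u
        ≤ ∑ u ∈ (insert w A).erase w, W.P z u :=
      Finset.sum_le_sum fun u _ => mul_le_of_le_one_right (W.P_nonneg z u) (W.surv_le_one A d u)
    have h4 : W.P z w * W.surv A d w ≤ W.P z w * (1 - p ^ d) :=
      mul_le_mul_of_nonneg_left (ih w hwd) (W.P_nonneg z w)
    have h5 : p * p ^ d ≤ W.P z w * p ^ d := mul_le_mul_of_nonneg_right hPw (pow_nonneg hp0.le d)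
    rw [pow_succ']
    linarith

theorem surv_mul_le {A : Finset Γ} {D : ℕ} {q : ℝ} [Nontrivial Γ] (hq : 0 ≤ q)
    (h : ∀ z ∈ A, W.surv A D z ≤ q) (k : ℕ) (x : Γ) : W.surv A (k * D) x ≤ q ^ k := by
  induction k with
  | zero => simpa using W.surv_le_one A 0 x
  | succ k ih =>
    rw [Nat.succ_mul, pow_succ]
    exact (W.surv_add_le h (k * D) x).trans (mul_le_mul_of_nonneg_right ih hq)

section

variable [Infinite Γ] (hp : W.ControlledWeights)
include hp

theorem exists_surv_le (A : Finset Γ) :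
    ∃ (D : ℕ) (q : ℝ), 0 < D ∧ 0 ≤ q ∧ q < 1 ∧ ∀ z ∈ A, W.surv A D z ≤ q := by
  obtain ⟨p, hp0, hp⟩ := hp
  obtain ⟨y, hy⟩ := Infinite.exists_notMem_finset A
  have h1 : ∀ z, W.surv A (W.dist z y) z ≤ 1 - p ^ W.dist z y :=
    fun z => W.surv_le_of_path hp0 hp hy _ z rfl
  have hp1 : p ≤ 1 := W.le_one_of_le_P hp y
  -- The extra 1 keeps D positive even for empty A; `summable_surv` divides time into blocks of
  -- length D.
  set D := A.sup (fun z => W.dist z y) + 1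
  refine ⟨D, 1 - p ^ D, Nat.succ_pos _, sub_nonneg.2 (pow_le_one₀ hp0.le hp1),
    sub_lt_self 1 (pow_pos hp0 D), fun z hz => ?_⟩
  have h2 : W.dist z y ≤ D := (Finset.le_sup (f := fun z => W.dist z y) hz).trans (Nat.le_succ _)
  have h3 := W.surv_antitone A z h2
  have h4 := pow_le_pow_of_le_one hp0.le hp1 h2
  have h5 := h1 z
  simp only at h3
  linarith

/-- Survival decays geometrically from one block of D steps to the next. This makes mean exit times
and Green kernels of finite sets finite. -/
theorem summable_surv (A : Finset Γ) (x : Γ) : Summable fun n => W.surv A n x := by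
  obtain ⟨D, q, hD, hq0, hq1, h⟩ := W.exists_surv_le hp A
  have h1 : ∀ n, W.surv A n x ≤ q ^ (n / D) := fun n =>
    (W.surv_antitone A x (Nat.div_mul_le_self n D)).trans (W.surv_mul_le hq0 h (n / D) x)
  have h2 : ∀ n, ∑ i ∈ Finset.range (n * D), W.surv A i x ≤ D * (1 - q)⁻¹ := by
    intro n
    have h3 : ∑ i ∈ Finset.range (n * D), W.surv A i x ≤ D * ∑ i ∈ Finset.range n, q ^ i := by
      induction n with
      | zero => simp
      | succ n ih =>
        rw [Nat.succ_mul, Finset.sum_range_add, Finset.sum_range_succ, mul_add]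
        refine add_le_add ih ?_
        have h4 : ∑ i ∈ Finset.range D, W.surv A (n * D + i) x
            ≤ ∑ i ∈ Finset.range D, q ^ n := by
          refine Finset.sum_le_sum fun i hi => ?_
          refine (h1 _).trans (le_of_eq ?_)
          congr 1
          rw [mul_comm, Nat.mul_add_div hD, Nat.div_eq_of_lt (Finset.mem_range.1 hi), add_zero]
        simpa using h4
    refine h3.trans (mul_le_mul_of_nonneg_left ?_ (Nat.cast_nonneg D))
    rw [← tsum_geometric_of_lt_one hq0 hq1]
    exact (summable_geometric_of_lt_one hq0 hq1).sum_le_tsum _ fun i _ => pow_nonneg hq0 i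
  refine summable_of_sum_range_le (c := D * (1 - q)⁻¹) (fun n => W.surv_nonneg A n x) fun n => ?_
  refine (Finset.sum_le_sum_of_subset_of_nonneg ?_ fun i _ _ => W.surv_nonneg A i x).trans (h2 n)
  exact Finset.range_mono (Nat.le_mul_of_pos_right n hD)

theorem tendsto_surv (A : Finset Γ) (x : Γ) :
    Filter.Tendsto (fun n => W.surv A n x) Filter.atTop (nhds 0) :=
  (W.summable_surv hp A x).tendsto_atTop_zero

theorem sum_surv_le_meanExit (A : Finset Γ) (x : Γ) (n : ℕ) :
    ∑ i ∈ Finset.range n, W.surv A i x ≤ W.meanExit A x :=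
  (W.summable_surv hp A x).sum_le_tsum _ fun i _ => W.surv_nonneg A i x

omit [Infinite Γ] hp in
theorem meanExit_nonneg (A : Finset Γ) (x : Γ) : 0 ≤ W.meanExit A x :=
  tsum_nonneg fun n => W.surv_nonneg A n x

omit [Infinite Γ] hp in
theorem meanExit_eq_zero {A : Finset Γ} {x : Γ} (hx : x ∉ A) : W.meanExit A x = 0 := by
  unfold meanExit
  simp [W.surv_eq_zero hx]

theorem one_le_meanExit {A : Finset Γ} {x : Γ} (hx : x ∈ A) : 1 ≤ W.meanExit A x := by
  have := W.sum_surv_le_meanExit hp A x 1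
  rwa [Finset.sum_range_one, W.surv_zero hx] at this

theorem meanExit_mono {A B : Finset Γ} (h : A ⊆ B) (x : Γ) : W.meanExit A x ≤ W.meanExit B x :=
  (W.summable_surv hp A x).tsum_le_tsum (fun n => W.surv_mono h n x) (W.summable_surv hp B x)

theorem tsum_surv_add (A : Finset Γ) (x : Γ) (n : ℕ) :
    ∑' k, W.surv A (n + k) x = ∑ z ∈ A, W.ker A n x z * W.meanExit A z := by
  simp_rw [surv_add]
  rw [Summable.tsum_finsetSum fun z _ => (W.summable_surv hp A z).mul_left _]
  exact Finset.sum_congr rfl fun z _ => tsum_mul_left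

theorem meanExit_eq_sum_add (A : Finset Γ) (x : Γ) (n : ℕ) :
    W.meanExit A x = ∑ i ∈ Finset.range n, W.surv A i x
      + ∑ z ∈ A, W.ker A n x z * W.meanExit A z := by
  rw [← W.tsum_surv_add hp, meanExit, ← (W.summable_surv hp A x).sum_add_tsum_nat_add n]
  simp_rw [add_comm n]

theorem meanExit_eq {A : Finset Γ} {x : Γ} (hx : x ∈ A) :
    W.meanExit A x = 1 + ∑ z ∈ A, W.P x z * W.meanExit A z := by
  rw [W.meanExit_eq_sum_add hp A x 1, Finset.sum_range_one, W.surv_zero hx]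
  congr 1
  exact Finset.sum_congr rfl fun z hz => by rw [W.ker_one hx hz]

theorem meanExit_le_sum_add {A : Finset Γ} {M : ℝ} (hM : ∀ z ∈ A, W.meanExit A z ≤ M) (x : Γ)
    (n : ℕ) : W.meanExit A x ≤ ∑ i ∈ Finset.range n, W.surv A i x + W.surv A n x * M := by
  rw [W.meanExit_eq_sum_add hp A x n, surv, Finset.sum_mul]
  gcongr with z hz
  · exact W.ker_nonneg A n x z
  · exact hM z hz

/-- The mean exit time is at most n plus the probability of surviving n steps times the largest
remaining mean M. Used as a lower bound: a large mean exit time forces survival. -/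
theorem sub_le_surv_mul {A : Finset Γ} {M : ℝ} (hM : ∀ z ∈ A, W.meanExit A z ≤ M) (x : Γ)
    (n : ℕ) : W.meanExit A x - n ≤ W.surv A n x * M := by
  have h1 := W.meanExit_le_sum_add hp hM x n
  have h2 : ∑ i ∈ Finset.range n, W.surv A i x ≤ ∑ i ∈ Finset.range n, (1 : ℝ) :=
    Finset.sum_le_sum fun i _ => W.surv_le_one A i x
  simp at h2
  linarith

theorem mul_surv_le_meanExit (A : Finset Γ) (x : Γ) (n : ℕ) :
    n * W.surv A n x ≤ W.meanExit A x := by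
  refine le_trans ?_ (W.sum_surv_le_meanExit hp A x n)
  have : ∑ i ∈ Finset.range n, W.surv A n x ≤ ∑ i ∈ Finset.range n, W.surv A i x :=
    Finset.sum_le_sum fun i hi => W.surv_antitone A x (Finset.mem_range.1 hi).le
  simpa using this

/-- Exponential decay of the survival probability, at the scale of the mean exit time. -/
theorem surv_le_half_pow {A : Finset Γ} {M : ℝ} (hM : ∀ z ∈ A, W.meanExit A z ≤ M) {n : ℕ}
    (hn : 2 * M ≤ n) (hn0 : 0 < n) (k : ℕ) (x : Γ) : W.surv A (k * n) x ≤ (1 / 2) ^ k := by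
  refine W.surv_mul_le (by norm_num) (fun z hz => ?_) k x
  have h1 := W.mul_surv_le_meanExit hp A z n
  have h2 := hM z hz
  have h3 : (0 : ℝ) < n := by exact_mod_cast hn0
  have h4 : n * W.surv A n z ≤ n * (1 / 2) := by linarith
  exact le_of_mul_le_mul_left h4 h3

/-- The maximum principle: a subharmonic function on `U` that is nonpositive on the outer boundary
of `U` is nonpositive on `U`. -/
theorem nonpos_of_subharmonic {U Ω : Finset Γ} (hU : U ⊆ Ω) {F : Γ → ℝ}
    (hF : ∀ z ∈ U, F z ≤ ∑ y ∈ Ω, W.P z y * F y)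
    (hb : ∀ w, w ∉ U → (∃ z ∈ U, W.Adj z w) → F w ≤ 0) {x : Γ} (hx : x ∈ U) : F x ≤ 0 := by
  have h1 : ∀ n, F x ≤ ∑ y ∈ U, W.ker U n x y * F y := by
    intro n
    have := W.le_of_subcaloric_const (N := n) hU (F := fun _ => F) le_rfl
      (fun _ _ z hz => hF z hz) (fun _ _ w hw hz => hb w hw hz) hx
    simpa using this
  -- The boundary contributes nothing positive, and what remains inside after n steps carries a
  -- weight tending to 0.
  have h2 : ∀ n, F x ≤ W.surv U n x * ∑ y ∈ U, |F y| := by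
    intro n
    refine (h1 n).trans ?_
    rw [Finset.mul_sum]
    refine Finset.sum_le_sum fun y _ => ?_
    exact (mul_le_mul_of_nonneg_left (le_abs_self _) (W.ker_nonneg U n x y)).trans
      (mul_le_mul_of_nonneg_right (W.ker_le_surv U n x y) (abs_nonneg _))
  have h3 := (W.tendsto_surv hp U x).mul_const (∑ y ∈ U, |F y|)
  rw [zero_mul] at h3
  exact ge_of_tendsto' h3 h2

theorem summable_ker (A : Finset Γ) (x y : Γ) : Summable fun n => W.ker A n x y :=
  (W.summable_surv hp A x).of_nonneg_of_le (fun n => W.ker_nonneg A n x y)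
    fun n => W.ker_le_surv A n x y

omit [Infinite Γ] hp in
theorem green_nonneg (A : Finset Γ) (x y : Γ) : 0 ≤ W.green A x y :=
  tsum_nonneg fun n => W.ker_nonneg A n x y

omit [Infinite Γ] hp in
theorem green_eq_zero_left {A : Finset Γ} {x : Γ} (hx : x ∉ A) (y : Γ) : W.green A x y = 0 := by
  unfold green
  simp [W.ker_eq_zero_left hx]

omit hp in
theorem mu_mul_green_comm (A : Finset Γ) (x y : Γ) :
    W.mu x * W.green A x y = W.mu y * W.green A y x := by
  unfold green
  rw [← tsum_mul_left, ← tsum_mul_left]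
  exact tsum_congr fun n => W.mu_mul_ker_comm A n x y

theorem sum_green (A : Finset Γ) (x : Γ) : ∑ y ∈ A, W.green A x y = W.meanExit A x := by
  unfold green meanExit surv
  exact (Summable.tsum_finsetSum fun y _ => W.summable_ker hp A x y).symm

theorem sum_green_mul_mu (A : Finset Γ) (y : Γ) :
    ∑ z ∈ A, W.green A z y * W.mu z = W.mu y * W.meanExit A y := by
  rw [← W.sum_green hp, Finset.mul_sum]
  exact Finset.sum_congr rfl fun z _ => by rw [mul_comm, mu_mul_green_comm]

theorem green_eq {A : Finset Γ} {x : Γ} (hx : x ∈ A) (y : Γ) :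
    W.green A x y = W.ker A 0 x y + ∑ z ∈ A, W.P x z * W.green A z y := by
  unfold green
  rw [(W.summable_ker hp A x y).tsum_eq_zero_add]
  congr 1
  simp_rw [W.ker_succ hx]
  rw [Summable.tsum_finsetSum fun z _ => (W.summable_ker hp A z y).mul_left _]
  exact Finset.sum_congr rfl fun z _ => tsum_mul_left

end

end WeightedGraph
end

noncomputable section

namespace WeightedGraph

variable {Γ : Type*} (W : WeightedGraph Γ)

/-! ### The heat kernel of a finite set -/

/-- The heat kernel of the walk killed on leaving `A`. -/
def pk (A : Finset Γ) (n : ℕ) (x y : Γ) : ℝ := W.ker A n x y / W.mu y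

section

variable [Nontrivial Γ]

theorem pk_nonneg (A : Finset Γ) (n : ℕ) (x y : Γ) : 0 ≤ W.pk A n x y :=
  div_nonneg (W.ker_nonneg A n x y) (W.mu_pos y).le

theorem pk_mul_mu (A : Finset Γ) (n : ℕ) (x y : Γ) : W.pk A n x y * W.mu y = W.ker A n x y :=
  div_mul_cancel₀ _ (W.mu_pos y).ne'

theorem pk_comm (A : Finset Γ) (n : ℕ) (x y : Γ) : W.pk A n x y = W.pk A n y x := by
  unfold pk
  rw [div_eq_div_iff (W.mu_pos y).ne' (W.mu_pos x).ne', mul_comm, mu_mul_ker_comm, mul_comm]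

theorem pk_add (A : Finset Γ) (m n : ℕ) (x y : Γ) :
    W.pk A (m + n) x y = ∑ z ∈ A, W.pk A m x z * W.pk A n z y * W.mu z := by
  rw [pk, ker_add, Finset.sum_div]
  refine Finset.sum_congr rfl fun z _ => ?_
  rw [← W.pk_mul_mu A m x z, pk, pk]
  ring

theorem pk_two_mul (A : Finset Γ) (n : ℕ) (x : Γ) :
    W.pk A (2 * n) x x = ∑ z ∈ A, W.pk A n x z ^ 2 * W.mu z := by
  rw [two_mul, pk_add]
  exact Finset.sum_congr rfl fun z _ => by rw [W.pk_comm A n z x, sq]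

/-- Chapman–Kolmogorov, symmetry and ab ≤ (a² + b²)/2. Only even diagonal times appear: these are
sums of squares and decrease in time, whereas odd ones may vanish, as on a bipartite graph. -/
theorem pk_add_le_half (A : Finset Γ) (i j : ℕ) (x y : Γ) :
    W.pk A (i + j) x y ≤ (W.pk A (2 * i) x x + W.pk A (2 * j) y y) / 2 := by
  rw [pk_add, pk_two_mul, pk_two_mul, ← Finset.sum_add_distrib, Finset.sum_div]
  refine Finset.sum_le_sum fun z _ => ?_
  rw [W.pk_comm A j z y]
  nlinarith [mul_nonneg (sq_nonneg (W.pk A i x z - W.pk A j y z)) (W.mu_pos z).le]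

/-- The `ℓ²` contraction of the killed semigroup. -/
theorem pk_two_mul_add_le {A : Finset Γ} {j : ℕ} {c : ℝ} (hc : 0 ≤ c)
    (h : ∀ z ∈ A, W.surv A j z ≤ c) (n : ℕ) (x : Γ) :
    W.pk A (2 * (n + j)) x x ≤ c ^ 2 * W.pk A (2 * n) x x := by
  rw [add_comm n j, pk_two_mul, pk_two_mul]
  -- Cauchy–Schwarz against the measure `ker A j z`, of mass at most c. The second factor c comes
  -- from its column sums, by reversibility.
  have h1 : ∀ z ∈ A, W.pk A (j + n) x z ^ 2 ≤ c * ∑ w ∈ A, W.ker A j z w * W.pk A n x w ^ 2 := by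
    intro z hz
    have h2 : W.pk A (j + n) x z = ∑ w ∈ A, W.ker A j z w * W.pk A n x w := by
      rw [pk_comm, pk_add]
      refine Finset.sum_congr rfl fun w _ => ?_
      rw [← W.pk_mul_mu A j z w, W.pk_comm A n w x]
      ring
    have h3 : W.pk A (j + n) x z ^ 2
        ≤ (∑ w ∈ A, W.ker A j z w) * ∑ w ∈ A, W.ker A j z w * W.pk A n x w ^ 2 := by
      rw [h2]
      refine Finset.sum_sq_le_sum_mul_sum_of_sq_le_mul A (fun w _ => W.ker_nonneg A j z w)
        (fun w _ => mul_nonneg (W.ker_nonneg A j z w) (sq_nonneg _)) fun w _ => le_of_eq ?_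
      ring
    exact h3.trans (mul_le_mul_of_nonneg_right (h z hz)
      (Finset.sum_nonneg fun w _ => mul_nonneg (W.ker_nonneg A j z w) (sq_nonneg _)))
  calc ∑ z ∈ A, W.pk A (j + n) x z ^ 2 * W.mu z
      ≤ ∑ z ∈ A, (c * ∑ w ∈ A, W.ker A j z w * W.pk A n x w ^ 2) * W.mu z :=
        Finset.sum_le_sum fun z hz => mul_le_mul_of_nonneg_right (h1 z hz) (W.mu_pos z).le
    _ = c * ∑ w ∈ A, W.pk A n x w ^ 2 * ∑ z ∈ A, W.ker A j z w * W.mu z := by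
        simp_rw [Finset.mul_sum, Finset.sum_mul]
        rw [Finset.sum_comm]
        exact Finset.sum_congr rfl fun w _ => Finset.sum_congr rfl fun z _ => by ring
    _ ≤ c * ∑ w ∈ A, W.pk A n x w ^ 2 * (W.mu w * c) := by
        refine mul_le_mul_of_nonneg_left (Finset.sum_le_sum fun w hw => ?_) hc
        rw [sum_ker_mul_mu]
        exact mul_le_mul_of_nonneg_left (mul_le_mul_of_nonneg_left (h w hw) (W.mu_pos w).le)
          (sq_nonneg _)
    _ = c ^ 2 * ∑ z ∈ A, W.pk A n x z ^ 2 * W.mu z := by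
        rw [Finset.mul_sum, Finset.mul_sum]
        exact Finset.sum_congr rfl fun w _ => by ring

theorem pk_two_mul_antitone (A : Finset Γ) (x : Γ) : Antitone fun n => W.pk A (2 * n) x x := by
  intro m n hmn
  obtain ⟨k, rfl⟩ := Nat.exists_eq_add_of_le hmn
  have := W.pk_two_mul_add_le (A := A) zero_le_one (fun z _ => W.surv_le_one A k z) m x
  simpa using this

/-! ### The heat kernel of the whole graph -/

/-- The `n`-step transition probability. -/
def gker (n : ℕ) (x y : Γ) : ℝ := W.ker (W.ballF x (n + 1)) n x y

/-- The heat kernel of the graph. -/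
def pg (n : ℕ) (x y : Γ) : ℝ := W.gker n x y / W.mu y

variable (hp : W.ControlledWeights)
include hp

theorem mem_ballF_two {x y : Γ} (h : W.Adj x y) : y ∈ W.ballF x 2 := by
  rw [W.mem_ballF hp]
  have := W.dist_le_one h
  have h2 : (W.dist x y : ℝ) ≤ 1 := by exact_mod_cast this
  linarith

theorem ballF_subset_of_adj {x y : Γ} {R : ℝ} (h : W.Adj x y) :
    W.ballF y R ⊆ W.ballF x (R + 1) := by
  refine W.ballF_subset hp ?_
  have h2 : (W.dist x y : ℝ) ≤ 1 := by exact_mod_cast W.dist_le_one h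
  linarith

/-- In n steps the walk cannot leave the open ball of radius n + 1, so killing outside a set
containing that ball goes unnoticed. -/
theorem ker_congr {A B : Finset Γ} {n : ℕ} {x : Γ} (hA : W.ballF x (n + 1) ⊆ A)
    (hB : W.ballF x (n + 1) ⊆ B) (y : Γ) : W.ker A n x y = W.ker B n x y := by
  classical
  induction n generalizing x with
  | zero =>
    have hx : x ∈ W.ballF x ((0 : ℕ) + 1) := W.self_mem_ballF hp (by norm_num)
    by_cases hxy : x = y
    · subst hxy
      rw [W.ker_zero_self (hA hx), W.ker_zero_self (hB hx)]
    · rw [W.ker_zero_ne hxy, W.ker_zero_ne hxy]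
  | succ n ih =>
    have hx : x ∈ W.ballF x ((n + 1 : ℕ) + 1) := W.self_mem_ballF hp (by positivity)
    have h2 : W.ballF x 2 ⊆ W.ballF x ((n + 1 : ℕ) + 1) := W.ballF_mono hp (by
      push_cast
      have : (0 : ℝ) ≤ n := Nat.cast_nonneg n
      linarith)
    rw [W.ker_succ (hA hx), W.ker_succ (hB hx)]
    have key : ∀ {C : Finset Γ}, W.ballF x ((n + 1 : ℕ) + 1) ⊆ C →
        ∑ z ∈ C, W.P x z * W.ker C n z y = ∑ z ∈ W.ballF x 2, W.P x z * W.ker C n z y := by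
      intro C hC
      refine (Finset.sum_subset (h2.trans hC) fun z _ hz => ?_).symm
      rw [W.P_eq_zero fun h => hz (W.mem_ballF_two hp h), zero_mul]
    rw [key hA, key hB]
    refine Finset.sum_congr rfl fun z _ => ?_
    by_cases hadj : W.Adj x z
    · have h3 : W.ballF z (n + 1) ⊆ W.ballF x ((n + 1 : ℕ) + 1) := by
        have := W.ballF_subset_of_adj hp (R := n + 1) hadj
        simpa using this
      rw [ih (h3.trans hA) (h3.trans hB)]
    · rw [W.P_eq_zero hadj, zero_mul, zero_mul]

theorem ker_eq_gker {A : Finset Γ} {n : ℕ} {x : Γ} (hA : W.ballF x (n + 1) ⊆ A) (y : Γ) :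
    W.ker A n x y = W.gker n x y :=
  W.ker_congr hp hA subset_rfl y

theorem pk_eq_pg {A : Finset Γ} {n : ℕ} {x : Γ} (hA : W.ballF x (n + 1) ⊆ A) (y : Γ) :
    W.pk A n x y = W.pg n x y := by
  rw [pk, pg, W.ker_eq_gker hp hA]

theorem ker_le_gker (A : Finset Γ) (n : ℕ) (x y : Γ) : W.ker A n x y ≤ W.gker n x y := by
  classical
  rw [← W.ker_eq_gker hp (Finset.subset_union_right (s₁ := A))]
  exact W.ker_mono Finset.subset_union_left n x y

theorem pk_le_pg (A : Finset Γ) (n : ℕ) (x y : Γ) : W.pk A n x y ≤ W.pg n x y :=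
  div_le_div_of_nonneg_right (W.ker_le_gker hp A n x y) (W.mu_pos y).le

omit hp in
theorem gker_le_one (n : ℕ) (x y : Γ) : W.gker n x y ≤ 1 := W.ker_le_one _ n x y

omit hp in
theorem pg_nonneg (n : ℕ) (x y : Γ) : 0 ≤ W.pg n x y := W.pk_nonneg _ n x y

omit hp in
theorem pg_le_inv_mu (n : ℕ) (x y : Γ) : W.pg n x y ≤ 1 / W.mu y :=
  div_le_div_of_nonneg_right (W.gker_le_one n x y) (W.mu_pos y).le

theorem pg_comm (n : ℕ) (x y : Γ) : W.pg n x y = W.pg n y x := by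
  classical
  rw [← W.pk_eq_pg hp (Finset.subset_union_left (s₂ := W.ballF y (n + 1))), pk_comm,
    W.pk_eq_pg hp Finset.subset_union_right]

theorem gker_succ {Ω : Finset Γ} {x : Γ} (h : ∀ y, W.Adj x y → y ∈ Ω) (n : ℕ) (y : Γ) :
    W.gker (n + 1) x y = ∑ z ∈ Ω, W.P x z * W.gker n z y := by
  classical
  set A := W.ballF x ((n + 1 : ℕ) + 1) with hA
  have hx : x ∈ A := W.self_mem_ballF hp (by positivity)
  have h1 : ∀ {C : Finset Γ}, (∀ y, W.Adj x y → y ∈ C) → ∀ f : Γ → ℝ,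
      ∑ z ∈ C, W.P x z * f z = ∑ z ∈ Ω ∪ C, W.P x z * f z := by
    intro C hC f
    refine Finset.sum_subset Finset.subset_union_right fun z _ hz => ?_
    rw [W.P_eq_zero fun h => hz (hC z h), zero_mul]
  have hadjA : ∀ y, W.Adj x y → y ∈ A := fun y hy => W.ballF_mono hp (by
    push_cast
    have : (0 : ℝ) ≤ n := Nat.cast_nonneg n
    linarith) (W.mem_ballF_two hp hy)
  have h2 : ∑ z ∈ Ω, W.P x z * W.gker n z y = ∑ z ∈ A, W.P x z * W.gker n z y := by
    rw [h1 hadjA]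
    refine Finset.sum_subset Finset.subset_union_left fun z _ hz => ?_
    rw [W.P_eq_zero fun h' => hz (h z h'), zero_mul]
  rw [h2, gker, ← hA, W.ker_succ hx]
  refine Finset.sum_congr rfl fun z _ => ?_
  by_cases hadj : W.Adj x z
  · have h3 : W.ballF z (n + 1) ⊆ A := by
      have := W.ballF_subset_of_adj hp (R := n + 1) hadj
      simpa [hA] using this
    rw [W.ker_eq_gker hp h3]
  · rw [W.P_eq_zero hadj, zero_mul, zero_mul]

theorem pg_succ {Ω : Finset Γ} {x : Γ} (h : ∀ y, W.Adj x y → y ∈ Ω) (n : ℕ) (y : Γ) :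
    W.pg (n + 1) x y = ∑ z ∈ Ω, W.P x z * W.pg n z y := by
  rw [pg, W.gker_succ hp h, Finset.sum_div]
  exact Finset.sum_congr rfl fun z _ => by rw [pg, mul_div_assoc]

theorem pg_add_le_half (i j : ℕ) (x y : Γ) :
    W.pg (i + j) x y ≤ (W.pg (2 * i) x x + W.pg (2 * j) y y) / 2 := by
  classical
  set A := W.ballF x ((i + j : ℕ) + 1) ∪ (W.ballF x ((2 * i : ℕ) + 1) ∪ W.ballF y ((2 * j : ℕ) + 1))
  rw [← W.pk_eq_pg hp (A := A) Finset.subset_union_left,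
    ← W.pk_eq_pg hp (A := A) (Finset.subset_union_left.trans Finset.subset_union_right),
    ← W.pk_eq_pg hp (A := A) (Finset.subset_union_right.trans Finset.subset_union_right)]
  exact W.pk_add_le_half A i j x y

theorem pg_two_mul_antitone (x : Γ) : Antitone fun n => W.pg (2 * n) x x := by
  intro m n hmn
  have h1 : W.ballF x ((2 * m : ℕ) + 1) ⊆ W.ballF x ((2 * n : ℕ) + 1) := W.ballF_mono hp (by
    have : ((2 * m : ℕ) : ℝ) ≤ (2 * n : ℕ) := by exact_mod_cast (by omega)
    linarith)
  simp only
  rw [← W.pk_eq_pg hp h1, ← W.pk_eq_pg hp subset_rfl]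
  exact W.pk_two_mul_antitone _ x hmn

theorem pg_le_half_of_le {h s : ℕ} (hs : 2 * h ≤ s) (x y : Γ) :
    W.pg s x y ≤ (W.pg (2 * h) x x + W.pg (2 * h) y y) / 2 := by
  have h1 := W.pg_add_le_half hp h (s - h) x y
  rw [Nat.add_sub_cancel' (by omega)] at h1
  have h2 := W.pg_two_mul_antitone hp y (show h ≤ s - h by omega)
  simp only at h2
  linarith

/-- A bound for the heat kernel at time `n₁ + n₂`, splitting the paths according to whether they
leave `U` before time `n₁`, or leave `U'` after time `n₁`. -/
theorem pg_split {x y : Γ} {U U' : Finset Γ} (hx : x ∈ U) (hy : y ∈ U') {n₁ n₂ : ℕ} {K₁ K₂ : ℝ}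
    (hK₁ : 0 ≤ K₁) (hK₂ : 0 ≤ K₂)
    (h₁ : ∀ s, n₂ ≤ s → s < n₁ + n₂ → ∀ w, w ∉ U → (∃ z ∈ U, W.Adj z w) → W.pg s w y ≤ K₁)
    (h₂ : ∀ s, n₁ ≤ s → s < n₁ + n₂ → ∀ w, w ∉ U' → (∃ z ∈ U', W.Adj z w) → W.pg s w x ≤ K₂) :
    W.pg (n₁ + n₂) x y ≤ ∑ z ∈ U', W.ker U' n₂ y z * W.pk U n₁ x z
      + (1 - W.surv U n₁ x) * K₁ + (1 - W.surv U' n₂ y) * K₂ := by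
  classical
  set Ω := (U ∪ U').biUnion fun z => W.ballF z 2 with hΩ
  have hadj : ∀ z ∈ U ∪ U', ∀ w, W.Adj z w → w ∈ Ω := fun z hz w hw =>
    Finset.mem_biUnion.2 ⟨z, hz, W.mem_ballF_two hp hw⟩
  have hsub : U ∪ U' ⊆ Ω := fun z hz =>
    Finset.mem_biUnion.2 ⟨z, hz, W.self_mem_ballF hp (by norm_num)⟩
  -- Run the walk from x until it leaves U, for at most n₁ steps: z ↦ p_{n₂+j}(z,y) is caloric.
  have step₁ := W.le_of_subcaloric_const (N := n₁) (Finset.subset_union_left.trans hsub)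
    (F := fun j z => W.pg (n₂ + j) z y) hK₁
    (fun j _ z hz => (W.pg_succ hp (hadj z (Finset.mem_union_left _ hz)) (n₂ + j) y).le)
    (fun j hj w hw hz => h₁ (n₂ + j) (by omega) (by omega) w hw hz) hx
  -- By symmetry the remaining n₂ steps are run from y. The function followed is the heat flow of
  -- `ker U n₁ x ·`, which is at most p_{n₁+j}(·,x), so the second hypothesis controls it on the
  -- boundary of U'.
  have step₂ := W.le_of_subcaloric_const (N := n₂) (Finset.subset_union_right.trans hsub)
    (F := fun j z => ∑ v ∈ U, W.ker U n₁ x v * W.pg j z v) hK₂ (by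
      intro j _ z hz
      simp_rw [W.pg_succ hp (hadj z (Finset.mem_union_right _ hz)) j, Finset.mul_sum]
      rw [Finset.sum_comm]
      exact le_of_eq (Finset.sum_congr rfl fun w _ => Finset.sum_congr rfl fun v _ => by ring)) (by
      intro j hj w hw hz
      refine le_trans ?_ (h₂ (n₁ + j) (by omega) (by omega) w hw hz)
      set A := U ∪ (W.ballF x (n₁ + 1) ∪ W.ballF w ((n₁ + j : ℕ) + 1))
      have hwA : W.ballF w ((n₁ + j : ℕ) + 1) ⊆ A :=
        Finset.subset_union_right.trans Finset.subset_union_right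
      have hwA' : W.ballF w (j + 1) ⊆ A := (W.ballF_mono hp (by
        push_cast
        have : (0 : ℝ) ≤ n₁ := Nat.cast_nonneg _
        linarith)).trans hwA
      rw [← W.pk_eq_pg hp hwA, pk_comm, pk_add]
      refine (Finset.sum_le_sum fun v _ => ?_).trans (Finset.sum_le_sum_of_subset_of_nonneg
        (Finset.subset_union_left (s₂ := W.ballF x (n₁ + 1) ∪ W.ballF w ((n₁ + j : ℕ) + 1)))
        fun v _ _ => mul_nonneg (mul_nonneg (W.pk_nonneg A n₁ x v) (W.pk_nonneg A j v w))
          (W.mu_pos v).le)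
      rw [← W.pk_eq_pg hp hwA', W.pk_comm A j w v, mul_right_comm, pk_mul_mu]
      exact mul_le_mul_of_nonneg_right (W.ker_mono Finset.subset_union_left n₁ x v)
        (W.pk_nonneg A j v w)) hy
  have hzero : ∀ z, ∑ v ∈ U, W.ker U n₁ x v * W.pg 0 z v = W.pk U n₁ x z := by
    intro z
    by_cases hz : z ∈ U
    · rw [Finset.sum_eq_single_of_mem z hz]
      · rw [pg, gker, W.ker_zero_self (W.self_mem_ballF hp (by positivity)), pk, mul_one_div]
      · intro v _ hv
        rw [pg, gker, W.ker_zero_ne hv.symm, zero_div, mul_zero]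
    · rw [pk, W.ker_eq_zero_right hz, zero_div]
      refine Finset.sum_eq_zero fun v hv => ?_
      have : z ≠ v := fun h => hz (h ▸ hv)
      rw [pg, gker, W.ker_zero_ne this, zero_div, mul_zero]
  simp only [hzero, add_zero] at step₁ step₂
  have h5 : ∑ z ∈ U, W.ker U n₁ x z * W.pg n₂ z y = ∑ v ∈ U, W.ker U n₁ x v * W.pg n₂ y v :=
    Finset.sum_congr rfl fun z _ => by rw [W.pg_comm hp]
  rw [add_comm n₁ n₂]
  linarith

end

end WeightedGraph
end

noncomputable section

namespace WeightedGraph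

variable {Γ : Type*} (W : WeightedGraph Γ)

/-! ### The law of the walk in terms of the killed kernels -/

theorem measurableSet_coord_eq {ι : Type*} [MeasurableSpace Γ] [MeasurableSingletonClass Γ]
    (i : ι) (z : Γ) : MeasurableSet {ω : ι → Γ | ω i = z} := by
  have h : MeasurableSet ((fun ω : ι → Γ => ω i) ⁻¹' {z}) :=
    measurable_pi_apply i (measurableSet_singleton z)
  exact h

theorem measurableSet_stay [Countable Γ] [MeasurableSpace Γ] [MeasurableSingletonClass Γ] (A : Set Γ)
    (n : ℕ) : MeasurableSet {ω : ℕ → Γ | ∀ k ≤ n, ω k ∈ A} := by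
  have : {ω : ℕ → Γ | ∀ k ≤ n, ω k ∈ A} = ⋂ k ∈ Finset.range (n + 1), (fun ω => ω k) ⁻¹' A := by
    ext ω
    simp
  rw [this]
  exact Finset.measurableSet_biInter _ fun k _ =>
    measurable_pi_apply k (Set.to_countable A).measurableSet

section Law

variable [Nontrivial Γ] [Countable Γ] [MeasurableSpace Γ] [MeasurableSingletonClass Γ]

instance (x : Γ) : IsProbabilityMeasure (W.walkLaw x) := by
  unfold walkLaw
  infer_instance

/-- By the Ionescu-Tulcea construction, the joint law of the history up to time n and the next
position is the composition product with `stepKernel n`. -/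
theorem walkLaw_markov (x : Γ) (n : ℕ) {D : Set (Π _ : Finset.Iic n, Γ)} (hD : MeasurableSet D)
    (z y : Γ) :
    W.walkLaw x {ω | (Preorder.frestrictLe n ω ∈ D ∧ ω n = z) ∧ ω (n + 1) = y}
      = W.walkLaw x {ω | Preorder.frestrictLe n ω ∈ D ∧ ω n = z} * ENNReal.ofReal (W.P z y) := by
  set x₀ : Π _ : Finset.Iic 0, Γ := fun _ => x
  have hmap := Kernel.partialTraj_compProd_eq_map_traj (X := fun _ : ℕ => Γ) (κ := W.stepKernel)
    (zero_le (a := n)) (x₀ := x₀)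
  set S : Set (Π _ : Finset.Iic n, Γ) := D ∩ {h | h ⟨n, Finset.mem_Iic.2 le_rfl⟩ = z}
  have hS : MeasurableSet S := hD.inter (measurableSet_coord_eq _ z)
  have hSy : MeasurableSet (S ×ˢ ({y} : Set Γ)) := hS.prod (measurableSet_singleton y)
  have h1 : W.walkLaw x {ω | (Preorder.frestrictLe n ω ∈ D ∧ ω n = z) ∧ ω (n + 1) = y}
      = ((Kernel.partialTraj (X := fun _ : ℕ => Γ) W.stepKernel 0 n x₀) ⊗ₘ W.stepKernel n)
        (S ×ˢ {y}) := by
    rw [hmap, Measure.map_apply (by fun_prop) hSy]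
    rfl
  have h2 : W.walkLaw x {ω | Preorder.frestrictLe n ω ∈ D ∧ ω n = z}
      = Kernel.partialTraj (X := fun _ : ℕ => Γ) W.stepKernel 0 n x₀ S := by
    rw [← Kernel.traj_map_frestrictLe, Kernel.map_apply' _ (by fun_prop) _ hS]
    rfl
  rw [h1, h2, Measure.compProd_apply_prod hS (measurableSet_singleton y)]
  have h3 : ∀ h ∈ S, W.stepKernel n h {y} = ENNReal.ofReal (W.P z y) := by
    rintro h ⟨-, hz⟩
    have hz' : h ⟨n, Finset.mem_Iic.2 le_rfl⟩ = z := hz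
    change (W.stepLaw (h ⟨n, Finset.mem_Iic.2 le_rfl⟩)).toMeasure {y} = _
    rw [PMF.toMeasure_apply_singleton _ _ (measurableSet_singleton y), hz']
    rfl
  rw [setLIntegral_congr_fun hS h3, setLIntegral_const, mul_comm]

theorem walkLaw_stay_and_eq (A : Finset Γ) {x : Γ} (hx : x ∈ A) (n : ℕ) (y : Γ) :
    W.walkLaw x {ω | (∀ k ≤ n, ω k ∈ A) ∧ ω n = y} = ENNReal.ofReal (W.ker A n x y) := by
  classical
  induction n generalizing y with
  | zero =>
    have h0 : W.walkLaw x {ω | ω 0 = x} = 1 := by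
      have h := Kernel.traj_map_frestrictLe_apply (X := fun _ : ℕ => Γ) (κ := W.stepKernel) 0 0
        (fun _ => x)
      have hm : MeasurableSet {h : Π _ : Finset.Iic 0, Γ | h ⟨0, by simp⟩ = x} :=
        measurableSet_coord_eq _ x
      have h2 := congrArg (fun ν => ν {h : Π _ : Finset.Iic 0, Γ | h ⟨0, by simp⟩ = x}) h
      rw [Measure.map_apply (by fun_prop) hm] at h2
      rw [Kernel.partialTraj_self, Kernel.id_apply, Measure.dirac_apply' _ hm] at h2
      simpa [walkLaw] using h2
    have hae : ∀ᵐ ω ∂(W.walkLaw x), ω 0 = x := by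
      rw [← prob_compl_eq_zero_iff₀] at h0
      · exact h0
      · exact (measurableSet_coord_eq 0 x).nullMeasurableSet
    by_cases hxy : x = y
    · subst hxy
      rw [W.ker_zero_self hx, ENNReal.ofReal_one, ← h0]
      congr 1
      ext ω
      simp only [Set.mem_ofPred_eq, Nat.le_zero]
      constructor
      · exact fun h => h.2
      · intro h
        refine ⟨fun k hk => ?_, h⟩
        rw [hk, h]; exact hx
    · rw [W.ker_zero_ne hxy, ENNReal.ofReal_zero]
      have : ∀ᵐ ω ∂(W.walkLaw x), ω ∉ {ω : ℕ → Γ | (∀ k ≤ 0, ω k ∈ A) ∧ ω 0 = y} := by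
        filter_upwards [hae] with ω hω h
        exact hxy (hω.symm.trans h.2)
      exact measure_eq_zero_iff_ae_notMem.2 this
  | succ n ih =>
    by_cases hy : y ∈ A
    swap
    · rw [W.ker_eq_zero_right hy, ENNReal.ofReal_zero]
      convert! measure_empty (μ := W.walkLaw x)
      ext ω
      simp only [Set.mem_ofPred_eq, Set.mem_empty_iff_false, iff_false]
      rintro ⟨h, rfl⟩
      exact hy (h _ le_rfl)
    set D : Set (Π _ : Finset.Iic n, Γ) := {h | ∀ i, h i ∈ A} with hDdef
    have hD : MeasurableSet D := by
      have : D = ⋂ i, (fun h : Π _ : Finset.Iic n, Γ => h i) ⁻¹' (A : Set Γ) := by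
        ext h
        simp [hDdef]
      rw [this]
      exact MeasurableSet.iInter fun i =>
        measurable_pi_apply i (Set.to_countable _).measurableSet
    have hDn : ∀ ω : ℕ → Γ,
        Preorder.frestrictLe (π := fun _ : ℕ => Γ) n ω ∈ D ↔ ∀ k ≤ n, ω k ∈ A := by
      intro ω
      constructor
      · exact fun h k hk => h ⟨k, Finset.mem_Iic.2 hk⟩
      · exact fun h i => h i.1 (Finset.mem_Iic.1 i.2)
    have hunion : {ω : ℕ → Γ | (∀ k ≤ n + 1, ω k ∈ A) ∧ ω (n + 1) = y}
        = ⋃ z ∈ A, {ω | (Preorder.frestrictLe (π := fun _ : ℕ => Γ) n ω ∈ D ∧ ω n = z)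
            ∧ ω (n + 1) = y} := by
      ext ω
      simp only [Set.mem_iUnion, Set.mem_ofPred_eq, hDn, exists_prop]
      constructor
      · rintro ⟨h1, h2⟩
        exact ⟨ω n, h1 n (Nat.le_succ n), ⟨fun k hk => h1 k (Nat.le_succ_of_le hk), rfl⟩, h2⟩
      · rintro ⟨z, -, ⟨h1, -⟩, h2⟩
        refine ⟨fun k hk => ?_, h2⟩
        rcases Nat.le_succ_iff.1 hk with h | h
        · exact h1 k h
        · rw [h, h2]; exact hy
    rw [hunion, measure_biUnion_finset]
    · rw [W.ker_succ' hy, ENNReal.ofReal_sum_of_nonneg fun z _ =>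
        mul_nonneg (W.ker_nonneg A n x z) (W.P_nonneg z y)]
      refine Finset.sum_congr rfl fun z _ => ?_
      rw [W.walkLaw_markov x n hD z y, ENNReal.ofReal_mul (W.ker_nonneg A n x z), ← ih z]
      simp_rw [hDn]
    · intro z _ z' _ hzz'
      refine Set.disjoint_left.2 ?_
      rintro ω ⟨⟨-, h1⟩, -⟩ ⟨⟨-, h2⟩, -⟩
      exact hzz' (h1.symm.trans h2)
    · intro z _
      have e : {ω : ℕ → Γ | (Preorder.frestrictLe (π := fun _ : ℕ => Γ) n ω ∈ D ∧ ω n = z) ∧ ω (n + 1) = y}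
        = (Preorder.frestrictLe (π := fun _ : ℕ => Γ) n ⁻¹' D ∩ (fun ω => ω n) ⁻¹' {z})
          ∩ (fun ω => ω (n + 1)) ⁻¹' {y} := rfl
      rw [e]
      exact ((Preorder.measurable_frestrictLe n hD).inter
        (measurable_pi_apply n (measurableSet_singleton z))).inter
        (measurable_pi_apply (n + 1) (measurableSet_singleton y))

theorem walkLaw_stay (A : Finset Γ) {x : Γ} (hx : x ∈ A) (n : ℕ) :
    W.walkLaw x {ω | ∀ k ≤ n, ω k ∈ A} = ENNReal.ofReal (W.surv A n x) := by
  have hunion : {ω : ℕ → Γ | ∀ k ≤ n, ω k ∈ A}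
      = ⋃ z ∈ A, {ω | (∀ k ≤ n, ω k ∈ A) ∧ ω n = z} := by
    ext ω
    simp only [Set.mem_iUnion, Set.mem_ofPred_eq, exists_prop]
    exact ⟨fun h => ⟨ω n, h n le_rfl, h, rfl⟩, fun ⟨_, _, h, _⟩ => h⟩
  rw [hunion, measure_biUnion_finset, surv, ENNReal.ofReal_sum_of_nonneg fun z _ =>
    W.ker_nonneg A n x z]
  · exact Finset.sum_congr rfl fun z _ => W.walkLaw_stay_and_eq A hx n z
  · intro z _ z' _ hzz'
    refine Set.disjoint_left.2 ?_
    rintro ω ⟨-, h1⟩ ⟨-, h2⟩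
    exact hzz' (h1.symm.trans h2)
  · intro z _
    exact (measurableSet_stay (A : Set Γ) n).inter (measurableSet_coord_eq n z)

end Law

/-- The exit time counts the n up to which the path has stayed in A; both sides are infinite on
paths that never leave. Integration then gives the mean exit time as a sum of survival
probabilities. -/
theorem exitTime_eq_tsum (A : Set Γ) (ω : ℕ → Γ) :
    exitTime A ω = ∑' n, Set.indicator {ω : ℕ → Γ | ∀ k ≤ n, ω k ∈ A} (fun _ => (1 : ℝ≥0∞)) ω := by
  classical
  by_cases h : ∃ k, ω k ∉ A
  · set k₀ := Nat.find h
    have hk : ω k₀ ∉ A := Nat.find_spec h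
    have hlt : ∀ k < k₀, ω k ∈ A := fun k hk => not_not.1 (Nat.find_min h hk)
    have h1 : exitTime A ω = k₀ := by
      unfold exitTime
      refine le_antisymm (iInf₂_le k₀ hk) (le_iInf₂ fun k hk' => ?_)
      exact_mod_cast Nat.find_min' h hk'
    rw [h1, tsum_eq_sum (s := Finset.range k₀)]
    · rw [Finset.sum_congr rfl fun n hn => Set.indicator_of_mem (s := {ω : ℕ → Γ | ∀ k ≤ n, ω k ∈ A})
        (fun k hk => hlt k (hk.trans_lt (Finset.mem_range.1 hn))) _]
      simp
    · intro n hn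
      have hn' : k₀ ≤ n := by simpa using hn
      exact Set.indicator_of_notMem (s := {ω : ℕ → Γ | ∀ k ≤ n, ω k ∈ A})
        (fun h' : ∀ k ≤ n, ω k ∈ A => hk (h' k₀ hn')) _
  · push Not at h
    have h1 : exitTime A ω = ⊤ := by
      unfold exitTime
      simp [h]
    have h2 : ∀ n, Set.indicator {ω : ℕ → Γ | ∀ k ≤ n, ω k ∈ A} (fun _ => (1 : ℝ≥0∞)) ω = 1 :=
      fun n => Set.indicator_of_mem (s := {ω : ℕ → Γ | ∀ k ≤ n, ω k ∈ A}) (fun k _ => h k) _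
    simp_rw [h1, h2]
    exact (ENNReal.tsum_const_eq_top_of_ne_zero one_ne_zero).symm

section

variable [Infinite Γ] (hp : W.ControlledWeights)
include hp

theorem surv_eq_one {A : Finset Γ} {n : ℕ} {x : Γ} (hA : W.ballF x (n + 1) ⊆ A) :
    W.surv A n x = 1 := by
  induction n generalizing x with
  | zero => exact W.surv_zero (hA (W.self_mem_ballF hp (by norm_num)))
  | succ n ih =>
    have hx : x ∈ A := hA (W.self_mem_ballF hp (by positivity))
    have hadj : ∀ y, W.Adj x y → y ∈ A := fun y hy => hA (W.ballF_mono hp (by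
      push_cast
      have : (0 : ℝ) ≤ n := Nat.cast_nonneg n
      linarith) (W.mem_ballF_two hp hy))
    rw [W.surv_succ hx, ← W.sum_P_eq_one hadj]
    refine Finset.sum_congr rfl fun z _ => ?_
    by_cases h : W.Adj x z
    · rw [ih, mul_one]
      have := W.ballF_subset_of_adj hp (R := n + 1) h
      refine (Finset.Subset.trans this ?_).trans hA
      simp
    · rw [W.P_eq_zero h, zero_mul]

theorem surv_ballF_eq_one {x : Γ} {R : ℝ} {n : ℕ} (h : n < R) : W.surv (W.ballF x R) n x = 1 := by
  refine W.surv_eq_one hp fun y hy => ?_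
  rw [W.mem_ballF hp] at *
  have h1 : W.dist x y < n + 1 := by exact_mod_cast hy
  have h2 : (W.dist x y : ℝ) ≤ n := by exact_mod_cast Nat.lt_succ_iff.1 h1
  linarith

variable [Countable Γ] [MeasurableSpace Γ] [MeasurableSingletonClass Γ]

theorem Pn_eq_gker (n : ℕ) (x y : Γ) : W.Pn n x y = W.gker n x y := by
  set A := W.ballF x (n + 1) with hA
  have hx : x ∈ A := W.self_mem_ballF hp (by positivity)
  have h1 : W.walkLaw x {ω | ∀ k ≤ n, ω k ∈ A} = 1 := by
    rw [W.walkLaw_stay A hx, W.surv_eq_one hp subset_rfl, ENNReal.ofReal_one]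
  have h2 : ∀ᵐ ω ∂(W.walkLaw x), ω ∈ {ω : ℕ → Γ | ∀ k ≤ n, ω k ∈ A} := by
    have hm : MeasurableSet {ω : ℕ → Γ | ∀ k ≤ n, ω k ∈ A} := measurableSet_stay (A : Set Γ) n
    rw [← prob_compl_eq_zero_iff₀ hm.nullMeasurableSet] at h1
    exact h1
  have h3 : W.walkLaw x {ω | ω n = y} = W.walkLaw x {ω | (∀ k ≤ n, ω k ∈ A) ∧ ω n = y} := by
    refine measure_congr ?_
    filter_upwards [h2] with ω hω
    exact propext ⟨fun h => ⟨hω, h⟩, fun h => h.2⟩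
  rw [Pn, measureReal_def, h3, W.walkLaw_stay_and_eq A hx,
    ENNReal.toReal_ofReal (W.ker_nonneg A n x y), gker]

theorem pn_eq_pg (n : ℕ) (x y : Γ) : W.pn n x y = W.pg n x y := by
  rw [pn, pg, W.Pn_eq_gker hp]

theorem E_eq_meanExit {R : ℝ} (x : Γ) (hR : 0 < R) : W.E x R = W.meanExit (W.ballF x R) x := by
  have hx : x ∈ W.ballF x R := W.self_mem_ballF hp hR
  unfold E
  simp_rw [exitTime_eq_tsum, ← W.coe_ballF hp]
  rw [lintegral_tsum fun n =>
    (measurable_const.indicator (measurableSet_stay (W.ballF x R : Set Γ) n)).aemeasurable]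
  have h1 : ∀ n, ∫⁻ ω, Set.indicator {ω : ℕ → Γ | ∀ k ≤ n, ω k ∈ (W.ballF x R : Set Γ)}
      (fun _ => (1 : ℝ≥0∞)) ω ∂(W.walkLaw x) = ENNReal.ofReal (W.surv (W.ballF x R) n x) := by
    intro n
    rw [lintegral_indicator_const (measurableSet_stay (W.ballF x R : Set Γ) n), one_mul,
      ← W.walkLaw_stay _ hx]
    rfl
  simp_rw [h1]
  rw [← ENNReal.ofReal_tsum_of_nonneg (fun n => W.surv_nonneg _ n x) (W.summable_surv hp _ x),
    ← meanExit, ENNReal.toReal_ofReal (W.meanExit_nonneg _ x)]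

omit hp in
theorem E_eq_zero {R : ℝ} (x : Γ) (hR : R ≤ 0) : W.E x R = 0 := by
  have h : W.ball x R = ∅ := by
    ext y
    simp only [ball, Set.mem_ofPred_eq, Set.mem_empty_iff_false, iff_false, not_lt]
    exact hR.trans (Nat.cast_nonneg _)
  have h2 : ∀ ω : ℕ → Γ, exitTime (∅ : Set Γ) ω = 0 := by
    intro ω
    refine le_antisymm ?_ zero_le
    exact (iInf₂_le 0 (Set.notMem_empty _)).trans (by simp)
  unfold E
  simp [h, h2]

end

end WeightedGraph
end

noncomputable section

namespace WeightedGraph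

/-! ### Doubling functions -/

theorem doubling_iterate {f : ℝ → ℝ} {C : ℝ} (hC : 0 ≤ C)
    (hd : ∀ r, 0 < r → f (2 * r) ≤ C * f r) {r : ℝ} (hr : 0 < r) (k : ℕ) :
    f (2 ^ k * r) ≤ C ^ k * f r := by
  induction k with
  | zero => simp
  | succ k ih =>
    have h1 := hd (2 ^ k * r) (by positivity)
    calc f (2 ^ (k + 1) * r) = f (2 * (2 ^ k * r)) := by ring_nf
      _ ≤ C * f (2 ^ k * r) := h1
      _ ≤ C * (C ^ k * f r) := mul_le_mul_of_nonneg_left ih hC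
      _ = C ^ (k + 1) * f r := by ring

/-- Choose k with 2 ^ k ≤ R/r < 2 ^ (k + 1) and double k + 1 times; one factor C pays for the
rounding. -/
theorem doubling_pow {f : ℝ → ℝ} {C : ℝ} {b : ℕ} (hC : 1 ≤ C) (hb : C ≤ 2 ^ b)
    (hmono : ∀ r s, r ≤ s → f r ≤ f s) (hf : ∀ r, 0 ≤ f r)
    (hd : ∀ r, 0 < r → f (2 * r) ≤ C * f r) {r R : ℝ} (hr : 0 < r) (hrR : r ≤ R) :
    f R ≤ C * (R / r) ^ b * f r := by
  have h1 : 1 ≤ R / r := (one_le_div hr).2 hrR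
  obtain ⟨k, hk1, hk2⟩ := exists_nat_pow_near h1 (show (1 : ℝ) < 2 by norm_num)
  have h2 : f R ≤ f (2 ^ (k + 1) * r) := hmono _ _ (by
    rw [div_lt_iff₀ hr] at hk2; exact hk2.le)
  have h3 := doubling_iterate (zero_le_one.trans hC) hd hr (k + 1)
  have h4 : C ^ (k + 1) ≤ C * (R / r) ^ b := by
    rw [pow_succ']
    refine mul_le_mul_of_nonneg_left ?_ (zero_le_one.trans hC)
    calc C ^ k ≤ (2 ^ b) ^ k := pow_le_pow_left₀ (zero_le_one.trans hC) hb k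
      _ = (2 ^ k) ^ b := by rw [← pow_mul, ← pow_mul, mul_comm]
      _ ≤ (R / r) ^ b := pow_le_pow_left₀ (by positivity) hk1 b
  exact h2.trans (h3.trans (mul_le_mul_of_nonneg_right h4 (hf r)))

/-- The converse estimate: if f gains a factor θ whenever the radius grows eightfold, then R/r is
polynomially bounded by f R / f r. -/
theorem growth_pow {f : ℝ → ℝ} {θ r₀ : ℝ} {m : ℕ} (hθ : 1 ≤ θ) (hm : 8 ≤ θ ^ m)
    (hmono : ∀ r s, r ≤ s → f r ≤ f s) (hr₀ : 0 < r₀) (hf : ∀ r, 0 < r → 0 < f r)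
    (hd : ∀ r, r₀ ≤ r → θ * f r ≤ f (8 * r)) {r R : ℝ} (hr : r₀ ≤ r) (hrR : r ≤ R) :
    R / r ≤ 8 * (f R / f r) ^ m := by
  have hr' : 0 < r := hr₀.trans_le hr
  have h1 : 1 ≤ R / r := (one_le_div hr').2 hrR
  obtain ⟨k, hk1, hk2⟩ := exists_nat_pow_near h1 (show (1 : ℝ) < 8 by norm_num)
  have h3 : ∀ k : ℕ, θ ^ k * f r ≤ f (8 ^ k * r) := by
    intro k
    induction k with
    | zero => simp
    | succ k ih =>
      have h4 := hd (8 ^ k * r) (hr.trans (le_mul_of_one_le_left hr'.le (one_le_pow₀ (by norm_num))))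
      calc θ ^ (k + 1) * f r = θ * (θ ^ k * f r) := by ring
        _ ≤ θ * f (8 ^ k * r) := mul_le_mul_of_nonneg_left ih (zero_le_one.trans hθ)
        _ ≤ f (8 * (8 ^ k * r)) := h4
        _ = f (8 ^ (k + 1) * r) := by ring_nf
  have h5 : θ ^ k ≤ f R / f r := by
    rw [le_div_iff₀ (hf r hr')]
    refine (h3 k).trans (hmono _ _ ?_)
    rwa [le_div_iff₀ hr'] at hk1
  calc R / r ≤ 8 ^ (k + 1) := hk2.le
    _ = 8 * 8 ^ k := by ring
    _ ≤ 8 * (θ ^ m) ^ k := by gcongr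
    _ = 8 * (θ ^ k) ^ m := by rw [← pow_mul, ← pow_mul, mul_comm m k]
    _ ≤ 8 * (f R / f r) ^ m := by
      have : 0 ≤ θ ^ k := pow_nonneg (zero_le_one.trans hθ) k
      gcongr

/-- From exp s ≥ s ^ k / k! with k γ ≥ a. All polynomial losses from doubling are absorbed through
this. -/
theorem exists_pow_mul_exp_le (a : ℕ) {c γ : ℝ} (hc : 0 < c) (hγ : 0 < γ) :
    ∃ C : ℝ, 1 ≤ C ∧ ∀ t : ℝ, 0 ≤ t → (1 + t) ^ a * Real.exp (-(c * t ^ γ)) ≤ C := by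
  obtain ⟨k, hk⟩ := exists_nat_ge (a / γ)
  rw [div_le_iff₀ hγ] at hk
  refine ⟨2 ^ a * (1 + k.factorial / c ^ k), ?_, fun t ht => ?_⟩
  · have h1 : (1 : ℝ) ≤ 2 ^ a := one_le_pow₀ (by norm_num)
    have h2 : (0 : ℝ) ≤ k.factorial / c ^ k := by positivity
    nlinarith
  have hts : 0 ≤ c * t ^ γ := mul_nonneg hc.le (Real.rpow_nonneg ht γ)
  have hexp : Real.exp (-(c * t ^ γ)) ≤ 1 := Real.exp_le_one_iff.2 (by linarith)
  have hpos : (0 : ℝ) ≤ k.factorial / c ^ k := by positivity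
  rcases le_total t 1 with h | h
  · calc (1 + t) ^ a * Real.exp (-(c * t ^ γ)) ≤ 2 ^ a * 1 := by
          gcongr; linarith
      _ ≤ 2 ^ a * (1 + k.factorial / c ^ k) := by gcongr; linarith
  · have h1 : (c * t ^ γ) ^ k / k.factorial ≤ Real.exp (c * t ^ γ) :=
      Real.pow_div_factorial_le_exp _ hts k
    have h2 : t ^ a ≤ (t ^ γ) ^ k := by
      rw [← Real.rpow_natCast, ← Real.rpow_natCast, ← Real.rpow_mul ht]
      exact Real.rpow_le_rpow_of_exponent_le h (by linarith)
    have h3 : t ^ a ≤ k.factorial / c ^ k * Real.exp (c * t ^ γ) := by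
      rw [mul_pow, div_le_iff₀ (by positivity)] at h1
      rw [div_mul_eq_mul_div, le_div_iff₀ (by positivity)]
      nlinarith [pow_pos hc k]
    calc (1 + t) ^ a * Real.exp (-(c * t ^ γ)) ≤ (2 * t) ^ a * Real.exp (-(c * t ^ γ)) := by
          gcongr; linarith
      _ = 2 ^ a * (t ^ a * Real.exp (-(c * t ^ γ))) := by rw [mul_pow]; ring
      _ ≤ 2 ^ a * (k.factorial / c ^ k * Real.exp (c * t ^ γ) * Real.exp (-(c * t ^ γ))) := by
          gcongr
      _ = 2 ^ a * (k.factorial / c ^ k) := by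
          rw [mul_assoc (k.factorial / c ^ k : ℝ), ← Real.exp_add]; simp
      _ ≤ 2 ^ a * (1 + k.factorial / c ^ k) := by gcongr; linarith

variable {Γ : Type*} (W : WeightedGraph Γ)

/-! ### Basic properties of mean exit times from balls -/

section

variable [Infinite Γ] [Countable Γ] [MeasurableSpace Γ] [MeasurableSingletonClass Γ]
  (hp : W.ControlledWeights)

omit [Infinite Γ] in
theorem E_nonneg [Nontrivial Γ] (x : Γ) (R : ℝ) : 0 ≤ W.E x R := ENNReal.toReal_nonneg

include hp

theorem E_mono (x : Γ) {R S : ℝ} (h : R ≤ S) : W.E x R ≤ W.E x S := by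
  rcases le_or_gt R 0 with hR | hR
  · rw [W.E_eq_zero x hR]; exact W.E_nonneg x S
  · rw [W.E_eq_meanExit hp x hR, W.E_eq_meanExit hp x (hR.trans_le h)]
    exact W.meanExit_mono hp (W.ballF_mono hp h) x

theorem E_le_meanExit {x y : Γ} {R S : ℝ} (hR : 0 < R) (h : W.dist x y + R ≤ S) :
    W.E y R ≤ W.meanExit (W.ballF x S) y := by
  rw [W.E_eq_meanExit hp y hR]
  exact W.meanExit_mono hp (W.ballF_subset hp h) y

theorem meanExit_le_E {x y : Γ} {R : ℝ} (hR : 0 < R) (hy : y ∈ W.ballF x R) :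
    W.meanExit (W.ballF x R) y ≤ W.E y (2 * R) := by
  rw [W.E_eq_meanExit hp y (by linarith), two_mul]
  exact W.meanExit_mono hp (W.ballF_subset_of_mem hp hy) y

theorem one_le_E (x : Γ) {R : ℝ} (hR : 0 < R) : 1 ≤ W.E x R := by
  rw [W.E_eq_meanExit hp x hR]
  exact W.one_le_meanExit hp (W.self_mem_ballF hp hR)

theorem E_pos (x : Γ) {R : ℝ} (hR : 0 < R) : 0 < W.E x R := zero_lt_one.trans_le (W.one_le_E hp x hR)

/-- A step moves the walk by distance at most one, so no path leaves before time R. Hence the set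
defining `e x n` is nonempty. -/
theorem le_E (x : Γ) (R : ℝ) : R ≤ W.E x R := by
  rcases le_or_gt R 0 with hR | hR
  · exact hR.trans (W.E_nonneg x R)
  rw [W.E_eq_meanExit hp x hR]
  refine (Nat.le_ceil R).trans ?_
  refine le_trans ?_ (W.sum_surv_le_meanExit hp (W.ballF x R) x ⌈R⌉₊)
  rw [Finset.sum_congr rfl fun n hn => W.surv_ballF_eq_one hp
    (Nat.lt_ceil.1 (Finset.mem_range.1 hn))]
  simp

/-- A ball of radius at most 1 is a single point, where the walk can wait only on a loop; each step
leaves with probability at least p. -/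
theorem exists_E_one_le : ∃ C : ℝ, 1 ≤ C ∧ ∀ (x : Γ) (R : ℝ), R ≤ 1 → W.E x R ≤ C := by
  have hp' := hp
  obtain ⟨p, hp0, hp1⟩ := hp'
  have hle1 : p ≤ 1 := W.le_one_of_le_P hp1 (Classical.arbitrary Γ)
  refine ⟨1 / p, (one_le_div hp0).2 hle1, fun x R hR => ?_⟩
  refine (W.E_mono hp x hR).trans ?_
  rw [W.E_eq_meanExit hp x one_pos, W.ballF_one hp one_pos le_rfl]
  obtain ⟨y, hy⟩ := W.exists_dist_eq hp x 1
  have hxy : y ∉ ({x} : Finset Γ) := by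
    rw [Finset.mem_singleton]
    rintro rfl
    rw [W.dist_self] at hy
    exact zero_ne_one hy
  have h1 := W.surv_le_of_path hp0 hp1 hxy 1 x hy
  rw [pow_one] at h1
  have h2 : ∀ n, W.surv {x} n x ≤ (1 - p) ^ n := by
    intro n
    have := W.surv_mul_le (A := {x}) (D := 1) (q := 1 - p) (by linarith) (fun z hz => by
      rw [Finset.mem_singleton.1 hz]; exact h1) n x
    simpa using this
  have h3 := tsum_geometric_of_lt_one (show 0 ≤ 1 - p by linarith) (by linarith)
  rw [sub_sub_cancel] at h3
  rw [one_div, ← h3]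
  exact (W.summable_surv hp _ x).tsum_le_tsum h2
    (summable_geometric_of_lt_one (by linarith) (by linarith))

/-! ### Consequences of volume doubling and the time comparison principle -/

theorem TC.exists_le (hT : W.TC) : ∃ C : ℝ, 1 ≤ C ∧ ∀ (x y : Γ) (R : ℝ), 0 < R →
    y ∈ W.ballF x R → W.E x (2 * R) ≤ C * W.E y R := by
  obtain ⟨C, hC, h⟩ := hT
  refine ⟨C, hC.le, fun x y R hR hy => ?_⟩
  rw [← Finset.mem_coe, W.coe_ballF hp] at hy
  exact (div_le_iff₀ (W.E_pos hp y hR)).1 (h x R hR y hy)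

omit [Countable Γ] [MeasurableSpace Γ] [MeasurableSingletonClass Γ] in
theorem VD.exists_le (hV : W.VD) : ∃ D : ℝ, 1 ≤ D ∧ ∀ (x : Γ) (R : ℝ), 0 < R →
    W.vol x (2 * R) ≤ D * W.vol x R := by
  obtain ⟨D, -, h⟩ := hV
  refine ⟨max D 1, le_max_right _ _, fun x R hR => (h x R hR).trans ?_⟩
  exact mul_le_mul_of_nonneg_right (le_max_left _ _) (W.vol_pos hp hR).le

/-- For w in B(x,R), the ball lies in B(w,2R), and (TC) compares E(w,2R) with E(x,R). Thus the
centre is, up to a constant, the best starting point. -/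
theorem TC.exists_meanExit_le (hT : W.TC) : ∃ C : ℝ, 1 ≤ C ∧ ∀ (x w : Γ) (R : ℝ), 0 < R →
    W.meanExit (W.ballF x R) w ≤ C * W.E x R := by
  obtain ⟨C, hC, h⟩ := TC.exists_le W hp hT
  refine ⟨C, hC, fun x w R hR => ?_⟩
  by_cases hw : w ∈ W.ballF x R
  · exact (W.meanExit_le_E hp hR hw).trans (h w x R hR ((W.mem_ballF_comm hp).1 hw))
  · rw [W.meanExit_eq_zero hw]
    exact mul_nonneg (zero_le_one.trans hC) (W.E_nonneg x R)

/-- The centre y may range over the doubled ball, which costs two further doublings. The exponent is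
taken at least 2 because it becomes β in the exit time tail. -/
theorem TC.exists_pow (hT : W.TC) : ∃ (C : ℝ) (b : ℕ), 1 ≤ C ∧ 2 ≤ b ∧ ∀ (x y : Γ) (R r : ℝ),
    0 < r → r ≤ R → y ∈ W.ballF x (2 * R) → W.E x R ≤ C * (R / r) ^ b * W.E y r := by
  obtain ⟨C, hC, h⟩ := TC.exists_le W hp hT
  obtain ⟨b, hb⟩ := pow_unbounded_of_one_lt C (show (1 : ℝ) < 2 by norm_num)
  have hb' : C ≤ 2 ^ (b + 2) := hb.le.trans (pow_le_pow_right₀ (by norm_num) (by omega))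
  have h2 : ∀ y r, 0 < r → W.E y (2 * r) ≤ C * W.E y r :=
    fun y r hr => h y y r hr (W.self_mem_ballF hp hr)
  have hC0 : 0 ≤ C := zero_le_one.trans hC
  refine ⟨C * C * C, b + 2, one_le_mul_of_one_le_of_one_le (one_le_mul_of_one_le_of_one_le hC hC) hC,
    by omega, fun x y R r hr hrR hy => ?_⟩
  have hR : 0 < R := hr.trans_le hrR
  have h3 := doubling_pow (f := W.E y) hC hb' (fun _ _ h => W.E_mono hp y h) (W.E_nonneg y)
    (h2 y) hr hrR
  calc W.E x R ≤ W.E x (2 * (2 * R)) := W.E_mono hp x (by linarith)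
    _ ≤ C * W.E y (2 * R) := h x y _ (by linarith) hy
    _ ≤ C * (C * W.E y R) := mul_le_mul_of_nonneg_left (h2 y R hR) hC0
    _ ≤ C * (C * (C * (R / r) ^ (b + 2) * W.E y r)) := by gcongr
    _ = C * C * C * (R / r) ^ (b + 2) * W.E y r := by ring

omit [Countable Γ] [MeasurableSpace Γ] [MeasurableSingletonClass Γ] in
theorem VD.exists_pow (hV : W.VD) : ∃ (D : ℝ) (a : ℕ), 1 ≤ D ∧ ∀ (x y : Γ) (R r : ℝ),
    0 < r → r ≤ R → y ∈ W.ballF x (2 * R) → W.vol x R ≤ D * (R / r) ^ a * W.vol y r := by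
  obtain ⟨D, hD, h⟩ := VD.exists_le W hp hV
  obtain ⟨a, ha⟩ := pow_unbounded_of_one_lt D (show (1 : ℝ) < 2 by norm_num)
  have hD0 : 0 ≤ D := zero_le_one.trans hD
  refine ⟨D * D * D, a, one_le_mul_of_one_le_of_one_le (one_le_mul_of_one_le_of_one_le hD hD) hD,
    fun x y R r hr hrR hy => ?_⟩
  have hR : 0 < R := hr.trans_le hrR
  have hnn : ∀ r, 0 ≤ W.vol y r := fun r => by
    rw [W.vol_eq hp]; exact Finset.sum_nonneg fun z _ => (W.mu_pos z).le
  have h3 := doubling_pow (f := W.vol y) hD ha.le (fun _ _ h => W.vol_mono hp h) hnn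
    (h y) hr hrR
  have h4 : W.vol x R ≤ W.vol y (2 * (2 * R)) := by
    refine W.vol_le_vol hp ?_
    rw [W.mem_ballF hp, W.dist_comm] at hy
    linarith
  calc W.vol x R ≤ W.vol y (2 * (2 * R)) := h4
    _ ≤ D * W.vol y (2 * R) := h y _ (by linarith)
    _ ≤ D * (D * W.vol y R) := mul_le_mul_of_nonneg_left (h y R hR) hD0
    _ ≤ D * (D * (D * (R / r) ^ a * W.vol y r)) := by gcongr
    _ = D * D * D * (R / r) ^ a * W.vol y r := by ring

/-- The mean exit times of B(x,8R) and B(x,R) differ by a harmonic function on B(x,R). At a boundary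
point w, within 2R of x, it is at least E(w,2R), which (TC) bounds below by E(x,R)/C. The maximum
principle carries the bound to x. -/
theorem TC.exists_growth (hT : W.TC) : ∃ θ : ℝ, 1 < θ ∧ ∀ (x : Γ) (R : ℝ), 1 ≤ R →
    θ * W.E x R ≤ W.E x (8 * R) := by
  obtain ⟨C, hC, h⟩ := TC.exists_le W hp hT
  have hC0 : 0 < C := zero_lt_one.trans_le hC
  refine ⟨1 + 1 / C, by simp [hC0], fun x R hR => ?_⟩
  have hR0 : 0 < R := by linarith
  set U := W.ballF x R
  set Ω := W.ballF x (8 * R)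
  have hU : U ⊆ Ω := W.ballF_mono hp (by linarith)
  set a := W.E x R / C
  have hx : x ∈ U := W.self_mem_ballF hp hR0
  have hnear : ∀ z ∈ U, ∀ w, W.Adj z w → (W.dist x w : ℝ) < 2 * R := by
    intro z hz w hw
    have h1 := W.dist_triangle_real x z w
    have h2 : (W.dist z w : ℝ) ≤ 1 := by exact_mod_cast W.dist_le_one hw
    have h3 := (W.mem_ballF hp).1 hz
    linarith
  have key := W.nonpos_of_subharmonic hp hU (F := fun z => W.meanExit U z + a - W.meanExit Ω z)
    (fun z hz => ?_) (fun w hw hz => ?_) hx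
  · rw [W.E_eq_meanExit hp x (by linarith : 0 < 8 * R)]
    have : (1 + 1 / C) * W.E x R = W.E x R + a := by simp only [a]; ring
    rw [this]
    rw [← W.E_eq_meanExit hp x hR0] at key
    linarith
  · rw [W.meanExit_eq hp hz, W.meanExit_eq hp (hU hz)]
    have h1 : ∑ y ∈ U, W.P z y * W.meanExit U y = ∑ y ∈ Ω, W.P z y * W.meanExit U y :=
      Finset.sum_subset hU fun y _ hy => by rw [W.meanExit_eq_zero hy, mul_zero]
    have h2 : ∑ y ∈ Ω, W.P z y = 1 := W.sum_P_eq_one fun y hy => (W.mem_ballF hp).2 (by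
      have := hnear z hz y hy
      linarith)
    rw [h1]
    simp_rw [mul_sub, mul_add, Finset.sum_sub_distrib, Finset.sum_add_distrib, ← Finset.sum_mul, h2]
    linarith
  · obtain ⟨z, hz, hzw⟩ := hz
    have hd := hnear z hz w hzw
    have h1 : W.E w (2 * R) ≤ W.meanExit Ω w := W.E_le_meanExit hp (by linarith) (by linarith)
    have h2 : W.E x (2 * (2 * R)) ≤ C * W.E w (2 * R) :=
      h x w _ (by linarith) ((W.mem_ballF hp).2 hd)
    have h3 := W.E_mono hp x (show R ≤ 2 * (2 * R) by linarith)
    have h4 : a ≤ W.E w (2 * R) := by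
      rw [div_le_iff₀ hC0]; linarith
    rw [W.meanExit_eq_zero hw]
    linarith

theorem TC.exists_ratio_le (hT : W.TC) : ∃ m : ℕ, ∀ (x : Γ) (R r : ℝ), 1 ≤ r → r ≤ R →
    R / r ≤ 8 * (W.E x R / W.E x r) ^ m := by
  obtain ⟨θ, hθ, h⟩ := TC.exists_growth W hp hT
  obtain ⟨m, hm⟩ := pow_unbounded_of_one_lt 8 hθ
  exact ⟨m, fun x R r hr hrR => growth_pow hθ.le hm.le (fun _ _ h => W.E_mono hp x h) one_pos
    (fun r hr => W.E_pos hp x hr) (h x) hr hrR⟩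

/-! ### The inverse of the mean exit time -/

theorem le_E_e (x : Γ) (n : ℕ) : (n : ℝ) ≤ W.E x (W.e x n) :=
  Nat.sInf_mem (s := {R : ℕ | (n : ℝ) ≤ W.E x R}) ⟨n, W.le_E hp x n⟩

omit hp in
theorem E_lt_of_lt_e {x : Γ} {n r : ℕ} (h : r < W.e x n) : W.E x r < n := by
  have := Nat.notMem_of_lt_sInf (s := {R : ℕ | (n : ℝ) ≤ W.E x R}) h
  exact not_le.1 this

theorem e_pos (x : Γ) {n : ℕ} (hn : 0 < n) : 0 < W.e x n := by
  rcases Nat.eq_zero_or_pos (W.e x n) with h | h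
  · have h1 := W.le_E_e hp x n
    rw [h, Nat.cast_zero, W.E_eq_zero x le_rfl] at h1
    have : (0 : ℝ) < n := by exact_mod_cast hn
    linarith
  · exact h

theorem one_le_e (x : Γ) {n : ℕ} (hn : 0 < n) : (1 : ℝ) ≤ W.e x n := by
  exact_mod_cast W.e_pos hp x hn

theorem e_mono (x : Γ) {m n : ℕ} (h : m ≤ n) : W.e x m ≤ W.e x n := by
  refine Nat.sInf_le ?_
  have h1 := W.le_E_e hp x n
  have h2 : (m : ℝ) ≤ n := by exact_mod_cast h
  exact h2.trans h1

theorem e_one (x : Γ) : W.e x 1 = 1 := by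
  refine le_antisymm (Nat.sInf_le ?_) (W.e_pos hp x one_pos)
  have := W.one_le_E hp x one_pos
  simpa using this

theorem vol_e_pos (x : Γ) {n : ℕ} (hn : 0 < n) : 0 < W.vol x (W.e x n) :=
  W.vol_pos hp (by exact_mod_cast W.e_pos hp x hn)

theorem TC.exists_E_e_le (hT : W.TC) : ∃ C : ℝ, 1 ≤ C ∧ ∀ (x : Γ) (n : ℕ), 0 < n →
    W.E x (W.e x n) ≤ C * n := by
  obtain ⟨C, hC, h⟩ := TC.exists_le W hp hT
  obtain ⟨C₁, hC₁, h₁⟩ := W.exists_E_one_le hp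
  refine ⟨max C C₁, hC.trans (le_max_left _ _), fun x n hn => ?_⟩
  have hn1 : (1 : ℝ) ≤ n := by exact_mod_cast hn
  have he := W.e_pos hp x hn
  rcases Nat.lt_or_ge (W.e x n) 2 with h2 | h2
  · have h3 : W.e x n = 1 := by omega
    rw [h3, Nat.cast_one]
    calc W.E x 1 ≤ C₁ := h₁ x 1 le_rfl
      _ ≤ max C C₁ := le_max_right _ _
      _ ≤ max C C₁ * n := le_mul_of_one_le_right (by positivity) hn1
  -- Here e(x,n) is at most twice its predecessor, whose mean exit time is still below n.
  · obtain ⟨k, hk⟩ := Nat.exists_eq_add_of_le' h2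
    have h3 : W.E x (k + 1 : ℕ) < n := W.E_lt_of_lt_e (by omega)
    have h4 := h x x (k + 1 : ℕ) (by positivity) (W.self_mem_ballF hp (by positivity))
    have h5 : W.E x (W.e x n) ≤ W.E x (2 * (k + 1 : ℕ)) := by
      refine W.E_mono hp x ?_
      rw [hk]
      push_cast
      have : (0 : ℝ) ≤ k := Nat.cast_nonneg k
      linarith
    calc W.E x (W.e x n) ≤ C * W.E x (k + 1 : ℕ) := h5.trans h4
      _ ≤ max C C₁ * n := mul_le_mul (le_max_left _ _) h3.le (W.E_nonneg _ _)
        (zero_le_one.trans (hC.trans (le_max_left _ _)))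

theorem exists_vol_le_vol_e (hV : W.VD) (hT : W.TC) : ∃ (C : ℝ) (a : ℕ), 1 ≤ C ∧
    ∀ (x : Γ) (R : ℝ) (n : ℕ), 0 < n →
      W.vol x R ≤ C * (1 + W.E x R / n) ^ a * W.vol x (W.e x n) := by
  obtain ⟨D, a, hD, h⟩ := VD.exists_pow W hp hV
  obtain ⟨m, hm⟩ := TC.exists_ratio_le W hp hT
  refine ⟨D * 8 ^ a, m * a, one_le_mul_of_one_le_of_one_le hD (one_le_pow₀ (by norm_num)),
    fun x R n hn => ?_⟩
  have hn0 : (0 : ℝ) < n := by exact_mod_cast hn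
  have he := W.one_le_e hp x hn
  have hv := W.vol_e_pos hp x hn
  have hE : 0 ≤ W.E x R / n := div_nonneg (W.E_nonneg x R) hn0.le
  have h8 : (1 : ℝ) ≤ D * 8 ^ a := one_le_mul_of_one_le_of_one_le hD (one_le_pow₀ (by norm_num))
  rcases le_total R (W.e x n) with hR | hR
  · refine (W.vol_mono hp hR).trans (le_mul_of_one_le_left hv.le ?_)
    exact one_le_mul_of_one_le_of_one_le h8 (one_le_pow₀ (by linarith))
  · have hR0 : 0 < R := by linarith
    have h1 := h x x R (W.e x n) (by linarith) hR (W.self_mem_ballF hp (by linarith))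
    refine h1.trans (mul_le_mul_of_nonneg_right ?_ hv.le)
    have h2 := hm x R (W.e x n) he hR
    have h3 : W.E x R / W.E x (W.e x n) ≤ 1 + W.E x R / n := by
      have : W.E x R / W.E x (W.e x n) ≤ W.E x R / n :=
        div_le_div_of_nonneg_left (W.E_nonneg x R) hn0 (W.le_E_e hp x n)
      linarith
    have h4 : R / W.e x n ≤ 8 * (1 + W.E x R / n) ^ m := by
      refine h2.trans ?_
      have : 0 ≤ W.E x R / W.E x (W.e x n) := div_nonneg (W.E_nonneg _ _) (W.E_nonneg _ _)
      gcongr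
    have h5 : 0 ≤ R / W.e x n := div_nonneg hR0.le (by linarith)
    calc D * (R / W.e x n) ^ a ≤ D * (8 * (1 + W.E x R / n) ^ m) ^ a := by gcongr
      _ = D * 8 ^ a * (1 + W.E x R / n) ^ (m * a) := by rw [mul_pow, pow_mul]; ring

end

end WeightedGraph
end

noncomputable section

namespace WeightedGraph

variable {Γ : Type*} (W : WeightedGraph Γ)

/-! ### The tail of the exit time from a ball -/

/-- The sum is a truncated Laplace transform of the exit time T at l. Exits up to time m cost at
most P(T ≤ m), later ones at most exp(-l(m+1)). -/
theorem sum_surv_sub_mul_exp_le [Nontrivial Γ] {U : Finset Γ} {z : Γ} (hz : z ∈ U) {l ε : ℝ}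
    {m : ℕ} (hl : 0 ≤ l) (hε : 0 ≤ ε) (hm : Real.exp (-(l * (m + 1))) ≤ ε) (n : ℕ) :
    ∑ j ∈ Finset.range n, (W.surv U j z - W.surv U (j + 1) z) * Real.exp (-(l * (j + 1)))
      ≤ 1 - W.surv U m z + ε := by
  have hd : ∀ j, 0 ≤ W.surv U j z - W.surv U (j + 1) z := fun j =>
    sub_nonneg.2 (W.surv_antitone U z (Nat.le_succ j))
  have h1 : ∑ j ∈ Finset.range n, (W.surv U j z - W.surv U (j + 1) z) * Real.exp (-(l * (j + 1)))
      ≤ ∑ j ∈ Finset.range (m + n),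
        (W.surv U j z - W.surv U (j + 1) z) * Real.exp (-(l * (j + 1))) :=
    Finset.sum_le_sum_of_subset_of_nonneg (Finset.range_mono (Nat.le_add_left n m))
      fun j _ _ => mul_nonneg (hd j) (Real.exp_pos _).le
  rw [Finset.sum_range_add] at h1
  have h2 : ∑ j ∈ Finset.range m, (W.surv U j z - W.surv U (j + 1) z) * Real.exp (-(l * (j + 1)))
      ≤ 1 - W.surv U m z := by
    rw [← W.sum_surv_sub U m hz]
    refine Finset.sum_le_sum fun j _ => mul_le_of_le_one_right (hd j) ?_
    rw [Real.exp_le_one_iff]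
    have : 0 ≤ l * (j + 1) := by positivity
    linarith
  have h3 : ∑ j ∈ Finset.range n, (W.surv U (m + j) z - W.surv U (m + j + 1) z)
      * Real.exp (-(l * ((m + j : ℕ) + 1))) ≤ ε := by
    have h4 : ∑ j ∈ Finset.range n, (W.surv U (m + j) z - W.surv U (m + j + 1) z)
        * Real.exp (-(l * ((m + j : ℕ) + 1)))
        ≤ ∑ j ∈ Finset.range n, (W.surv U (m + j) z - W.surv U (m + (j + 1)) z) * ε := by
      refine Finset.sum_le_sum fun j _ => mul_le_mul_of_nonneg_left ?_ (hd (m + j))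
      refine le_trans (Real.exp_le_exp.2 ?_) hm
      push_cast
      have : 0 ≤ l * j := by positivity
      linarith
    rw [← Finset.sum_mul, Finset.sum_range_sub' (fun j => W.surv U (m + j) z)] at h4
    refine h4.trans (mul_le_of_le_one_left hε ?_)
    have := W.surv_le_one U (m + 0) z
    have := W.surv_nonneg U (m + n) z
    linarith
  linarith

/-- An exponential Chebyshev bound iterated along the path: before leaving B(x,R) the walk must
leave k successive balls of radius r, each contributing a factor ρ. The comparison in
`le_of_subcaloric`, with exp(l n) ρ ^ k as boundary value, performs the convolution over exit times.
-/
theorem one_sub_surv_le_of_chain [Infinite Γ] (hp : W.ControlledWeights) {x : Γ} {R l ρ : ℝ} {r : ℕ}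
    (hr : 1 ≤ r) (hl : 0 ≤ l) (hρ0 : 0 ≤ ρ)
    (hρ : ∀ z ∈ W.ballF x R, ∀ n, ∑ j ∈ Finset.range n, (W.surv (W.ballF z r) j z
      - W.surv (W.ballF z r) (j + 1) z) * Real.exp (-(l * (j + 1))) ≤ ρ) (k n : ℕ) (z : Γ)
    (hz : W.dist x z + k * r ≤ R) :
    1 - W.surv (W.ballF x R) n z ≤ Real.exp (l * n) * ρ ^ k := by
  set B := W.ballF x R
  have hr' : (1 : ℝ) ≤ r := by exact_mod_cast hr
  induction k generalizing n z with
  | zero =>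
    have h1 := W.surv_nonneg B n z
    have h2 : 1 ≤ Real.exp (l * n) := Real.one_le_exp (by positivity)
    rw [pow_zero, mul_one]
    linarith
  | succ k ih =>
    set U := W.ballF z r with hU
    set Ω := W.ballF x (R + 2)
    push_cast at hz
    have hk0 : (0 : ℝ) ≤ k * r := by positivity
    have hzB : z ∈ B := (W.mem_ballF hp).2 (by linarith)
    have hzU : z ∈ U := W.self_mem_ballF hp (by linarith)
    have hUB : U ⊆ B := W.ballF_subset hp (by linarith)
    have hBΩ : B ⊆ Ω := W.ballF_mono hp (by linarith)
    have hadj : ∀ y ∈ B, ∀ w, W.Adj y w → w ∈ Ω := by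
      intro y hy w hw
      have h1 := W.dist_triangle_real x y w
      have h2 : (W.dist y w : ℝ) ≤ 1 := by exact_mod_cast W.dist_le_one hw
      have h3 := (W.mem_ballF hp).1 hy
      exact (W.mem_ballF hp).2 (by linarith)
    have key := W.le_of_subcaloric (N := n) (hUB.trans hBΩ) (F := fun n y => 1 - W.surv B n y)
      (G := fun n => Real.exp (l * n) * ρ ^ k) (fun n _ => by positivity) (by
        intro i _ y hy
        have h1 : ∑ v ∈ B, W.P y v * W.surv B i v = ∑ v ∈ Ω, W.P y v * W.surv B i v :=
          Finset.sum_subset hBΩ fun v _ hv => by rw [W.surv_eq_zero hv, mul_zero]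
        simp_rw [mul_sub, Finset.sum_sub_distrib, mul_one]
        rw [W.surv_succ (hUB hy), W.sum_P_eq_one (hadj y (hUB hy)), h1]) (by
        rintro i _ w - ⟨y, hy, hyw⟩
        refine ih i w ?_
        have h1 := W.dist_triangle_real x z w
        have h2 : W.dist z y < r := by exact_mod_cast (W.mem_ballF hp).1 hy
        have h3 := W.dist_le_one hyw
        have h4 := W.dist_triangle z y w
        have h5 : (W.dist z w : ℝ) ≤ r := by exact_mod_cast (by omega)
        linarith) le_rfl hzU
    have h0 : ∑ y ∈ U, W.ker U n z y * (1 - W.surv B 0 y) = 0 :=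
      Finset.sum_eq_zero fun y hy => by rw [W.surv_zero (hUB hy), sub_self, mul_zero]
    rw [h0, zero_add] at key
    refine key.trans ?_
    have h1 : ∀ j ∈ Finset.range n, (W.surv U j z - W.surv U (j + 1) z)
        * (Real.exp (l * (n - 1 - j : ℕ)) * ρ ^ k)
        = (Real.exp (l * n) * ρ ^ k) * ((W.surv U j z - W.surv U (j + 1) z)
          * Real.exp (-(l * (j + 1)))) := by
      intro j hj
      have hj' := Finset.mem_range.1 hj
      have h2 : ((n - 1 - j : ℕ) : ℝ) = n - (j + 1) := by
        rw [Nat.sub_sub, Nat.cast_sub (by omega)]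
        push_cast
        ring
      rw [h2, mul_sub, sub_eq_add_neg (l * n), Real.exp_add]
      ring
    rw [Finset.sum_congr rfl h1, ← Finset.mul_sum, pow_succ, ← mul_assoc]
    exact mul_le_mul_of_nonneg_left (hρ z hzB n) (by positivity)

variable [Infinite Γ] [Countable Γ] [MeasurableSpace Γ] [MeasurableSingletonClass Γ]
  (hp : W.ControlledWeights)
include hp

theorem TC.exists_le_surv (hT : W.TC) : ∃ θ : ℝ, 0 < θ ∧ θ ≤ 1 / 4 ∧ ∀ (x : Γ) (R : ℝ), 0 < R →
    ∀ m : ℕ, m ≤ W.E x R / 2 → 2 * θ ≤ W.surv (W.ballF x R) m x := by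
  obtain ⟨C, hC, h⟩ := TC.exists_meanExit_le W hp hT
  have hC0 : 0 < C := zero_lt_one.trans_le hC
  refine ⟨1 / (4 * C), by positivity, ?_, fun x R hR m hm => ?_⟩
  · rw [div_le_div_iff₀ (by positivity) (by norm_num)]
    linarith
  · have h1 := W.sub_le_surv_mul hp (fun z _ => h x z R hR) x m
    rw [← W.E_eq_meanExit hp x hR] at h1
    have hE := W.E_pos hp x hR
    have h2 : 2 * (1 / (4 * C)) = 1 / (2 * C) := by field_simp; norm_num
    rw [h2, div_le_iff₀ (by positivity)]
    have h3 : W.E x R * 1 ≤ W.E x R * (W.surv (W.ballF x R) m x * (2 * C)) := by linarith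
    exact le_of_mul_le_mul_left h3 hE

theorem exists_E_le_pow {C : ℝ} {b : ℕ} (hC : 1 ≤ C)
    (h : ∀ (x y : Γ) (R r : ℝ), 0 < r → r ≤ R → y ∈ W.ballF x (2 * R) →
      W.E x R ≤ C * (R / r) ^ b * W.E y r) :
    ∃ C' : ℝ, 1 ≤ C' ∧ (∀ (x : Γ) (R : ℝ), 1 ≤ R → W.E x R ≤ C' * R ^ b) ∧
      ∀ (x : Γ) (R : ℝ), R ≤ 1 → W.E x R ≤ C' := by
  obtain ⟨C₁, hC₁, h₁⟩ := W.exists_E_one_le hp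
  refine ⟨C * C₁, one_le_mul_of_one_le_of_one_le hC hC₁, fun x R hR => ?_, fun x R hR => ?_⟩
  · have h2 := h x x R 1 one_pos hR (W.self_mem_ballF hp (by linarith))
    have h3 := h₁ x 1 le_rfl
    rw [div_one] at h2
    calc W.E x R ≤ C * R ^ b * W.E x 1 := h2
      _ ≤ C * R ^ b * C₁ := by gcongr
      _ = C * C₁ * R ^ b := by ring
  · exact (h₁ x R hR).trans (le_mul_of_one_le_left (zero_le_one.trans hC₁) hC)

/-- The chain is applied with N balls of radius r = ⌊R/N⌋ and ρ = 1 - θ; the number N is left free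
for optimisation. -/
theorem exists_one_sub_surv_le_exp (hT : W.TC) {C₁ : ℝ} {b : ℕ} (hC₁ : 1 ≤ C₁)
    (h₁ : ∀ (x y : Γ) (R r : ℝ), 0 < r → r ≤ R → y ∈ W.ballF x (2 * R) →
      W.E x R ≤ C₁ * (R / r) ^ b * W.E y r) :
    ∃ K θ : ℝ, 0 < K ∧ 0 < θ ∧ ∀ (x : Γ) (R : ℝ) (N n : ℕ), 0 < N → N ≤ R →
      1 - W.surv (W.ballF x R) n x ≤ Real.exp (K * N ^ b * n / W.E x R - θ * N) := by
  obtain ⟨θ, hθ, hθ4, hsurv⟩ := TC.exists_le_surv W hp hT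
  obtain ⟨L, hL, hexpL⟩ : ∃ L : ℝ, 0 < L ∧ Real.exp (-L) = θ :=
    ⟨Real.log (1 / θ), Real.log_pos (by rw [one_lt_div hθ]; linarith), by
      rw [← Real.log_inv, Real.exp_log (by positivity)]; simp⟩
  refine ⟨2 * L * C₁ * 2 ^ b, θ, by positivity, hθ, fun x R N n hN hNR => ?_⟩
  have hN1 : (1 : ℝ) ≤ N := by exact_mod_cast hN
  have hN0' : (0 : ℝ) < N := by linarith
  have hR : 0 < R := by linarith
  have hE := W.E_pos hp x hR
  obtain ⟨r, hr1, hrle, hrge⟩ : ∃ r : ℕ, 1 ≤ r ∧ (r : ℝ) * N ≤ R ∧ R ≤ r * (2 * N) := by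
    have hRN : 1 ≤ R / N := (one_le_div hN0').2 hNR
    have hr1 : 1 ≤ ⌊R / N⌋₊ := Nat.le_floor (by simpa using hRN)
    have hr1' : (1 : ℝ) ≤ ⌊R / N⌋₊ := by exact_mod_cast hr1
    refine ⟨⌊R / N⌋₊, hr1, ?_, ?_⟩
    · rw [← le_div_iff₀ hN0']
      exact Nat.floor_le (by linarith)
    · have h2 : R / N < ⌊R / N⌋₊ + 1 := Nat.lt_floor_add_one _
      rw [div_lt_iff₀ hN0'] at h2
      nlinarith
  have hr1' : (1 : ℝ) ≤ r := by exact_mod_cast hr1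
  have hr0 : (0 : ℝ) < r := by linarith
  have hrR : (r : ℝ) ≤ R := le_trans (le_mul_of_one_le_right hr0.le hN1) hrle
  have hEz : ∀ z ∈ W.ballF x R, W.E x R ≤ C₁ * (2 * N) ^ b * W.E z r := by
    intro z hz
    have h3 : R / r ≤ 2 * N := by
      rw [div_le_iff₀ hr0]
      linarith
    have h4 : 0 ≤ R / r := by positivity
    have := W.E_nonneg z r
    exact (h₁ x z R r hr0 hrR (W.ballF_mono hp (by linarith) hz)).trans (by gcongr)
  -- Large enough that l E(z,r) ≥ 2L for all z in the ball. Then exits after time E(z,r)/2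
  -- contribute at most exp(-L) = θ, while earlier ones have probability at most 1 - 2θ.
  obtain ⟨l, hl⟩ : ∃ l : ℝ, l = 2 * L * (C₁ * (2 * N) ^ b) / W.E x R := ⟨_, rfl⟩
  have hl0 : 0 ≤ l := by rw [hl]; positivity
  have hlE : l * W.E x R = 2 * L * (C₁ * (2 * N) ^ b) := by
    rw [hl, div_mul_cancel₀ _ hE.ne']
  have hlz : ∀ z ∈ W.ballF x R, 2 * L ≤ l * W.E z r := by
    intro z hz
    have hM : 0 < C₁ * (2 * (N : ℝ)) ^ b := by positivity
    have h5 := mul_le_mul_of_nonneg_left (hEz z hz) hl0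
    rw [hlE] at h5
    refine le_of_mul_le_mul_right ?_ hM
    linarith
  have hchain := W.one_sub_surv_le_of_chain hp (x := x) (R := R) (l := l) (ρ := 1 - θ) hr1 hl0
    (by linarith) (fun z hz i => by
      have hmz : (⌊W.E z r / 2⌋₊ : ℝ) ≤ W.E z r / 2 :=
        Nat.floor_le (div_nonneg (W.E_nonneg z r) zero_le_two)
      have h2 := hsurv z r hr0 _ hmz
      have h3 : Real.exp (-(l * ((⌊W.E z r / 2⌋₊ : ℕ) + 1))) ≤ θ := by
        rw [← hexpL, Real.exp_le_exp, neg_le_neg_iff]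
        have h4 := mul_le_mul_of_nonneg_left (Nat.lt_floor_add_one (W.E z r / 2)).le hl0
        have h5 := hlz z hz
        linarith
      have h4 := W.sum_surv_sub_mul_exp_le (W.self_mem_ballF hp (x := z) (R := (r : ℝ)) hr0)
        hl0 hθ.le h3 i
      linarith) N n x (by
      rw [W.dist_self, Nat.cast_zero, zero_add]
      linarith)
  refine hchain.trans ?_
  have h5 : (1 - θ) ^ N ≤ Real.exp (-(θ * N)) := by
    have h6 : 1 - θ ≤ Real.exp (-θ) := by
      have := Real.add_one_le_exp (-θ)
      linarith
    calc (1 - θ) ^ N ≤ Real.exp (-θ) ^ N := pow_le_pow_left₀ (by linarith) h6 N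
      _ = Real.exp (-(θ * N)) := by rw [← Real.exp_nat_mul]; ring_nf
  have h7 : 2 * L * C₁ * 2 ^ b * N ^ b * n / W.E x R = l * n := by
    rw [hl, mul_pow]; ring
  rw [h7, sub_eq_add_neg (l * n), Real.exp_add]
  exact mul_le_mul_of_nonneg_left h5 (Real.exp_pos _).le

/-- The stretched exponential bound for the probability of leaving a ball early. -/
theorem TC.exists_one_sub_surv_le (hT : W.TC) : ∃ β C c : ℝ, 1 < β ∧ 1 ≤ C ∧ 0 < c ∧
    ∀ (x : Γ) (R : ℝ) (n : ℕ), 0 < R → 0 < n → 1 - W.surv (W.ballF x R) n x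
      ≤ C * Real.exp (-(c * (W.E x R / n) ^ (1 / (β - 1)))) := by
  obtain ⟨C₁, b, hC₁, hb, h₁⟩ := TC.exists_pow W hp hT
  obtain ⟨C₄, hC₄, h₄, h₄'⟩ := W.exists_E_le_pow hp hC₁ h₁
  obtain ⟨K, θ, hK0, hθ, hexp⟩ := W.exists_one_sub_surv_le_exp hp hT hC₁ h₁
  -- The first condition makes the growth term at most half of the gain θ N; the second ensures N ≤
  -- R.
  obtain ⟨c₂, hc₂0, hc₂K, hc₂C⟩ : ∃ c₂ : ℝ, 0 < c₂ ∧ c₂ * K ≤ θ / 2 ∧ c₂ * C₄ ≤ 1 / 2 := by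
    refine ⟨min (θ / 2 / K) (1 / 2 / C₄), lt_min (by positivity) (by positivity), ?_, ?_⟩
    · rw [← le_div_iff₀ hK0]; exact min_le_left _ _
    · rw [← le_div_iff₀ (by positivity)]; exact min_le_right _ _
  have hb1 : (1 : ℝ) < b := by exact_mod_cast hb
  obtain ⟨γ, hγ⟩ : ∃ γ : ℝ, γ = 1 / ((b : ℝ) - 1) := ⟨_, rfl⟩
  have hγ0 : 0 < γ := by rw [hγ]; exact one_div_pos.2 (by linarith)
  have hb' : ((b - 1 : ℕ) : ℝ) = b - 1 := by rw [Nat.cast_sub (by omega), Nat.cast_one]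
  refine ⟨b, Real.exp (θ / 2), θ / 2 * c₂ ^ γ, hb1, Real.one_le_exp (by positivity),
    by positivity, fun x R n hR hn => ?_⟩
  rw [← hγ]
  have hn0 : (0 : ℝ) < n := by exact_mod_cast hn
  have hE := W.E_pos hp x hR
  obtain ⟨t, ht⟩ : ∃ t, t = W.E x R / n := ⟨_, rfl⟩
  have ht0 : 0 < t := by rw [ht]; exact div_pos hE hn0
  have htn : W.E x R = t * n := by rw [ht, div_mul_cancel₀ _ hn0.ne']
  rw [← ht]
  -- The growth term is K N ^ b / t and the gain is θ N; they balance when N ^ (b - 1) is of order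
  -- t. The loss in rounding s down to N is paid by the constant exp(θ/2).
  obtain ⟨s, hs⟩ : ∃ s, s = (c₂ * t) ^ γ := ⟨_, rfl⟩
  have hs0 : 0 ≤ s := by rw [hs]; exact Real.rpow_nonneg (by positivity) γ
  have hspow : s ^ (b - 1) = c₂ * t := by
    rw [hs, ← Real.rpow_natCast, ← Real.rpow_mul (by positivity), hb', hγ,
      one_div_mul_cancel (by linarith), Real.rpow_one]
  have hst : s = c₂ ^ γ * t ^ γ := by rw [hs, Real.mul_rpow hc₂0.le ht0.le]
  obtain ⟨N, hNs, hsN⟩ : ∃ N : ℕ, (N : ℝ) ≤ s ∧ s < N + 1 :=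
    ⟨⌊s⌋₊, Nat.floor_le hs0, Nat.lt_floor_add_one s⟩
  suffices h : 1 - W.surv (W.ballF x R) n x ≤ Real.exp (-(θ / 2 * N)) by
    refine h.trans ?_
    rw [← Real.exp_add, Real.exp_le_exp, mul_assoc, ← hst]
    nlinarith
  rcases Nat.eq_zero_or_pos N with hN0 | hN0
  · rw [hN0, Nat.cast_zero, mul_zero, neg_zero, Real.exp_zero]
    have := W.surv_nonneg (W.ballF x R) n x
    linarith
  rcases lt_or_ge (n : ℝ) R with hnR | hnR
  · rw [W.surv_ballF_eq_one hp hnR, sub_self]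
    exact (Real.exp_pos _).le
  have hN1 : (1 : ℝ) ≤ N := by exact_mod_cast hN0
  have hs1 : 1 ≤ s := hN1.trans hNs
  have hc₂t : 1 ≤ c₂ * t := by rw [← hspow]; exact one_le_pow₀ hs1
  have hn1 : (1 : ℝ) ≤ n := by exact_mod_cast hn
  have hR1 : 1 ≤ R := by
    by_contra hR1
    have h2 := h₄' x R (not_le.1 hR1).le
    have h3 : t ≤ C₄ := by
      rw [ht, div_le_iff₀ hn0]
      exact h2.trans (le_mul_of_one_le_right (by linarith) hn1)
    have := mul_le_mul_of_nonneg_left h3 hc₂0.le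
    linarith
  -- E(x,R) is at most C₄ R ^ b and the walk needs n ≥ R steps to get out, so t is at most C₄ R ^ (b
  -- - 1).
  have hNR : (N : ℝ) ≤ R := by
    refine hNs.trans (le_of_pow_le_pow_left₀ (n := b - 1) (by omega) hR.le ?_)
    rw [hspow]
    have h2 : t ≤ C₄ * R ^ (b - 1) := by
      rw [ht, div_le_iff₀ hn0]
      calc W.E x R ≤ C₄ * R ^ b := h₄ x R hR1
        _ = C₄ * R ^ (b - 1) * R := by
          rw [mul_assoc, ← pow_succ, Nat.sub_add_cancel (by omega)]
        _ ≤ C₄ * R ^ (b - 1) * n := by gcongr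
    calc c₂ * t ≤ c₂ * (C₄ * R ^ (b - 1)) := by gcongr
      _ = c₂ * C₄ * R ^ (b - 1) := by ring
      _ ≤ 1 * R ^ (b - 1) := by gcongr; linarith
      _ = R ^ (b - 1) := one_mul _
  refine (hexp x R N n hN0 hNR).trans (Real.exp_le_exp.2 ?_)
  have h8 : K * (N : ℝ) ^ (b - 1) ≤ θ / 2 * t := by
    have h9 : (N : ℝ) ^ (b - 1) ≤ c₂ * t := by
      rw [← hspow]; exact pow_le_pow_left₀ (by linarith) hNs _
    calc K * (N : ℝ) ^ (b - 1) ≤ K * (c₂ * t) := by gcongr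
      _ = c₂ * K * t := by ring
      _ ≤ θ / 2 * t := by gcongr
  have h10 : K * (N : ℝ) ^ b * n / W.E x R ≤ θ / 2 * N := by
    rw [htn, mul_div_mul_right _ _ hn0.ne', div_le_iff₀ ht0]
    calc K * (N : ℝ) ^ b = K * (N : ℝ) ^ (b - 1) * N := by
          rw [mul_assoc, ← pow_succ, Nat.sub_add_cancel (by omega)]
      _ ≤ θ / 2 * t * N := by gcongr
      _ = θ / 2 * N * t := by ring
  linarith

end WeightedGraph
end

noncomputable section

namespace WeightedGraph

variable {Γ : Type*} (W : WeightedGraph Γ)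

/-! ### From local to global diagonal upper estimates -/

/-- Boundedness is essential: the estimate is applied to the supremum, which must be finite for half
of it to be absorbed. -/
theorem le_two_mul_of_bootstrap {S : Set ℝ} (hS : S.Nonempty) (hb : BddAbove S) {C : ℝ}
    (h : ∀ A, (∀ s ∈ S, s ≤ A) → ∀ s ∈ S, s ≤ C + A / 2) : ∀ s ∈ S, s ≤ 2 * C := by
  have h1 := csSup_le hS (h (sSup S) fun s hs => le_csSup hb hs)
  intro s hs
  have h2 := le_csSup hb hs
  linarith

variable [Infinite Γ] [Countable Γ] [MeasurableSpace Γ] [MeasurableSingletonClass Γ]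

/-- The on-diagonal upper estimate for the walks killed on leaving balls. -/
def LocalDUE : Prop := ∀ ε : ℝ, 0 < ε → ∃ C : ℝ, 1 ≤ C ∧ ∀ (x : Γ) (R : ℝ) (n : ℕ), 0 < R →
  ε * W.E x R ≤ 2 * n → W.pk (W.ballF x R) (2 * n) x x ≤ C / W.vol x R

variable (hp : W.ControlledWeights)
include hp

/-- The factor 7 allows h = max ⌊s/2⌋ 1 with s ≥ ⌊n/2⌋: halving twice with rounding gives n ≤ 4⌊s/2⌋
+ 3. -/
theorem exists_vol_le_vol_e_of_dist_le (hV : W.VD) (hT : W.TC) : ∃ (C : ℝ) (a : ℕ), 1 ≤ C ∧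
    ∀ (x w : Γ) (R : ℝ) (n h : ℕ), 0 < R → 0 < n → n ≤ 7 * h → W.dist x w ≤ R →
      W.vol x R ≤ C * (1 + W.E x R / n) ^ a * W.vol w (W.e w h) := by
  obtain ⟨C, a, hC, h1⟩ := W.exists_vol_le_vol_e hp hV hT
  obtain ⟨C', b, hC', -, h2⟩ := TC.exists_pow W hp hT
  refine ⟨C * (7 * (C' * 2 ^ b)) ^ a, a, ?_, fun x w R n h hR hn hnh hd => ?_⟩
  · have h3 : (1 : ℝ) ≤ 2 ^ b := one_le_pow₀ (by norm_num)
    have h4 : 1 ≤ C' * 2 ^ b := one_le_mul_of_one_le_of_one_le hC' h3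
    exact one_le_mul_of_one_le_of_one_le hC (one_le_pow₀ (by linarith))
  have hn0 : (0 : ℝ) < n := by exact_mod_cast hn
  have hh : 0 < h := by omega
  have hh0 : (0 : ℝ) < h := by exact_mod_cast hh
  have hnh' : (n : ℝ) ≤ 7 * h := by exact_mod_cast hnh
  have h3 : W.vol x R ≤ W.vol w (2 * R) := W.vol_le_vol hp (by rw [W.dist_comm]; linarith)
  have h4 := h1 w (2 * R) h hh
  have h5 := h2 w x (2 * R) R hR (by linarith)
    ((W.mem_ballF hp).2 (by rw [W.dist_comm]; linarith))
  rw [mul_div_assoc, div_self hR.ne', mul_one] at h5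
  have hE := W.E_nonneg x R
  have h6 : 1 ≤ C' * 2 ^ b := one_le_mul_of_one_le_of_one_le hC' (one_le_pow₀ (by norm_num))
  have h7 : 1 + W.E w (2 * R) / h ≤ 7 * (C' * 2 ^ b) * (1 + W.E x R / n) := by
    have h8 : W.E w (2 * R) / h ≤ 7 * (C' * 2 ^ b) * (W.E x R / n) := by
      rw [mul_div_assoc', div_le_div_iff₀ hh0 hn0]
      calc W.E w (2 * R) * n ≤ C' * 2 ^ b * W.E x R * (7 * h) := by gcongr
        _ = _ := by ring
    linarith
  have h9 := W.vol_e_pos hp w hh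
  have h10 := W.E_nonneg w (2 * R)
  calc W.vol x R ≤ C * (1 + W.E w (2 * R) / h) ^ a * W.vol w (W.e w h) := h3.trans h4
    _ ≤ C * (7 * (C' * 2 ^ b) * (1 + W.E x R / n)) ^ a * W.vol w (W.e w h) := by gcongr
    _ = _ := by rw [mul_pow]; ring

theorem exists_vol_e_le_vol_e (hV : W.VD) (hT : W.TC) : ∃ (C : ℝ) (a : ℕ), 1 ≤ C ∧
    ∀ (x w : Γ) (R : ℝ) (n h : ℕ), 0 < n → n ≤ 7 * h → W.dist x w ≤ R →
      W.vol x (W.e x n) ≤ C * (1 + W.E x R / n) ^ a * W.vol w (W.e w h) := by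
  obtain ⟨C, a, hC, h1⟩ := W.exists_vol_le_vol_e_of_dist_le hp hV hT
  obtain ⟨C', hC', h2⟩ := TC.exists_E_e_le W hp hT
  refine ⟨C * (1 + C') ^ a, a, ?_, fun x w R n h hn hnh hd => ?_⟩
  · exact one_le_mul_of_one_le_of_one_le hC (one_le_pow₀ (by linarith))
  have hn0 : (0 : ℝ) < n := by exact_mod_cast hn
  have he := W.one_le_e hp x hn
  have hE := W.E_nonneg x R
  have hv := W.vol_e_pos hp w (show 0 < h by omega)
  -- S is the larger of R and e(x,n), and the mean exit time at scale e(x,n) is of order n.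
  obtain ⟨S, hS1, hS2, hS3, hS4⟩ : ∃ S : ℝ, 0 < S ∧ (W.e x n : ℝ) ≤ S ∧ R ≤ S ∧
      W.E x S ≤ C' * n + W.E x R := by
    rcases le_total R (W.e x n) with h | h
    · exact ⟨W.e x n, by linarith, le_rfl, h, (h2 x n hn).trans (by linarith)⟩
    · exact ⟨R, by linarith, h, le_rfl, le_add_of_nonneg_left (by positivity)⟩
  have h3 := (W.vol_mono hp hS2).trans (h1 x w S n h hS1 hn hnh (hd.trans hS3))
  have h4 : 1 + W.E x S / n ≤ (1 + C') * (1 + W.E x R / n) := by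
    have h5 : W.E x S / n ≤ C' + W.E x R / n := by
      rw [div_le_iff₀ hn0, add_mul, div_mul_cancel₀ _ hn0.ne']; exact hS4
    have h6 : 0 ≤ C' * (W.E x R / n) := by positivity
    linarith
  have h7 := W.E_nonneg x S
  calc W.vol x (W.e x n) ≤ C * (1 + W.E x S / n) ^ a * W.vol w (W.e w h) := h3
    _ ≤ C * ((1 + C') * (1 + W.E x R / n)) ^ a * W.vol w (W.e w h) := by gcongr
    _ = _ := by rw [mul_pow]; ring

/-- Polynomial factors are absorbed by the tail of the exit time. -/
theorem exists_pow_mul_one_sub_surv_le (hT : W.TC) (a : ℕ) : ∃ C : ℝ, 1 ≤ C ∧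
    ∀ (x : Γ) (R : ℝ) (n : ℕ), 0 < R → 0 < n →
      (1 + W.E x R / n) ^ a * (1 - W.surv (W.ballF x R) n x) ≤ C := by
  obtain ⟨β, C₁, c, hβ, hC₁, hc, h1⟩ := TC.exists_one_sub_surv_le W hp hT
  obtain ⟨C₂, hC₂, h2⟩ := exists_pow_mul_exp_le a hc (one_div_pos.2 (sub_pos.2 hβ))
  refine ⟨C₁ * C₂, one_le_mul_of_one_le_of_one_le hC₁ hC₂, fun x R n hR hn => ?_⟩
  have ht : 0 ≤ W.E x R / n := div_nonneg (W.E_nonneg x R) (Nat.cast_nonneg n)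
  calc (1 + W.E x R / n) ^ a * (1 - W.surv (W.ballF x R) n x)
      ≤ (1 + W.E x R / n) ^ a * (C₁ * Real.exp (-(c * (W.E x R / n) ^ (1 / (β - 1))))) := by
        gcongr
        exact h1 x R n hR hn
    _ = C₁ * ((1 + W.E x R / n) ^ a * Real.exp (-(c * (W.E x R / n) ^ (1 / (β - 1))))) := by ring
    _ ≤ C₁ * C₂ := by gcongr; exact h2 _ ht

/-- The bootstrap step. The main term of `pg_split` is the killed kernel, bounded by `LocalDUE`;
each of the two error terms is at most A/4. The index `max n 1` avoids e(x,0) = 0, whose ball is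
empty. -/
theorem exists_pg_mul_vol_le (hV : W.VD) (hT : W.TC) (hL : W.LocalDUE) : ∃ C : ℝ, 1 ≤ C ∧
    ∀ (N n : ℕ), n ≤ N → ∀ A : ℝ, (∀ k ≤ N, ∀ z, W.pg (2 * k) z z * W.vol z (W.e z (max k 1)) ≤ A) →
      ∀ x, W.pg (2 * n) x x * W.vol x (W.e x (max n 1)) ≤ C + A / 2 := by
  obtain ⟨C₁, a, hC₁, hvol⟩ := W.exists_vol_e_le_vol_e hp hV hT
  obtain ⟨C₂, hC₂, htail⟩ := W.exists_pow_mul_one_sub_surv_le hp hT (a + 1)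
  obtain ⟨C₃, hC₃, hEe⟩ := TC.exists_E_e_le W hp hT
  obtain ⟨K, hK⟩ := exists_nat_ge (4 * C₁ * C₂)
  have hK1 : (1 : ℝ) ≤ K := by
    have := one_le_mul_of_one_le_of_one_le hC₁ hC₂
    linarith
  have hK0 : (0 : ℝ) < K := by linarith
  obtain ⟨C, hC, hloc⟩ := hL (2 / (C₃ * K)) (by positivity)
  refine ⟨C, hC, fun N n hn A hA x => ?_⟩
  have hA0 : 0 ≤ A := by
    refine le_trans ?_ (hA 0 (Nat.zero_le _) x)
    exact mul_nonneg (W.pg_nonneg _ x x) (W.vol_e_pos hp x (by simp)).le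
  rcases Nat.eq_zero_or_pos n with rfl | hn0
  · rw [mul_zero, max_eq_right zero_le_one, W.e_one hp, Nat.cast_one, W.vol_one hp one_pos le_rfl]
    have h1 := mul_le_mul_of_nonneg_right (W.pg_le_inv_mu 0 x x) (W.mu_pos x).le
    rw [one_div_mul_cancel (W.mu_pos x).ne'] at h1
    linarith
  have hn0' : (0 : ℝ) < n := by exact_mod_cast hn0
  have hK1' : 1 ≤ K := by exact_mod_cast hK1
  have hKn : 0 < K * n := by positivity
  rw [max_eq_left hn0]
  have hv := W.vol_e_pos hp x hn0
  -- At this radius E(x,R) is comparable to K n: small enough for the local estimate at time 2n,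
  -- large enough that exit before time n is unlikely.
  obtain ⟨R, hRe⟩ : ∃ R : ℕ, R = W.e x (K * n) := ⟨_, rfl⟩
  have hR1 : (1 : ℝ) ≤ R := by rw [hRe]; exact W.one_le_e hp x hKn
  have hR0 : (0 : ℝ) < R := by linarith
  have hER : W.E x R ≤ C₃ * (K * n) := by
    rw [hRe]
    simpa using hEe x (K * n) hKn
  have hER' : K * n ≤ W.E x R := by
    rw [hRe]
    simpa using W.le_E_e hp x (K * n)
  have hvR : W.vol x (W.e x n) ≤ W.vol x R := by
    refine W.vol_mono hp ?_
    rw [hRe]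
    exact_mod_cast W.e_mono hp x (Nat.le_mul_of_pos_left n hK1')
  have hpk : W.pk (W.ballF x R) (2 * n) x x ≤ C / W.vol x (W.e x n) := by
    refine (hloc x R n hR0 ?_).trans (by gcongr)
    rw [div_mul_eq_mul_div, div_le_iff₀ (by positivity)]
    nlinarith
  obtain ⟨t, ht⟩ : ∃ t, t = W.E x R / n := ⟨_, rfl⟩
  have htK : K ≤ t := by rw [ht, le_div_iff₀ hn0']; exact hER'
  have ht0 : 0 ≤ t := hK0.le.trans htK
  obtain ⟨M, hM⟩ : ∃ M, M = A * (C₁ * (1 + t) ^ a) / W.vol x (W.e x n) := ⟨_, rfl⟩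
  have hM0 : 0 ≤ M := by rw [hM]; positivity
  have hbd : ∀ s, n ≤ s → s < n + n → ∀ w, w ∉ W.ballF x R → (∃ z ∈ W.ballF x R, W.Adj z w) →
      W.pg s w x ≤ M := by
    rintro s hs - w - ⟨z, hz, hzw⟩
    have hd : (W.dist x w : ℝ) ≤ R := by
      have h1 : W.dist x z < R := by exact_mod_cast (W.mem_ballF hp).1 hz
      have h2 := W.dist_le_one hzw
      have h3 := W.dist_triangle x z w
      exact_mod_cast (by omega : W.dist x w ≤ R)
    have hz : ∀ v, (W.dist x v : ℝ) ≤ R → W.pg (2 * (n / 2)) v v ≤ M := by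
      intro v hv'
      have h1 := hA (n / 2) (by omega) v
      have h2 := hvol x v R n (max (n / 2) 1) hn0 (by omega) hv'
      rw [← ht] at h2
      have h3 := W.pg_nonneg (2 * (n / 2)) v v
      rw [hM, le_div_iff₀ hv]
      calc W.pg (2 * (n / 2)) v v * W.vol x (W.e x n)
          ≤ W.pg (2 * (n / 2)) v v * (C₁ * (1 + t) ^ a * W.vol v (W.e v (max (n / 2) 1))) := by
            gcongr
        _ = W.pg (2 * (n / 2)) v v * W.vol v (W.e v (max (n / 2) 1)) * (C₁ * (1 + t) ^ a) := by
            ring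
        _ ≤ A * (C₁ * (1 + t) ^ a) := by gcongr
    have h1 := W.pg_le_half_of_le hp (h := n / 2) (s := s) (by omega) w x
    have h2 := hz w hd
    have h3 := hz x (by rw [W.dist_self, Nat.cast_zero]; exact hR0.le)
    linarith
  have hx := W.self_mem_ballF hp (x := x) hR0
  have key := W.pg_split hp hx hx hM0 hM0 hbd hbd
  have hfirst : ∑ z ∈ W.ballF x R, W.ker (W.ballF x R) n x z * W.pk (W.ballF x R) n x z
      = W.pk (W.ballF x R) (2 * n) x x := by
    rw [W.pk_two_mul]
    refine Finset.sum_congr rfl fun z _ => ?_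
    rw [← W.pk_mul_mu]
    ring
  rw [hfirst, ← two_mul] at key
  have htl := htail x R n hR0 hn0
  rw [← ht, pow_succ] at htl
  -- The tail was taken with exponent a + 1, one more than the volume comparison costs; the spare
  -- factor 1 + t is at least 4 C₁ C₂.
  have hsm : (1 - W.surv (W.ballF x R) n x) * M ≤ A / 4 / W.vol x (W.e x n) := by
    have h1 : 0 ≤ 1 - W.surv (W.ballF x R) n x := sub_nonneg.2 (W.surv_le_one _ _ _)
    rw [hM, mul_div_assoc', div_le_div_iff_of_pos_right hv]
    have h2 : (1 + t) ^ a * (1 - W.surv (W.ballF x R) n x) * (4 * C₁ * C₂) ≤ C₂ := by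
      refine le_trans ?_ htl
      have h3 : 4 * C₁ * C₂ ≤ 1 + t := by linarith
      calc (1 + t) ^ a * (1 - W.surv (W.ballF x R) n x) * (4 * C₁ * C₂)
          ≤ (1 + t) ^ a * (1 - W.surv (W.ballF x R) n x) * (1 + t) := by
            gcongr
        _ = _ := by ring
    have h4 : (1 + t) ^ a * (1 - W.surv (W.ballF x R) n x) * (4 * C₁) ≤ 1 := by
      refine le_of_mul_le_mul_right ?_ (zero_lt_one.trans_le hC₂)
      linarith
    nlinarith
  have hfin : W.pg (2 * n) x x ≤ (C + A / 2) / W.vol x (W.e x n) := by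
    have : (C + A / 2) / W.vol x (W.e x n) = C / W.vol x (W.e x n)
        + A / 4 / W.vol x (W.e x n) + A / 4 / W.vol x (W.e x n) := by ring
    linarith
  exact (le_div_iff₀ hv).1 hfin

theorem exists_pg_two_mul_le (hV : W.VD) (hT : W.TC) (hL : W.LocalDUE) : ∃ C : ℝ, 1 ≤ C ∧
    ∀ (n : ℕ) (x : Γ), W.pg (2 * n) x x * W.vol x (W.e x (max n 1)) ≤ C := by
  obtain ⟨C, hC, hboot⟩ := W.exists_pg_mul_vol_le hp hV hT hL
  obtain ⟨D, a, hD, hvol⟩ := VD.exists_pow W hp hV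
  refine ⟨2 * C, by linarith, fun N x => ?_⟩
  refine le_two_mul_of_bootstrap
    (S := {s | ∃ k ≤ N, ∃ z, s = W.pg (2 * k) z z * W.vol z (W.e z (max k 1))})
    ⟨_, N, le_rfl, x, rfl⟩ ?_ ?_ _ ⟨N, le_rfl, x, rfl⟩
  -- A priori finiteness: the heat kernel at z is at most 1/μ(z), and (VD) bounds the volume up to
  -- radius max N 1 by a multiple of μ(z), uniformly in z.
  · refine ⟨D * (max N 1 : ℕ) ^ a, ?_⟩
    rintro _ ⟨k, hk, z, rfl⟩
    have h0 : 1 ≤ max N 1 := le_max_right _ _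
    have h0' : (1 : ℝ) ≤ (max N 1 : ℕ) := by exact_mod_cast h0
    have h1 : W.e z (max k 1) ≤ max N 1 :=
      (W.e_mono hp z (max_le_max hk le_rfl)).trans (Nat.sInf_le (W.le_E hp z _))
    have h2 := (W.vol_mono hp (x := z) (show (W.e z (max k 1) : ℝ) ≤ (max N 1 : ℕ) by
      exact_mod_cast h1)).trans (hvol z z (max N 1 : ℕ) 1 one_pos h0'
        (W.self_mem_ballF hp (by linarith)))
    rw [div_one, W.vol_one hp one_pos le_rfl] at h2
    have h3 := W.mu_pos z
    calc W.pg (2 * k) z z * W.vol z (W.e z (max k 1))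
        ≤ 1 / W.mu z * (D * (max N 1 : ℕ) ^ a * W.mu z) :=
          mul_le_mul (W.pg_le_inv_mu _ z z) h2 (W.vol_e_pos hp z (by simp)).le (by positivity)
      _ = D * (max N 1 : ℕ) ^ a := by field_simp
  · rintro A hA _ ⟨k, hk, z, rfl⟩
    exact hboot N k hk A (fun j hj w => hA _ ⟨j, hj, w, rfl⟩) z

theorem DUE_of_localDUE (hV : W.VD) (hT : W.TC) (hL : W.LocalDUE) : W.DUE := by
  obtain ⟨C, hC, h⟩ := W.exists_pg_two_mul_le hp hV hT hL
  obtain ⟨C₁, a, hC₁, hvol⟩ := W.exists_vol_e_le_vol_e hp hV hT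
  refine ⟨C * C₁, by positivity, fun x n hn => ?_⟩
  have h1 := hvol x x 0 n (max (n / 2) 1) hn (by omega) (by rw [W.dist_self, Nat.cast_zero])
  rw [W.E_eq_zero x le_rfl, zero_div, add_zero, one_pow, mul_one] at h1
  have h2 := W.pg_le_half_of_le hp (h := n / 2) (s := n) (by omega) x x
  have h3 := h (n / 2) x
  have h4 := W.vol_e_pos hp x hn
  have h5 := W.pg_nonneg (2 * (n / 2)) x x
  rw [W.pn_eq_pg hp, le_div_iff₀ h4]
  have h6 : W.pg n x x ≤ W.pg (2 * (n / 2)) x x := by linarith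
  calc W.pg n x x * W.vol x (W.e x n)
      ≤ W.pg (2 * (n / 2)) x x * (C₁ * W.vol x (W.e x (max (n / 2) 1))) := by gcongr
    _ = W.pg (2 * (n / 2)) x x * W.vol x (W.e x (max (n / 2) 1)) * C₁ := by ring
    _ ≤ C * C₁ := by gcongr

end WeightedGraph
end

noncomputable section

namespace WeightedGraph

variable {Γ : Type*} (W : WeightedGraph Γ)
variable [Infinite Γ] [Countable Γ] [MeasurableSpace Γ] [MeasurableSingletonClass Γ]
variable (hp : W.ControlledWeights)
include hp

/-! ### Consequences of the diagonal upper estimate -/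

theorem DUE.exists_pg_two_mul_le (hD : W.DUE) : ∃ C : ℝ, 1 ≤ C ∧
    ∀ (n : ℕ) (x : Γ), W.pg (2 * n) x x * W.vol x (W.e x (max n 1)) ≤ C := by
  obtain ⟨C, hC, h⟩ := hD
  refine ⟨max C 1, le_max_right _ _, fun n x => ?_⟩
  rcases Nat.eq_zero_or_pos n with rfl | hn
  · rw [mul_zero, max_eq_right zero_le_one, W.e_one hp, Nat.cast_one, W.vol_one hp one_pos le_rfl]
    have h1 := mul_le_mul_of_nonneg_right (W.pg_le_inv_mu 0 x x) (W.mu_pos x).le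
    rw [one_div_mul_cancel (W.mu_pos x).ne'] at h1
    exact h1.trans (le_max_right _ _)
  · rw [max_eq_left hn]
    have h1 := h x (2 * n) (by omega)
    rw [W.pn_eq_pg hp, le_div_iff₀ (W.vol_e_pos hp x (by omega))] at h1
    refine le_trans ?_ (h1.trans (le_max_left _ _))
    refine mul_le_mul_of_nonneg_left (W.vol_mono hp ?_) (W.pg_nonneg _ x x)
    exact_mod_cast W.e_mono hp x (by omega)

theorem DUE.exists_pg_mul_vol_le (hV : W.VD) (hT : W.TC) (hD : W.DUE) : ∃ (C : ℝ) (a : ℕ), 1 ≤ C ∧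
    ∀ (x v w : Γ) (R : ℝ) (n s : ℕ), 0 < R → 0 < n → n / 2 ≤ s → W.dist x v ≤ R →
      W.dist x w ≤ R → W.pg s v w * W.vol x R ≤ C * (1 + W.E x R / n) ^ a := by
  obtain ⟨C, hC, h⟩ := DUE.exists_pg_two_mul_le W hp hD
  obtain ⟨C₁, a, hC₁, hvol⟩ := W.exists_vol_le_vol_e_of_dist_le hp hV hT
  refine ⟨C * C₁, a, one_le_mul_of_one_le_of_one_le hC hC₁, ?_⟩
  intro x v w R n s hR hn hs hv hw
  have ht : 0 ≤ W.E x R / n := div_nonneg (W.E_nonneg x R) (Nat.cast_nonneg n)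
  have h1 : ∀ z, W.dist x z ≤ R →
      W.pg (2 * (s / 2)) z z * W.vol x R ≤ C * C₁ * (1 + W.E x R / n) ^ a := by
    intro z hz
    have h2 := hvol x z R n (max (s / 2) 1) hR hn (by omega) hz
    have h3 := W.pg_nonneg (2 * (s / 2)) z z
    calc W.pg (2 * (s / 2)) z z * W.vol x R
        ≤ W.pg (2 * (s / 2)) z z *
          (C₁ * (1 + W.E x R / n) ^ a * W.vol z (W.e z (max (s / 2) 1))) := by gcongr
      _ = W.pg (2 * (s / 2)) z z * W.vol z (W.e z (max (s / 2) 1)) *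
          (C₁ * (1 + W.E x R / n) ^ a) := by ring
      _ ≤ C * (C₁ * (1 + W.E x R / n) ^ a) := by
        gcongr
        exact h _ z
      _ = _ := by ring
  have h2 := W.pg_le_half_of_le hp (h := s / 2) (s := s) (by omega) v w
  have h3 := mul_le_mul_of_nonneg_right h2 (W.vol_pos hp (x := x) hR).le
  have h4 := h1 v hv
  have h5 := h1 w hw
  linarith

theorem DUE.exists_pg_mul_vol_e_le (hV : W.VD) (hT : W.TC) (hD : W.DUE) :
    ∃ (C : ℝ) (a : ℕ), 1 ≤ C ∧
    ∀ (x v w : Γ) (R : ℝ) (n s : ℕ), 0 < n → n / 2 ≤ s → W.dist x v ≤ R →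
      W.dist x w ≤ R → W.pg s v w * W.vol x (W.e x n) ≤ C * (1 + W.E x R / n) ^ a := by
  obtain ⟨C, a, hC, h⟩ := DUE.exists_pg_mul_vol_le W hp hV hT hD
  obtain ⟨C', hC', h2⟩ := TC.exists_E_e_le W hp hT
  refine ⟨C * (1 + C') ^ a, a, one_le_mul_of_one_le_of_one_le hC (one_le_pow₀ (by linarith)), ?_⟩
  intro x v w R n s hn hs hv hw
  have hn0 : (0 : ℝ) < n := by exact_mod_cast hn
  have he := W.one_le_e hp x hn
  have hE := W.E_nonneg x R
  obtain ⟨S, hS1, hS2, hS3, hS4⟩ : ∃ S : ℝ, 0 < S ∧ (W.e x n : ℝ) ≤ S ∧ R ≤ S ∧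
      W.E x S ≤ C' * n + W.E x R := by
    rcases le_total R (W.e x n) with h | h
    · exact ⟨W.e x n, by linarith, le_rfl, h, (h2 x n hn).trans (by linarith)⟩
    · exact ⟨R, by linarith, h, le_rfl, le_add_of_nonneg_left (by positivity)⟩
  have h3 := h x v w S n s hS1 hn hs (hv.trans hS3) (hw.trans hS3)
  have h4 : 1 + W.E x S / n ≤ (1 + C') * (1 + W.E x R / n) := by
    have h5 : W.E x S / n ≤ C' + W.E x R / n := by
      rw [div_le_iff₀ hn0, add_mul, div_mul_cancel₀ _ hn0.ne']; exact hS4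
    have h6 : 0 ≤ C' * (W.E x R / n) := by positivity
    linarith
  have h7 := W.E_nonneg x S
  have h8 := W.pg_nonneg s v w
  have h9 := W.vol_mono hp (x := x) hS2
  calc W.pg s v w * W.vol x (W.e x n) ≤ W.pg s v w * W.vol x S := by gcongr
    _ ≤ C * (1 + W.E x S / n) ^ a := h3
    _ ≤ C * ((1 + C') * (1 + W.E x R / n)) ^ a := by gcongr
    _ = _ := by rw [mul_pow]; ring

omit [Countable Γ] [MeasurableSpace Γ] [MeasurableSingletonClass Γ] in
theorem ballF_disjoint_half {x y : Γ} : Disjoint (W.ballF x (W.dist x y / 2))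
    (W.ballF y (W.dist x y / 2)) := by
  rw [Finset.disjoint_left]
  intro z hz hz'
  rw [W.mem_ballF hp] at hz hz'
  have h1 := W.dist_triangle_real x z y
  rw [W.dist_comm z y] at h1
  linarith

omit [Countable Γ] [MeasurableSpace Γ] [MeasurableSingletonClass Γ] in
theorem dist_le_of_boundary {x w : Γ} {R : ℝ} {U : Finset Γ} (hU : U = W.ballF x R)
    (h : ∃ z ∈ U, W.Adj z w) : (W.dist x w : ℝ) ≤ R + 1 := by
  obtain ⟨z, hz, hzw⟩ := h
  rw [hU, W.mem_ballF hp] at hz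
  have h1 := W.dist_triangle_real x z w
  have h2 : (W.dist z w : ℝ) ≤ 1 := by exact_mod_cast W.dist_le_one hzw
  linarith

/-- Balls of radius d(x,y)/2 around x and y are disjoint, so the killed main term of `pg_split`
vanishes. The rest is exit probabilities times bounds from (DUE), with a polynomial loss in
E(x,d)/n. -/
theorem UE_of_DUE (hV : W.VD) (hT : W.TC) (hD : W.DUE) : W.UE := by
  obtain ⟨C₁, a, hC₁, hbd⟩ := DUE.exists_pg_mul_vol_e_le W hp hV hT hD
  obtain ⟨β, C₂, c, hβ, hC₂, hc, htail⟩ := TC.exists_one_sub_surv_le W hp hT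
  obtain ⟨C₃, b, hC₃, -, hpow⟩ := TC.exists_pow W hp hT
  obtain ⟨γ, hγ⟩ : ∃ γ, γ = 1 / (β - 1) := ⟨_, rfl⟩
  have hγ0 : 0 < γ := by rw [hγ]; exact one_div_pos.2 (sub_pos.2 hβ)
  obtain ⟨K, hK⟩ : ∃ K, K = C₃ * 3 ^ b := ⟨_, rfl⟩
  have hK1 : 1 ≤ K := by
    rw [hK]; exact one_le_mul_of_one_le_of_one_le hC₃ (one_le_pow₀ (by norm_num))
  have hK0 : 0 < K := by linarith
  -- Half of the exponent is kept for the conclusion; the other half absorbs the polynomial factor.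
  obtain ⟨c', hc'⟩ : ∃ c', c' = c / K ^ γ / 2 := ⟨_, rfl⟩
  have hc'0 : 0 < c' := by rw [hc']; positivity
  obtain ⟨C₄, hC₄, hexp⟩ := exists_pow_mul_exp_le a hc'0 hγ0
  obtain ⟨C₀, hC₀, hdiag⟩ := hD
  obtain ⟨C₅, hC₅⟩ : ∃ C₅, C₅ = 2 * C₂ * (C₁ * K ^ a * C₄) := ⟨_, rfl⟩
  have hC₅0 : 0 < C₅ := by rw [hC₅]; positivity
  refine ⟨1 + C₀ + C₅, β, c', by linarith, hβ, hc'0, fun x y n hn => ?_⟩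
  rw [← hγ, W.pn_eq_pg hp]
  have hn0 : (0 : ℝ) < n := by exact_mod_cast hn
  have hv := W.vol_e_pos hp x hn
  rcases Nat.eq_zero_or_pos (W.dist x y) with hd | hd
  · have hxy := (W.dist_eq_zero).1 hd
    subst hxy
    rw [hd, Nat.cast_zero, W.E_eq_zero x le_rfl, zero_div, Real.zero_rpow hγ0.ne', mul_zero,
      neg_zero, Real.exp_zero, mul_one, ← W.pn_eq_pg hp]
    refine (hdiag x n hn).trans ?_
    gcongr
    linarith
  obtain ⟨d, hdd⟩ : ∃ d : ℝ, d = W.dist x y := ⟨_, rfl⟩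
  have hd1 : 1 ≤ d := by rw [hdd]; exact_mod_cast hd
  obtain ⟨t, ht⟩ : ∃ t, t = W.E x d / n := ⟨_, rfl⟩
  have ht0 : 0 ≤ t := by rw [ht]; exact div_nonneg (W.E_nonneg x d) hn0.le
  have hE0 := W.E_nonneg x d
  have hdisj := W.ballF_disjoint_half hp (x := x) (y := y)
  rw [← hdd] at hdisj ⊢
  rw [← ht]
  have hself : (W.dist x x : ℝ) ≤ 3 * d := by rw [W.dist_self, Nat.cast_zero]; linarith
  have hKt : 1 + W.E x (3 * d) / n ≤ K * (1 + t) := by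
    have h1 := hpow x x (3 * d) d (by linarith) (by linarith) (W.self_mem_ballF hp (by linarith))
    rw [mul_div_assoc, div_self (by linarith), mul_one, ← hK] at h1
    have h2 : W.E x (3 * d) / n ≤ K * t := by
      rw [ht, mul_div_assoc']
      gcongr
    linarith
  obtain ⟨M, hM⟩ : ∃ M, M = C₁ * (K * (1 + t)) ^ a / W.vol x (W.e x n) := ⟨_, rfl⟩
  have hM0 : 0 ≤ M := by rw [hM]; positivity
  -- Since d ≥ 1, the points that occur, up to one step outside the half ball around y, lie within
  -- 3d of x.
  have hMbd : ∀ s v w, n / 2 ≤ s → (W.dist x v : ℝ) ≤ 3 * d → (W.dist x w : ℝ) ≤ 3 * d →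
      W.pg s v w ≤ M := by
    intro s v w hs hv' hw'
    rw [hM, le_div_iff₀ hv]
    refine (hbd x v w (3 * d) n s hn hs hv' hw').trans ?_
    have := W.E_nonneg x (3 * d)
    gcongr
  have key := W.pg_split hp (x := x) (y := y) (U := W.ballF x (d / 2)) (U' := W.ballF y (d / 2))
    (n₁ := n / 2) (n₂ := n - n / 2)
    (W.self_mem_ballF hp (by linarith)) (W.self_mem_ballF hp (by linarith)) hM0 hM0
    (fun s hs _ w _ hw => by
      have h1 := W.dist_le_of_boundary hp rfl hw
      exact hMbd s w y (by omega) (by linarith) (by linarith))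
    (fun s hs _ w _ hw => by
      have h1 := W.dist_le_of_boundary hp rfl hw
      have h2 := W.dist_triangle_real x y w
      exact hMbd s w x (by omega) (by linarith) hself)
  have hz : ∑ z ∈ W.ballF y (d / 2), W.ker (W.ballF y (d / 2)) (n - n / 2) y z
      * W.pk (W.ballF x (d / 2)) (n / 2) x z = 0 := by
    refine Finset.sum_eq_zero fun z hz => ?_
    rw [pk, W.ker_eq_zero_right (fun h => Finset.disjoint_left.1 hdisj h hz), zero_div, mul_zero]
  rw [hz, zero_add, Nat.add_sub_cancel' (Nat.div_le_self n 2)] at key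
  have hΨ : ∀ v k, (W.dist x v : ℝ) ≤ d → k ≤ n → 1 - W.surv (W.ballF v (d / 2)) k v
      ≤ C₂ * Real.exp (-(2 * c' * t ^ γ)) := by
    intro v k hvd hk
    have h1 := W.surv_antitone (W.ballF v (d / 2)) v hk
    have h2 := htail v (d / 2) n (by linarith) hn
    have h3 := hpow x v d (d / 2) (by linarith) (by linarith) ((W.mem_ballF hp).2 (by linarith))
    have h4 : d / (d / 2) = 2 := by field_simp
    rw [h4] at h3
    have h5 : t / K ≤ W.E v (d / 2) / n := by
      rw [ht, div_div, div_le_div_iff₀ (by positivity) hn0]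
      have h6 : W.E x d ≤ K * W.E v (d / 2) := by
        refine h3.trans ?_
        have := W.E_nonneg v (d / 2)
        rw [hK]
        gcongr
        norm_num
      nlinarith
    have h6 : 2 * c' * t ^ γ ≤ c * (W.E v (d / 2) / n) ^ (1 / (β - 1)) := by
      rw [← hγ]
      calc 2 * c' * t ^ γ = c * (t / K) ^ γ := by
            rw [Real.div_rpow ht0 hK0.le, hc']; ring
        _ ≤ c * (W.E v (d / 2) / n) ^ γ := by gcongr
    refine (sub_le_sub_left h1 1).trans (h2.trans ?_)
    gcongr
  have h1 := hΨ x (n / 2) (by rw [W.dist_self, Nat.cast_zero]; linarith) (Nat.div_le_self n 2)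
  have h2 := hΨ y (n - n / 2) hdd.ge (Nat.sub_le _ _)
  have h3 := mul_le_mul_of_nonneg_right h1 hM0
  have h4 := mul_le_mul_of_nonneg_right h2 hM0
  have h5 : Real.exp (-(2 * c' * t ^ γ)) = Real.exp (-(c' * t ^ γ)) * Real.exp (-(c' * t ^ γ)) := by
    rw [← Real.exp_add]; ring_nf
  have h6 := hexp t ht0
  calc W.pg n x y ≤ 2 * (C₂ * Real.exp (-(2 * c' * t ^ γ)) * M) := by linarith
    _ = 2 * C₂ * (C₁ * K ^ a * ((1 + t) ^ a * Real.exp (-(c' * t ^ γ)))) / W.vol x (W.e x n)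
        * Real.exp (-(c' * t ^ γ)) := by rw [hM, h5, mul_pow]; ring
    _ ≤ 2 * C₂ * (C₁ * K ^ a * C₄) / W.vol x (W.e x n) * Real.exp (-(c' * t ^ γ)) := by gcongr
    _ ≤ (1 + C₀ + C₅) / W.vol x (W.e x n) * Real.exp (-(c' * t ^ γ)) := by
      rw [← hC₅]
      gcongr
      linarith

end WeightedGraph
end

noncomputable section

namespace WeightedGraph

variable {Γ : Type*} (W : WeightedGraph Γ)

/-! ### Dirichlet solutions of the heat equation on balls -/

section

variable [Nontrivial Γ] (hp : W.ControlledWeights)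
include hp

theorem tsum_ball (x : Γ) (R : ℝ) (f : Γ → ℝ) :
    ∑' z : W.ball x R, f z = ∑ z ∈ W.ballF x R, f z := by
  rw [← W.coe_ballF hp]
  exact Finset.tsum_subtype' (W.ballF x R) f

theorem mem_ball_iff {x y : Γ} {R : ℝ} : y ∈ W.ball x R ↔ y ∈ W.ballF x R := by
  rw [← W.coe_ballF hp, Finset.mem_coe]

theorem killedOp_of_mem {x z : Γ} {R : ℝ} (hz : z ∈ W.ballF x R) (f : Γ → ℝ) :
    W.killedOp (W.ball x R) f z = ∑ w ∈ W.ballF x R, W.P z w * f w := by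
  rw [killedOp, if_pos ((W.mem_ball_iff hp).2 hz), W.tsum_ball hp x R fun w => W.P z w * f w]

theorem isDirichletSolution_ker (x w : Γ) (R : ℝ) (j n : ℕ) :
    W.IsDirichletSolution (W.ball x R) n fun k z => W.ker (W.ballF x R) (j + k) z w where
  nonneg _ _ z := W.ker_nonneg _ _ z w
  support _ _ z hz := W.ker_eq_zero_left (fun h => hz ((W.mem_ball_iff hp).2 h)) _ w
  heat k _ := by
    funext z
    by_cases hz : z ∈ W.ballF x R
    · rw [W.killedOp_of_mem hp hz, ← add_assoc, W.ker_succ hz]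
    · rw [W.ker_eq_zero_left hz, killedOp, if_neg fun h => hz ((W.mem_ball_iff hp).1 h)]

theorem IsDirichletSolution.eq_sum_ker {x : Γ} {R : ℝ} {n : ℕ} {u : ℕ → Γ → ℝ}
    (hu : W.IsDirichletSolution (W.ball x R) n u) {i k : ℕ} (h : i + k ≤ n) {z : Γ}
    (hz : z ∈ W.ballF x R) :
    u (i + k) z = ∑ w ∈ W.ballF x R, W.ker (W.ballF x R) k z w * u i w := by
  induction k generalizing z with
  | zero =>
    rw [Finset.sum_eq_single_of_mem z hz, W.ker_zero_self hz, one_mul, add_zero]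
    intro w _ hw
    rw [W.ker_zero_ne hw.symm, zero_mul]
  | succ k ih =>
    rw [← add_assoc, ← hu.heat (i + k) (by omega), W.killedOp_of_mem hp hz,
      Finset.sum_congr rfl fun v hv => by rw [ih (by omega) hv]]
    simp_rw [W.ker_succ hz, Finset.mul_sum, Finset.sum_mul]
    rw [Finset.sum_comm]
    exact Finset.sum_congr rfl fun w _ => Finset.sum_congr rfl fun v _ => by ring

end

variable [Infinite Γ] [Countable Γ] [MeasurableSpace Γ] [MeasurableSingletonClass Γ]
variable (hp : W.ControlledWeights)
include hp

theorem exists_vol_mul_E_le (hV : W.VD) (hT : W.TC) : ∃ C : ℝ, 1 ≤ C ∧ ∀ (x y : Γ) (R : ℝ),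
    0 < R → y ∈ W.ballF x R → W.vol y (2 * R) * W.E y (2 * R) ≤ C * (W.vol x R * W.E x R) := by
  obtain ⟨C₁, b, hC₁, -, h₁⟩ := TC.exists_pow W hp hT
  obtain ⟨D, a, hD, h₂⟩ := VD.exists_pow W hp hV
  refine ⟨D * 2 ^ a * (C₁ * 2 ^ b), ?_, fun x y R hR hy => ?_⟩
  · exact one_le_mul_of_one_le_of_one_le
      (one_le_mul_of_one_le_of_one_le hD (one_le_pow₀ (by norm_num)))
      (one_le_mul_of_one_le_of_one_le hC₁ (one_le_pow₀ (by norm_num)))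
  have hx : x ∈ W.ballF y (2 * (2 * R)) :=
    W.ballF_mono hp (by linarith) ((W.mem_ballF_comm hp).1 hy)
  have h3 := h₁ y x (2 * R) R hR (by linarith) hx
  have h4 := h₂ y x (2 * R) R hR (by linarith) hx
  have h5 : 2 * R / R = 2 := by field_simp
  rw [h5] at h3 h4
  have h6 := W.vol_pos hp (x := x) hR
  calc W.vol y (2 * R) * W.E y (2 * R)
      ≤ (D * 2 ^ a * W.vol x R) * (C₁ * 2 ^ b * W.E x R) :=
        mul_le_mul h4 h3 (W.E_nonneg y _) (by positivity)
    _ = _ := by ring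

/-- For i in the first half of the interval, the time left until n is of order E(x,R) and the kernel
is at most a multiple of 1/V(x,R). Averaging over these i gives the factor 1/E(x,R);
`exists_vol_mul_E_le` moves the centre to y. -/
theorem skewedPMV_of_DUE (hV : W.VD) (hT : W.TC) (hD : W.DUE) : W.SkewedPMV := by
  obtain ⟨C₁, a, hC₁, hbd⟩ := DUE.exists_pg_mul_vol_le W hp hV hT hD
  obtain ⟨C₂, hC₂, hVE⟩ := W.exists_vol_mul_E_le hp hV hT
  intro c₁ c₂ hc₁ hc₁₂
  obtain ⟨δ, hδ⟩ : ∃ δ, δ = c₂ - c₁ := ⟨_, rfl⟩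
  have hδ0 : 0 < δ := by linarith
  obtain ⟨K, hK⟩ : ∃ K, K = C₁ * (1 + 2 / δ) ^ a := ⟨_, rfl⟩
  have hK0 : 0 < K := by rw [hK]; positivity
  refine ⟨max 1 (C₂ * (2 / δ * K)), le_max_left _ _, fun R hR x y hy u hu => ?_⟩
  rw [W.mem_ball_iff hp] at hy
  obtain ⟨ℰ, hℰ⟩ : ∃ ℰ, ℰ = W.E x R := ⟨_, rfl⟩
  have hℰ0 : 0 < ℰ := by rw [hℰ]; exact W.E_pos hp x hR
  rw [← hℰ] at hu ⊢
  obtain ⟨m, hm⟩ : ∃ m, m = ⌊c₁ * ℰ⌋₊ := ⟨_, rfl⟩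
  obtain ⟨n, hn⟩ : ∃ n, n = ⌊c₂ * ℰ⌋₊ := ⟨_, rfl⟩
  rw [← hm, ← hn]
  rw [← hn] at hu
  have hmn : m ≤ n := by
    rw [hm, hn]
    exact Nat.floor_le_floor (by gcongr)
  -- The floors may coincide when E is small. With the added 1 the number of available times is
  -- still at least δ E.
  have hdiff : δ * ℰ ≤ n - m + 1 := by
    have h1 : (m : ℝ) ≤ c₁ * ℰ := by rw [hm]; exact Nat.floor_le (by positivity)
    have h2 : c₂ * ℰ < n + 1 := by rw [hn]; exact Nat.lt_floor_add_one _
    rw [hδ]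
    linarith
  have hxB := W.self_mem_ballF hp (x := x) hR
  obtain ⟨S, hS⟩ : ∃ S : ℕ → ℝ, S = fun i => ∑ z ∈ W.ballF x R, u i z * W.mu z := ⟨_, rfl⟩
  have hS0 : ∀ i ≤ n, 0 ≤ S i := fun i hi => by
    rw [hS]
    exact Finset.sum_nonneg fun z _ => mul_nonneg (hu.nonneg i hi z) (W.mu_pos z).le
  have hsum : ∀ i, ∑ z ∈ W.ballF x R, u i z * W.mu z = S i := fun i => by rw [hS]
  have htsum : ∀ i, ∑' z : W.ball x R, u i z * W.mu z = S i := fun i => by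
    rw [W.tsum_ball hp x R fun z => u i z * W.mu z, hsum]
  simp_rw [htsum]
  have hVx := W.vol_pos hp (x := x) hR
  have hstep : ∀ i ∈ Finset.Icc m ((m + n) / 2), u n x ≤ K / W.vol x R * S i := by
    intro i hi
    rw [Finset.mem_Icc] at hi
    have h1 := IsDirichletSolution.eq_sum_ker W hp hu (i := i) (k := n - i) (by omega) hxB
    rw [Nat.add_sub_cancel' (by omega)] at h1
    rw [h1, ← hsum, Finset.mul_sum]
    refine Finset.sum_le_sum fun w hw => ?_
    have h2 := hbd x x w R (max (n - m) 1) (n - i) hR (by omega) (by omega)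
      (by rw [W.dist_self, Nat.cast_zero]; exact hR.le) ((W.mem_ballF hp).1 hw).le
    have h3 : 1 + W.E x R / (max (n - m) 1 : ℕ) ≤ 1 + 2 / δ := by
      have h4 : (n : ℝ) - m + 1 ≤ 2 * (max (n - m) 1 : ℕ) := by
        have h5 : n + 1 ≤ 2 * (max (n - m) 1) + m := by omega
        have h6 : (n : ℝ) + 1 ≤ 2 * (max (n - m) 1 : ℕ) + m := by exact_mod_cast h5
        linarith
      have h7 : (0 : ℝ) < (max (n - m) 1 : ℕ) := by exact_mod_cast (by omega)
      rw [← hℰ]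
      gcongr 1 + ?_
      rw [div_le_div_iff₀ h7 hδ0]
      linarith
    have h4 : W.pg (n - i) x w ≤ K / W.vol x R := by
      rw [le_div_iff₀ hVx, hK]
      refine h2.trans ?_
      have := W.E_nonneg x R
      gcongr
    rw [← W.pk_mul_mu]
    have h5 := (W.pk_le_pg hp (W.ballF x R) (n - i) x w).trans h4
    have h6 := hu.nonneg i (by omega) w
    have h7 := W.mu_pos w
    calc W.pk (W.ballF x R) (n - i) x w * W.mu w * u i w
        ≤ K / W.vol x R * W.mu w * u i w := by gcongr
      _ = K / W.vol x R * (u i w * W.mu w) := by ring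
  have hcard := Finset.card_nsmul_le_sum (Finset.Icc m ((m + n) / 2)) _ _ hstep
  rw [Nat.card_Icc, nsmul_eq_mul, ← Finset.mul_sum] at hcard
  have hcnt : δ * ℰ / 2 ≤ ((m + n) / 2 + 1 - m : ℕ) := by
    have h5 : n + 1 ≤ 2 * ((m + n) / 2 + 1 - m) + m := by omega
    have h6 : (n : ℝ) + 1 ≤ 2 * ((m + n) / 2 + 1 - m : ℕ) + m := by exact_mod_cast h5
    linarith
  have hsub : ∑ i ∈ Finset.Icc m ((m + n) / 2), S i ≤ ∑ i ∈ Finset.Icc m n, S i :=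
    Finset.sum_le_sum_of_subset_of_nonneg (Finset.Icc_subset_Icc le_rfl (by omega))
      fun i hi _ => hS0 i (Finset.mem_Icc.1 hi).2
  have hun := hu.nonneg n le_rfl x
  have hT0 : 0 ≤ ∑ i ∈ Finset.Icc m n, S i :=
    Finset.sum_nonneg fun i hi => hS0 i (Finset.mem_Icc.1 hi).2
  generalize ∑ i ∈ Finset.Icc m n, S i = T at *
  have h1 : δ * ℰ / 2 * u n x ≤ K / W.vol x R * T := by
    calc δ * ℰ / 2 * u n x ≤ ((m + n) / 2 + 1 - m : ℕ) * u n x := by gcongr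
      _ ≤ _ := hcard
      _ ≤ K / W.vol x R * T := by gcongr
  have h2 : u n x ≤ 2 / δ * K / (W.vol x R * ℰ) * T := by
    have h3 : 2 / δ * K / (W.vol x R * ℰ) * T = (K / W.vol x R * T) / (δ * ℰ / 2) := by
      field_simp
    rw [h3, le_div_iff₀ (by positivity)]
    linarith
  refine h2.trans (mul_le_mul_of_nonneg_right ?_ hT0)
  have h4 : 0 < W.vol y (2 * R) * W.E y (2 * R) :=
    mul_pos (W.vol_pos hp (by linarith)) (W.E_pos hp y (by linarith))
  rw [div_le_div_iff₀ (by positivity) h4]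
  have h5 := hVE x y R hR hy
  rw [← hℰ] at h5
  calc 2 / δ * K * (W.vol y (2 * R) * W.E y (2 * R))
      ≤ 2 / δ * K * (C₂ * (W.vol x R * ℰ)) := by gcongr
    _ = C₂ * (2 / δ * K) * (W.vol x R * ℰ) := by ring
    _ ≤ max 1 (C₂ * (2 / δ * K)) * (W.vol x R * ℰ) := by gcongr; exact le_max_right _ _

end WeightedGraph
end

noncomputable section

namespace WeightedGraph

variable {Γ : Type*} (W : WeightedGraph Γ)

/-! ### The mean value inequality from the upper estimate -/

section

variable [Infinite Γ] (hp : W.ControlledWeights)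
include hp

theorem green_eq' {A : Finset Γ} {y : Γ} (hy : y ∈ A) (x : Γ) :
    W.green A x y = W.ker A 0 x y + ∑ z ∈ A, W.green A x z * W.P z y := by
  unfold green
  rw [(W.summable_ker hp A x y).tsum_eq_zero_add]
  congr 1
  simp_rw [W.ker_succ' hy]
  rw [Summable.tsum_finsetSum fun z _ => (W.summable_ker hp A x z).mul_right _]
  exact Finset.sum_congr rfl fun z _ => tsum_mul_right

omit [Infinite Γ] hp in
theorem sum_ker_zero_mul {A : Finset Γ} {x : Γ} (hx : x ∈ A) (f : Γ → ℝ) :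
    ∑ y ∈ A, W.ker A 0 x y * f y = f x := by
  rw [Finset.sum_eq_single_of_mem x hx, W.ker_zero_self hx, one_mul]
  intro w _ hw
  rw [W.ker_zero_ne hw.symm, zero_mul]

/-- The Green kernel inverts I - P on functions on A with zero values outside. -/
theorem sum_green_mul_sub {A : Finset Γ} {x : Γ} (hx : x ∈ A) (f : Γ → ℝ) :
    ∑ z ∈ A, W.green A x z * (f z - ∑ y ∈ A, W.P z y * f y) = f x := by
  have h1 : ∑ z ∈ A, W.green A x z * ∑ y ∈ A, W.P z y * f y
      = ∑ y ∈ A, (∑ z ∈ A, W.green A x z * W.P z y) * f y := by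
    simp_rw [Finset.mul_sum, Finset.sum_mul]
    rw [Finset.sum_comm]
    exact Finset.sum_congr rfl fun y _ => Finset.sum_congr rfl fun z _ => by ring
  simp_rw [mul_sub, Finset.sum_sub_distrib]
  rw [h1, ← Finset.sum_sub_distrib, ← W.sum_ker_zero_mul hx f]
  refine Finset.sum_congr rfl fun y hy => ?_
  rw [W.green_eq' hp hy x]
  ring

/-- Balayage: on `B' ⊆ B`, a nonnegative harmonic function on `B` is the Green potential in `B` of
a measure on the inner boundary of `B'`, and the potential is at most the function on `B`. -/
theorem exists_balayage {B B' Ω : Finset Γ} (hB : B' ⊆ B) (hΩ : B ⊆ Ω) {u : Γ → ℝ}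
    (hu : ∀ z ∈ B, ∀ y, W.Adj z y → 0 ≤ u y)
    (hh : ∀ z ∈ B, ∑ y ∈ Ω, W.P z y * u y = u z) :
    ∃ ν : Γ → ℝ, (∀ z ∈ B', 0 ≤ ν z) ∧ (∀ z ∈ B', (∀ y, W.Adj z y → y ∈ B') → ν z = 0) ∧
      (∀ z ∈ B', ∑ v ∈ B', W.green B z v * ν v = u z) ∧
      ∀ z ∈ B, ∑ v ∈ B', W.green B z v * ν v ≤ u z := by
  classical
  obtain ⟨A, hA⟩ : ∃ A, A = B \ B' := ⟨_, rfl⟩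
  obtain ⟨f, hf⟩ : ∃ f : Γ → ℝ, f = fun a => ∑ b ∈ B', W.P a b * u b := ⟨_, rfl⟩
  -- The reduced function of u on B': equal to u on B', zero outside B and harmonic between. At z in
  -- B \ B' it is the mean of u at the entrance to B' for the walk killed outside B.
  obtain ⟨w, hw⟩ : ∃ w : Γ → ℝ, w = fun z => if z ∈ B' then u z else
    ∑ a ∈ A, W.green A z a * f a := ⟨_, rfl⟩
  have hwB' : ∀ z ∈ B', w z = u z := fun z hz => by rw [hw]; exact if_pos hz
  have hwA : ∀ z ∈ A, w z = ∑ a ∈ A, W.green A z a * f a := fun z hz => by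
    rw [hA, Finset.mem_sdiff] at hz
    rw [hw]; exact if_neg hz.2
  have hwout : ∀ z, z ∉ B → w z = 0 := fun z hz => by
    rw [hw]
    refine (if_neg fun h => hz (hB h)).trans (Finset.sum_eq_zero fun a _ => ?_)
    rw [W.green_eq_zero_left (fun h => hz ?_), zero_mul]
    rw [hA] at h
    exact (Finset.mem_sdiff.1 h).1
  have hwΩ : ∀ z, ∑ y ∈ B, W.P z y * w y = ∑ y ∈ Ω, W.P z y * w y := fun z =>
    Finset.sum_subset hΩ fun y _ hy => by rw [hwout y hy, mul_zero]
  have hPw : ∀ z ∈ A, w z = ∑ y ∈ B, W.P z y * w y := by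
    intro z hz
    rw [← Finset.sum_sdiff hB, ← hA]
    have h1 : ∑ b ∈ B', W.P z b * w b = f z := by
      rw [hf]
      exact Finset.sum_congr rfl fun b hb => by rw [hwB' b hb]
    have h2 : ∑ v ∈ A, W.P z v * w v = ∑ a ∈ A, (∑ v ∈ A, W.P z v * W.green A v a) * f a := by
      simp_rw [Finset.sum_mul]
      rw [Finset.sum_comm]
      refine Finset.sum_congr rfl fun v hv => ?_
      rw [hwA v hv, Finset.mul_sum]
      exact Finset.sum_congr rfl fun a _ => by ring
    rw [h1, h2, hwA z hz, ← W.sum_ker_zero_mul hz f, add_comm, ← Finset.sum_add_distrib]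
    refine Finset.sum_congr rfl fun a _ => ?_
    rw [W.green_eq hp hz]
    ring
  have hwu : ∀ z ∈ B, w z ≤ u z := by
    intro z hz
    by_cases hz' : z ∈ B'
    · exact (hwB' z hz').le
    have hzA : z ∈ A := by rw [hA]; exact Finset.mem_sdiff.2 ⟨hz, hz'⟩
    have hAB : A ⊆ B := by rw [hA]; exact Finset.sdiff_subset
    have := W.nonpos_of_subharmonic hp (hAB.trans hΩ) (F := fun y => w y - u y) (fun y hy => by
      simp_rw [mul_sub, Finset.sum_sub_distrib]
      rw [hh y (hAB hy), ← hwΩ, ← hPw y hy]) (by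
      rintro v hv ⟨y, hy, hyv⟩
      by_cases hvB' : v ∈ B'
      · rw [hwB' v hvB', sub_self]
      · have hvB : v ∉ B := fun h => hv (by rw [hA]; exact Finset.mem_sdiff.2 ⟨h, hvB'⟩)
        rw [hwout v hvB]
        have := hu y (hAB hy) v hyv
        linarith) hzA
    linarith
  -- The charge of w. It vanishes on B \ B', where w is harmonic, and at points of B' with all
  -- neighbours in B', where w coincides with u; it is nonnegative on B' because w ≤ u.
  obtain ⟨ν, hν⟩ : ∃ ν : Γ → ℝ, ν = fun z => w z - ∑ y ∈ B, W.P z y * w y := ⟨_, rfl⟩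
  have hrep : ∀ z ∈ B, ∑ v ∈ B', W.green B z v * ν v = w z := by
    intro z hz
    rw [← W.sum_green_mul_sub hp hz w, Finset.sum_subset hB, hν]
    intro v hvB hvB'
    have h1 := hPw v (by rw [hA]; exact Finset.mem_sdiff.2 ⟨hvB, hvB'⟩)
    rw [hν]
    change W.green B z v * (w v - ∑ y ∈ B, W.P v y * w y) = 0
    rw [← h1, sub_self, mul_zero]
  refine ⟨ν, fun z hz => ?_, fun z hz hadj => ?_, fun z hz => ?_, fun z hz => ?_⟩
  · rw [hν]
    change 0 ≤ w z - ∑ y ∈ B, W.P z y * w y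
    rw [hwΩ, hwB' z hz, ← hh z (hB hz), sub_nonneg]
    refine Finset.sum_le_sum fun y _ => ?_
    by_cases hy : y ∈ B
    · exact mul_le_mul_of_nonneg_left (hwu y hy) (W.P_nonneg z y)
    · rw [hwout y hy, mul_zero]
      by_cases hzy : W.Adj z y
      · exact mul_nonneg (W.P_nonneg z y) (hu z (hB hz) y hzy)
      · rw [W.P_eq_zero hzy, zero_mul]
  · rw [hν]
    change w z - ∑ y ∈ B, W.P z y * w y = 0
    rw [hwΩ, hwB' z hz, ← hh z (hB hz), sub_eq_zero]
    refine Finset.sum_congr rfl fun y _ => ?_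
    by_cases hzy : W.Adj z y
    · rw [hwB' y (hadj y hzy)]
    · rw [W.P_eq_zero hzy, zero_mul, zero_mul]
  · rw [hrep z (hB hz), hwB' z hz]
  · rw [hrep z hz]
    exact hwu z hz

/-- Split the series at time N; each later term is a survival probability times a bound for the
kernel at time N. -/
theorem green_le {A : Finset Γ} {x z : Γ} {N : ℕ} {M M' : ℝ}
    (h : ∀ n < N, W.ker A n x z ≤ M) (h' : ∀ v ∈ A, W.ker A N v z ≤ M') :
    W.green A x z ≤ N * M + W.meanExit A x * M' := by
  unfold green
  rw [← (W.summable_ker hp A x z).sum_add_tsum_nat_add N]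
  refine add_le_add ?_ ?_
  · refine (Finset.sum_le_sum fun n hn => h n (Finset.mem_range.1 hn)).trans ?_
    rw [Finset.sum_const, Finset.card_range, nsmul_eq_mul]
  · rw [meanExit, ← tsum_mul_right]
    refine Summable.tsum_le_tsum (fun k => ?_) ((summable_nat_add_iff N).2
      (W.summable_ker hp A x z)) ((W.summable_surv hp A x).mul_right M')
    rw [ker_add, surv, Finset.sum_mul]
    exact Finset.sum_le_sum fun v hv => mul_le_mul_of_nonneg_left (h' v hv) (W.ker_nonneg A k x v)

end

variable [Infinite Γ] [Countable Γ] [MeasurableSpace Γ] [MeasurableSingletonClass Γ]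
variable (hp : W.ControlledWeights)
include hp

/-! ### Heat kernel and Green kernel bounds under the upper estimate -/

omit hp in
theorem DUE_of_UE (hU : W.UE) : W.DUE := by
  obtain ⟨C, β, c, hC, hβ, -, h⟩ := hU
  refine ⟨C, by linarith, fun x n hn => ?_⟩
  have h1 := h x x n hn
  rwa [W.dist_self, Nat.cast_zero, W.E_eq_zero x le_rfl, zero_div,
    Real.zero_rpow (one_div_pos.2 (sub_pos.2 hβ)).ne', mul_zero, neg_zero, Real.exp_zero,
    mul_one] at h1

/-- Uniform in time: for small n the volume at scale e(x,n) is too small by a power of E(x,R)/n,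
which the off-diagonal exponential compensates. -/
theorem UE.exists_pg_le (hV : W.VD) (hT : W.TC) (hU : W.UE) : ∃ C : ℝ, 1 ≤ C ∧
    ∀ (x z : Γ) (R : ℝ) (n : ℕ), 0 < R → R / 4 ≤ W.dist x z → W.pg n x z ≤ C / W.vol x R := by
  obtain ⟨C₁, β, c, hC₁, hβ, hc, h⟩ := hU
  obtain ⟨C₂, b, hC₂, -, hpow⟩ := TC.exists_pow W hp hT
  obtain ⟨C₃, a, hC₃, hvol⟩ := W.exists_vol_le_vol_e hp hV hT
  obtain ⟨γ, hγ⟩ : ∃ γ, γ = 1 / (β - 1) := ⟨_, rfl⟩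
  have hγ0 : 0 < γ := by rw [hγ]; exact one_div_pos.2 (sub_pos.2 hβ)
  obtain ⟨K, hK⟩ : ∃ K, K = C₂ * 4 ^ b := ⟨_, rfl⟩
  have hK0 : 0 < K := by rw [hK]; positivity
  obtain ⟨C₄, hC₄, hexp⟩ := exists_pow_mul_exp_le a (c := c / K ^ γ) (by positivity) hγ0
  refine ⟨C₁ * (C₃ * C₄), one_le_mul_of_one_le_of_one_le hC₁.le
    (one_le_mul_of_one_le_of_one_le hC₃ hC₄), fun x z R n hR hz => ?_⟩
  have hVR := W.vol_pos hp (x := x) hR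
  rcases Nat.eq_zero_or_pos n with rfl | hn
  · have hxz : x ≠ z := by
      rintro rfl
      rw [W.dist_self, Nat.cast_zero] at hz
      linarith
    rw [pg, gker, W.ker_zero_ne hxz, zero_div]
    positivity
  have hn0 : (0 : ℝ) < n := by exact_mod_cast hn
  have h1 := h x z n hn
  rw [W.pn_eq_pg hp, ← hγ] at h1
  have h2 := hvol x R n hn
  obtain ⟨t, ht⟩ : ∃ t, t = W.E x R / n := ⟨_, rfl⟩
  have ht0 : 0 ≤ t := by rw [ht]; exact div_nonneg (W.E_nonneg x R) hn0.le
  rw [← ht] at h2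
  have h3 : t / K ≤ W.E x (W.dist x z) / n := by
    have h4 := hpow x x R (R / 4) (by linarith) (by linarith) (W.self_mem_ballF hp (by linarith))
    have h5 : R / (R / 4) = 4 := by field_simp
    rw [h5, ← hK] at h4
    have h6 := W.E_mono hp x hz
    rw [ht, div_div, div_le_div_iff₀ (by positivity) hn0]
    calc W.E x R * n ≤ K * W.E x (W.dist x z) * n := by gcongr; exact h4.trans (by gcongr)
      _ = _ := by ring
  have h4 : c / K ^ γ * t ^ γ ≤ c * (W.E x (W.dist x z) / n) ^ γ := by
    calc c / K ^ γ * t ^ γ = c * (t / K) ^ γ := by rw [Real.div_rpow ht0 hK0.le]; ring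
      _ ≤ _ := by gcongr
  have hve := W.vol_e_pos hp x hn
  calc W.pg n x z ≤ C₁ / W.vol x (W.e x n) * Real.exp (-(c / K ^ γ * t ^ γ)) :=
        h1.trans (by gcongr)
    _ ≤ C₁ * (C₃ * C₄) / W.vol x R := by
      rw [le_div_iff₀ hVR, div_mul_eq_mul_div, div_mul_eq_mul_div, div_le_iff₀ hve]
      calc C₁ * Real.exp (-(c / K ^ γ * t ^ γ)) * W.vol x R
          ≤ C₁ * Real.exp (-(c / K ^ γ * t ^ γ)) * (C₃ * (1 + t) ^ a * W.vol x (W.e x n)) := by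
            gcongr
        _ = C₁ * (C₃ * ((1 + t) ^ a * Real.exp (-(c / K ^ γ * t ^ γ)))) * W.vol x (W.e x n) := by
            ring
        _ ≤ C₁ * (C₃ * C₄) * W.vol x (W.e x n) := by
            gcongr
            exact hexp t ht0

/-- About E(x,R) early terms are controlled by the time-uniform off-diagonal bound, the later ones
by (DUE) at time ⌈E(x,R)⌉. -/
theorem UE.exists_green_le (hV : W.VD) (hT : W.TC) (hU : W.UE) : ∃ C : ℝ, 1 ≤ C ∧
    ∀ (x z : Γ) (R : ℝ), 0 < R → z ∈ W.ballF x R → R / 4 ≤ W.dist x z →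
      W.green (W.ballF x R) x z ≤ C * W.E x R / W.vol x R * W.mu z := by
  obtain ⟨C₁, hC₁, h₁⟩ := UE.exists_pg_le W hp hV hT hU
  obtain ⟨C₂, a, hC₂, h₂⟩ := DUE.exists_pg_mul_vol_le W hp hV hT (W.DUE_of_UE hU)
  refine ⟨2 * C₁ + C₂ * 2 ^ a, ?_, fun x z R hR hz hd => ?_⟩
  · have : 0 ≤ C₂ * 2 ^ a := by positivity
    linarith
  have hVR := W.vol_pos hp (x := x) hR
  have hE1 := W.one_le_E hp x hR
  have hμ := W.mu_pos z
  have hker : ∀ n v, W.ker (W.ballF x R) n v z ≤ W.pg n v z * W.mu z := by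
    intro n v
    rw [← W.pk_mul_mu]
    exact mul_le_mul_of_nonneg_right (W.pk_le_pg hp _ n v z) hμ.le
  obtain ⟨N, hN⟩ : ∃ N, N = ⌈W.E x R⌉₊ := ⟨_, rfl⟩
  have hN1 : W.E x R ≤ N := by rw [hN]; exact Nat.le_ceil _
  have hN2 : (N : ℝ) ≤ 2 * W.E x R := by
    have : (N : ℝ) < W.E x R + 1 := by rw [hN]; exact Nat.ceil_lt_add_one (by linarith)
    linarith
  have hN0 : 0 < N := by
    have : (0 : ℝ) < N := by linarith
    exact_mod_cast this
  have hM' : ∀ v ∈ W.ballF x R, W.ker (W.ballF x R) N v z ≤ C₂ * 2 ^ a / W.vol x R * W.mu z := by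
    intro v hv
    refine (hker N v).trans (mul_le_mul_of_nonneg_right ?_ hμ.le)
    rw [le_div_iff₀ hVR]
    refine (h₂ x v z R N N hR hN0 (Nat.div_le_self _ _) ((W.mem_ballF hp).1 hv).le
      ((W.mem_ballF hp).1 hz).le).trans ?_
    have h3 : W.E x R / N ≤ 1 := div_le_one_of_le₀ hN1 (Nat.cast_nonneg _)
    have h4 : 0 ≤ W.E x R / N := by positivity
    gcongr
    linarith
  have key := W.green_le hp (A := W.ballF x R) (x := x) (z := z) (N := N)
    (M := C₁ / W.vol x R * W.mu z) (fun n _ => (hker n x).trans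
      (mul_le_mul_of_nonneg_right (h₁ x z R n hR hd) hμ.le)) hM'
  rw [← W.E_eq_meanExit hp x hR] at key
  refine key.trans ?_
  calc N * (C₁ / W.vol x R * W.mu z) + W.E x R * (C₂ * 2 ^ a / W.vol x R * W.mu z)
      ≤ 2 * W.E x R * (C₁ / W.vol x R * W.mu z)
        + W.E x R * (C₂ * 2 ^ a / W.vol x R * W.mu z) := by gcongr
    _ = _ := by ring

theorem MV_of_UE (hV : W.VD) (hT : W.TC) (hU : W.UE) : W.MV := by
  obtain ⟨C₁, hC₁, hgreen⟩ := UE.exists_green_le W hp hV hT hU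
  obtain ⟨C₂, b, hC₂, -, hpow⟩ := TC.exists_pow W hp hT
  obtain ⟨D, a, hD, hvol⟩ := VD.exists_pow W hp hV
  refine ⟨D * 4 ^ a + C₁ * (C₂ * 2 ^ b), by positivity, fun x R hR u hu hh => ?_⟩
  rw [W.tsum_ball hp x R fun y => u y * W.mu y]
  have hxB := W.self_mem_ballF hp (x := x) hR
  have huB : ∀ z ∈ W.ballF x R, 0 ≤ u z := fun z hz => hu z (Or.inl ((W.mem_ball_iff hp).2 hz))
  have huB' : ∀ z ∈ W.ballF x R, ∀ y, W.Adj z y → 0 ≤ u y := fun z hz y hy =>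
    hu y (Or.inr ⟨z, (W.mem_ball_iff hp).2 hz, hy⟩)
  have hVR := W.vol_pos hp (x := x) hR
  have hS0 : ∀ z ∈ W.ballF x R, 0 ≤ u z * W.mu z := fun z hz =>
    mul_nonneg (huB z hz) (W.mu_pos z).le
  have hS : 0 ≤ ∑ z ∈ W.ballF x R, u z * W.mu z := Finset.sum_nonneg hS0
  -- For small radii the volume is at most a multiple of μ(x), so the term y = x suffices. For R > 4
  -- one step is less than R/4, which keeps the inner boundary of B(x,R/2) at distance at least R/4.
  rcases le_or_gt R 4 with hR4 | hR4
  · have h1 : W.vol x R ≤ D * 4 ^ a * W.mu x := by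
      have h2 := hvol x x 4 1 one_pos (by norm_num) (W.self_mem_ballF hp (by norm_num))
      rw [div_one, W.vol_one hp one_pos le_rfl] at h2
      exact (W.vol_mono hp hR4).trans h2
    have h2 := Finset.single_le_sum hS0 hxB
    rw [div_mul_eq_mul_div, le_div_iff₀ hVR]
    have h3 := huB x hxB
    have h4 : 0 ≤ C₁ * (C₂ * 2 ^ b) := by positivity
    calc u x * W.vol x R ≤ u x * (D * 4 ^ a * W.mu x) := by gcongr
      _ = D * 4 ^ a * (u x * W.mu x) := by ring
      _ ≤ (D * 4 ^ a + C₁ * (C₂ * 2 ^ b)) * ∑ z ∈ W.ballF x R, u z * W.mu z := by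
        exact mul_le_mul (by linarith) h2 (hS0 x hxB) (by positivity)
  · have hadjΩ : ∀ z ∈ W.ballF x R, ∀ y, W.Adj z y → y ∈ W.ballF x (R + 1) := by
      intro z hz y hy
      have h1 := (W.mem_ballF hp).1 hz
      have h2 := W.dist_triangle_real x z y
      have h3 : (W.dist z y : ℝ) ≤ 1 := by exact_mod_cast W.dist_le_one hy
      exact (W.mem_ballF hp).2 (by linarith)
    obtain ⟨ν, hν0, hν1, hν2, hν3⟩ := W.exists_balayage hp (B := W.ballF x R)
      (B' := W.ballF x (R / 2)) (Ω := W.ballF x (R + 1)) (u := u) (W.ballF_mono hp (by linarith))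
      (W.ballF_mono hp (by linarith)) huB' (fun z hz => by
        rw [← hh z ((W.mem_ball_iff hp).2 hz), markovOp, tsum_eq_sum]
        intro y hy
        rw [W.P_eq_zero (fun h => hy (hadjΩ z hz y h)), zero_mul])
    have hE := W.E_pos hp x hR
    have hx' := W.self_mem_ballF hp (x := x) (R := R / 2) (by linarith)
    have h1 : u x ≤ C₁ * W.E x R / W.vol x R * ∑ v ∈ W.ballF x (R / 2), ν v * W.mu v := by
      rw [← hν2 x hx', Finset.mul_sum]
      refine Finset.sum_le_sum fun v hv => ?_
      by_cases hadj : ∀ y, W.Adj v y → y ∈ W.ballF x (R / 2)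
      · rw [hν1 v hv hadj, mul_zero, zero_mul, mul_zero]
      · push Not at hadj
        obtain ⟨y, hvy, hy⟩ := hadj
        have h2 : R / 4 ≤ W.dist x v := by
          rw [W.mem_ballF hp, not_lt] at hy
          have h3 := W.dist_triangle_real x v y
          have h4 : (W.dist v y : ℝ) ≤ 1 := by exact_mod_cast W.dist_le_one hvy
          linarith
        have h3 := hgreen x v R hR (W.ballF_mono hp (by linarith) hv) h2
        calc W.green (W.ballF x R) x v * ν v ≤ C₁ * W.E x R / W.vol x R * W.mu v * ν v :=
              mul_le_mul_of_nonneg_right h3 (hν0 v hv)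
          _ = _ := by ring
    -- The mass of ν is read off from u: integrating the potential against μ gives each v the weight
    -- μ(v) times its mean exit time, and the potential is at most u on the whole ball.
    have h2 : W.E x R * ∑ v ∈ W.ballF x (R / 2), ν v * W.mu v
        ≤ C₂ * 2 ^ b * ∑ z ∈ W.ballF x R, u z * W.mu z := by
      have h3 : ∑ v ∈ W.ballF x (R / 2), ν v * (W.mu v * W.meanExit (W.ballF x R) v)
          ≤ ∑ z ∈ W.ballF x R, u z * W.mu z := by
        simp_rw [← W.sum_green_mul_mu hp, Finset.mul_sum]
        rw [Finset.sum_comm]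
        refine Finset.sum_le_sum fun z hz => ?_
        refine le_trans (le_of_eq ?_) (mul_le_mul_of_nonneg_right (hν3 z hz) (W.mu_pos z).le)
        rw [Finset.sum_mul]
        exact Finset.sum_congr rfl fun v _ => by ring
      refine le_trans ?_ (mul_le_mul_of_nonneg_left h3 (by positivity))
      rw [Finset.mul_sum, Finset.mul_sum]
      refine Finset.sum_le_sum fun v hv => ?_
      have h4 := hpow x v R (R / 2) (by linarith) (by linarith) (W.ballF_mono hp (by linarith) hv)
      have h5 : R / (R / 2) = 2 := by field_simp
      rw [h5] at h4
      have h6 := W.E_le_meanExit hp (x := x) (y := v) (R := R / 2) (S := R) (by linarith) (by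
        have := (W.mem_ballF hp).1 hv
        linarith)
      have h7 := hν0 v hv
      have h8 := W.mu_pos v
      calc W.E x R * (ν v * W.mu v)
          ≤ C₂ * 2 ^ b * W.meanExit (W.ballF x R) v * (ν v * W.mu v) := by
            refine mul_le_mul_of_nonneg_right (h4.trans ?_) (by positivity)
            gcongr
        _ = _ := by ring
    have h4 : 0 ≤ D * 4 ^ a := by positivity
    calc u x ≤ C₁ * W.E x R / W.vol x R * ∑ v ∈ W.ballF x (R / 2), ν v * W.mu v := h1
      _ = C₁ / W.vol x R * (W.E x R * ∑ v ∈ W.ballF x (R / 2), ν v * W.mu v) := by ring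
      _ ≤ C₁ / W.vol x R * (C₂ * 2 ^ b * ∑ z ∈ W.ballF x R, u z * W.mu z) := by gcongr
      _ = C₁ * (C₂ * 2 ^ b) / W.vol x R * ∑ z ∈ W.ballF x R, u z * W.mu z := by ring
      _ ≤ _ := by
        gcongr
        linarith

end WeightedGraph
end

noncomputable section

namespace WeightedGraph

variable {Γ : Type*} (W : WeightedGraph Γ)

/-! ### Local diagonal upper estimates from the mean value inequality -/

theorem exists_mul_pow_lt_two_pow (A : ℝ) (m : ℕ) : ∃ q : ℕ, 2 ≤ q ∧ 8 * (A * q) ^ m < 2 ^ q := by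
  have h := (tendsto_pow_const_div_const_pow_of_one_lt m (one_lt_two (α := ℝ))).const_mul
    (8 * A ^ m)
  rw [mul_zero] at h
  obtain ⟨q, hq, hq2⟩ := ((h.eventually_lt_const one_pos).and
    (Filter.eventually_ge_atTop 2)).exists
  refine ⟨q, hq2, ?_⟩
  rw [mul_div_assoc', div_lt_one (by positivity)] at hq
  rw [mul_pow, ← mul_assoc]
  exact hq

section

variable [Infinite Γ] (hp : W.ControlledWeights)
include hp

/-- The difference is harmonic in B', since the pole contributions cancel, and on the outer boundary
of B' only the Green kernel of B remains. -/
theorem green_sub_le {B B' : Finset Γ} (hB : B' ⊆ B) (hadj : ∀ z ∈ B', ∀ w, W.Adj z w → w ∈ B)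
    {y : Γ} {M : ℝ} (hM : ∀ w, w ∉ B' → (∃ z ∈ B', W.Adj z w) → W.green B w y ≤ M) {x : Γ}
    (hx : x ∈ B') : W.green B x y - W.green B' x y ≤ M := by
  have h := W.nonpos_of_subharmonic hp hB (F := fun z => W.green B z y - W.green B' z y - M)
    (fun z hz => ?_) (fun w hw hz => ?_) hx
  · linarith
  · have h1 : ∑ v ∈ B', W.P z v * W.green B' v y = ∑ v ∈ B, W.P z v * W.green B' v y :=
      Finset.sum_subset hB fun v _ hv => by rw [W.green_eq_zero_left hv, mul_zero]
    have h2 : W.ker B 0 z y = W.ker B' 0 z y := by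
      by_cases hzy : z = y
      · subst hzy
        rw [W.ker_zero_self hz, W.ker_zero_self (hB hz)]
      · rw [W.ker_zero_ne hzy, W.ker_zero_ne hzy]
    simp_rw [mul_sub, Finset.sum_sub_distrib, ← Finset.sum_mul]
    rw [W.sum_P_eq_one (hadj z hz), one_mul, W.green_eq hp hz, W.green_eq hp (hB hz), h1, h2]
    linarith
  · have := hM w hw hz
    rw [W.green_eq_zero_left hw]
    linarith

theorem sum_ker_two_mul_sub_le {B B' : Finset Γ} (hB : B' ⊆ B) (x y : Γ) (s : Finset ℕ) :
    ∑ i ∈ s, (W.ker B (2 * i) x y - W.ker B' (2 * i) x y) ≤ W.green B x y - W.green B' x y := by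
  have hs := (W.summable_ker hp B x y).sub (W.summable_ker hp B' x y)
  have h1 : ∑ i ∈ s, (W.ker B (2 * i) x y - W.ker B' (2 * i) x y)
      = ∑ i ∈ s.image (2 * ·), (W.ker B i x y - W.ker B' i x y) :=
    (Finset.sum_image (f := fun i => W.ker B i x y - W.ker B' i x y)
      fun i _ j _ h => by simpa using h).symm
  rw [h1, green, green, ← (W.summable_ker hp B x y).tsum_sub (W.summable_ker hp B' x y)]
  exact hs.sum_le_tsum _ fun i _ => sub_nonneg.2 (W.ker_mono hB i x y)

end

variable [Infinite Γ] [Countable Γ] [MeasurableSpace Γ] [MeasurableSingletonClass Γ]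
variable (hp : W.ControlledWeights)
include hp

/-! ### Green functions under the mean value inequality and induction on scales -/

theorem MV.exists_green_le (hM : W.MV) : ∃ C : ℝ, 0 < C ∧ ∀ (x z : Γ) (R r : ℝ), 0 < r → 0 < R →
    r ≤ W.dist x z → W.dist x z + r ≤ R →
      W.green (W.ballF x R) z x ≤ C * W.E x R / W.vol z r * W.mu x := by
  obtain ⟨C, hC, h⟩ := hM
  refine ⟨C, hC, fun x z R r hr hR hd hdR => ?_⟩
  have hsub := W.ballF_subset hp hdR
  have h1 := h z r hr (fun y => W.green (W.ballF x R) y x) (fun y _ => W.green_nonneg _ y x) (by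
    intro y hy
    rw [W.mem_ball_iff hp] at hy
    have hyx : y ≠ x := by
      rintro rfl
      rw [W.mem_ballF hp, W.dist_comm] at hy
      linarith
    change _ = W.green (W.ballF x R) y x
    rw [W.green_eq hp (hsub hy), W.ker_zero_ne hyx, zero_add, markovOp, tsum_eq_sum]
    intro v hv
    rw [W.green_eq_zero_left hv, mul_zero])
  rw [W.tsum_ball hp z r fun y => W.green (W.ballF x R) y x * W.mu y] at h1
  have h2 : ∑ y ∈ W.ballF z r, W.green (W.ballF x R) y x * W.mu y ≤ W.mu x * W.E x R := by
    rw [W.E_eq_meanExit hp x hR, ← W.sum_green_mul_mu hp]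
    exact Finset.sum_le_sum_of_subset_of_nonneg hsub fun y _ _ =>
      mul_nonneg (W.green_nonneg _ y x) (W.mu_pos y).le
  have h3 := W.vol_pos hp (x := z) hr
  calc W.green (W.ballF x R) z x ≤ C / W.vol z r * (W.mu x * W.E x R) :=
        h1.trans (by gcongr)
    _ = _ := by ring

/-- The differences are nonnegative, so their even-time sum is at most the difference of the Green
kernels. That difference is governed by points w at distance between R and 2R; the condition q ≥ 2
keeps B(w,R) inside the outer ball. -/
theorem MV.exists_sum_pk_sub_le (hV : W.VD) (hM : W.MV) (q : ℕ) (hq : 2 ≤ q) : ∃ C : ℝ, 0 < C ∧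
    ∀ (x : Γ) (R : ℝ), 1 ≤ R → ∀ s : Finset ℕ,
      ∑ i ∈ s, (W.pk (W.ballF x (2 ^ q * R)) (2 * i) x x - W.pk (W.ballF x R) (2 * i) x x)
        ≤ C * W.E x (2 ^ q * R) / W.vol x (2 ^ q * R) := by
  obtain ⟨C, hC, hgreen⟩ := MV.exists_green_le W hp hM
  obtain ⟨D, a, hD, hvol⟩ := VD.exists_pow W hp hV
  refine ⟨C * (D * (2 ^ q) ^ a), by positivity, fun x R hR s => ?_⟩
  have hq4 : (4 : ℝ) ≤ 2 ^ q := by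
    calc (4 : ℝ) = 2 ^ 2 := by norm_num
      _ ≤ 2 ^ q := pow_le_pow_right₀ (by norm_num) hq
  have hRq : 4 * R ≤ 2 ^ q * R := by gcongr
  have hR0 : 0 < 2 ^ q * R := by linarith
  have hsub : W.ballF x R ⊆ W.ballF x (2 ^ q * R) := W.ballF_mono hp (by linarith)
  have hμ := W.mu_pos x
  have hVx := W.vol_pos hp (x := x) hR0
  have hdw : ∀ w, (∃ z ∈ W.ballF x R, W.Adj z w) → (W.dist x w : ℝ) ≤ 2 * R := fun w hw => by
    have := W.dist_le_of_boundary hp rfl hw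
    linarith
  have h1 := W.green_sub_le hp hsub (y := x)
    (M := C * (D * (2 ^ q) ^ a) * W.E x (2 ^ q * R) / W.vol x (2 ^ q * R) * W.mu x)
    (fun z hz w hw => (W.mem_ballF hp).2 (by
      have := hdw w ⟨z, hz, hw⟩
      linarith)) (fun w hw hz => by
      have h2 := hdw w hz
      rw [W.mem_ballF hp, not_lt] at hw
      refine (hgreen x w (2 ^ q * R) R (by linarith) hR0 hw (by linarith)).trans ?_
      have h3 := hvol x w (2 ^ q * R) R (by linarith) (by linarith)
        ((W.mem_ballF hp).2 (by linarith))
      rw [mul_div_assoc, div_self (by linarith), mul_one] at h3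
      have h4 := W.vol_pos hp (x := w) (show 0 < R by linarith)
      have h5 := W.E_nonneg x (2 ^ q * R)
      refine mul_le_mul_of_nonneg_right ?_ hμ.le
      rw [div_le_div_iff₀ h4 hVx]
      calc C * W.E x (2 ^ q * R) * W.vol x (2 ^ q * R)
          ≤ C * W.E x (2 ^ q * R) * (D * (2 ^ q) ^ a * W.vol w R) := by gcongr
        _ = _ := by ring) (W.self_mem_ballF hp (by linarith) : x ∈ W.ballF x R)
  have h2 := (W.sum_ker_two_mul_sub_le hp hsub x x s).trans h1
  simp_rw [pk, ← sub_div]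
  rw [← Finset.sum_div, div_le_iff₀ hμ]
  exact h2

/-- The diagonal of the heat kernel killed outside a ball decays fast after the time scale of the
ball. -/
theorem exists_pk_two_mul_le_pow (hT : W.TC) : ∃ C : ℝ, 1 ≤ C ∧
    ∀ (x : Γ) (R : ℝ) (k i j : ℕ), 0 < R → j + 3 * C * k * W.E x R ≤ i →
      W.pk (W.ballF x R) (2 * i) x x ≤ (1 / 4) ^ k * W.pk (W.ballF x R) (2 * j) x x := by
  obtain ⟨C, hC, h⟩ := TC.exists_meanExit_le W hp hT
  refine ⟨C, hC, fun x R k i j hR hi => ?_⟩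
  have hE := W.one_le_E hp x hR
  have hM1 : 1 ≤ C * W.E x R := one_le_mul_of_one_le_of_one_le hC hE
  obtain ⟨K, hK⟩ : ∃ K, K = ⌈2 * (C * W.E x R)⌉₊ := ⟨_, rfl⟩
  have hK1 : 2 * (C * W.E x R) ≤ K := by rw [hK]; exact Nat.le_ceil _
  have hK2 : (K : ℝ) ≤ 3 * (C * W.E x R) := by
    have : (K : ℝ) < 2 * (C * W.E x R) + 1 := by rw [hK]; exact Nat.ceil_lt_add_one (by linarith)
    linarith
  have hK0 : 0 < K := by
    have : (0 : ℝ) < K := by linarith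
    exact_mod_cast this
  have h1 : ∀ z ∈ W.ballF x R, W.surv (W.ballF x R) (k * K) z ≤ (1 / 2) ^ k := fun z _ =>
    W.surv_le_half_pow hp (fun z _ => h x z R hR) hK1 hK0 k z
  have h2 := W.pk_two_mul_add_le (by positivity) h1 j x
  rw [← pow_mul, mul_comm k 2, pow_mul, div_pow, one_pow] at h2
  norm_num only at h2
  refine (W.pk_two_mul_antitone (W.ballF x R) x (?_ : j + k * K ≤ i)).trans h2
  have h3 : (j : ℝ) + k * K ≤ i := by
    refine le_trans ?_ hi
    have : (k : ℝ) * K ≤ k * (3 * (C * W.E x R)) := by gcongr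
    linarith
  exact_mod_cast h3

/-- Induction on scales with ratio 2 ^ q and a fixed constant A. Over times in (n/2, n] the outer
kernel exceeds the inner one by a sum of order E/V, while the inner kernel, bounded inductively, has
decayed enough to beat the volume ratio. Monotonicity in time then isolates the value at 2n. -/
theorem localDUE_of_MV (hV : W.VD) (hT : W.TC) (hM : W.MV) : W.LocalDUE := by
  obtain ⟨C₁, hC₁, hdecay⟩ := W.exists_pk_two_mul_le_pow hp hT
  obtain ⟨D, a, hD, hvol⟩ := VD.exists_pow W hp hV
  obtain ⟨m, hm⟩ := TC.exists_ratio_le W hp hT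
  intro ε hε
  obtain ⟨k₀, hk₀⟩ := pow_unbounded_of_one_lt (4 * D) (show (1 : ℝ) < 4 by norm_num)
  -- The decay must beat a volume ratio of order 2 ^ (q a), which takes a time linear in q times
  -- E(x,R). Since E grows at least like a power of the radius, a large q makes E(x,2^q R) dominate
  -- that time.
  obtain ⟨q, hq2, hq⟩ := exists_mul_pow_lt_two_pow
    (4 / ε * (ε / 2 + 1 + 3 * C₁ * (a + k₀))) m
  obtain ⟨C₂, hC₂, hdiff⟩ := MV.exists_sum_pk_sub_le W hp hV hM q hq2
  have hq1 : (1 : ℝ) ≤ q := by exact_mod_cast (by omega : 1 ≤ q)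
  have hscale : ∀ (x : Γ) (R : ℝ), 1 ≤ R →
      (ε / 2 + 1 + 3 * C₁ * (q * a + k₀ : ℕ)) * W.E x R ≤ ε / 4 * W.E x (2 ^ q * R) := by
    intro x R hR
    have hE := W.E_pos hp x (show 0 < R by linarith)
    by_contra! hlt
    have h2q : (1 : ℝ) ≤ 2 ^ q := one_le_pow₀ (by norm_num)
    have h1 := hm x (2 ^ q * R) R hR (by nlinarith)
    rw [mul_div_assoc, div_self (by linarith), mul_one] at h1
    have h2 : W.E x (2 ^ q * R) / W.E x R ≤ 4 / ε * (ε / 2 + 1 + 3 * C₁ * (a + k₀)) * q := by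
      rw [div_le_iff₀ hE]
      have h3 : ε / 2 + 1 + 3 * C₁ * (q * a + k₀ : ℕ) ≤ (ε / 2 + 1 + 3 * C₁ * (a + k₀)) * q := by
        push_cast
        have : (k₀ : ℝ) ≤ k₀ * q := le_mul_of_one_le_right (Nat.cast_nonneg _) hq1
        have h4 : 3 * C₁ * k₀ ≤ 3 * C₁ * (k₀ * q) := by gcongr
        have h5 : ε / 2 + 1 ≤ (ε / 2 + 1) * q := le_mul_of_one_le_right (by positivity) hq1
        linarith
      have h4 := hlt.le.trans (mul_le_mul_of_nonneg_right h3 hE.le)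
      calc W.E x (2 ^ q * R) = 4 / ε * (ε / 4 * W.E x (2 ^ q * R)) := by field_simp
        _ ≤ 4 / ε * ((ε / 2 + 1 + 3 * C₁ * (a + k₀)) * q * W.E x R) := by gcongr
        _ = _ := by ring
    have h3 : 0 ≤ W.E x (2 ^ q * R) / W.E x R := div_nonneg (W.E_nonneg x _) hE.le
    have h4 : 8 * (W.E x (2 ^ q * R) / W.E x R) ^ m
        ≤ 8 * (4 / ε * (ε / 2 + 1 + 3 * C₁ * (a + k₀)) * q) ^ m := by gcongr
    linarith
  -- The first summand covers radii up to 2 ^ q; the second makes the Green difference cost at most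
  -- A/2 on average in the inductive step.
  obtain ⟨A, hA⟩ : ∃ A, A = D * (2 ^ q) ^ a + 8 * C₂ / ε := ⟨_, rfl⟩
  have hA1 : D * (2 ^ q) ^ a ≤ A := by
    rw [hA]
    have : 0 ≤ 8 * C₂ / ε := by positivity
    linarith
  have hA2 : 8 * C₂ / ε ≤ A := by
    rw [hA]
    have : 0 ≤ D * (2 ^ q) ^ a := by positivity
    linarith
  have h2q : (1 : ℝ) ≤ 2 ^ q := one_le_pow₀ (by norm_num)
  have hA0 : 1 ≤ A := (one_le_mul_of_one_le_of_one_le hD (one_le_pow₀ h2q)).trans hA1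
  have hsmall : ∀ (x : Γ) (R : ℝ) (n : ℕ), 0 < R → R ≤ 2 ^ q →
      W.pk (W.ballF x R) (2 * n) x x ≤ A / W.vol x R := by
    intro x R n hR hRq
    have hμ := W.mu_pos x
    have h1 := (W.pk_le_pg hp (W.ballF x R) (2 * n) x x).trans (W.pg_le_inv_mu (2 * n) x x)
    refine h1.trans ?_
    rw [div_le_div_iff₀ hμ (W.vol_pos hp hR), one_mul]
    have h2 := hvol x x (2 ^ q) 1 one_pos h2q (W.self_mem_ballF hp (by linarith))
    rw [div_one, W.vol_one hp one_pos le_rfl] at h2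
    exact ((W.vol_mono hp hRq).trans h2).trans (by gcongr)
  have hstep : ∀ (x : Γ) (R : ℝ), 1 ≤ R →
      (∀ n : ℕ, ε * W.E x R ≤ 2 * n → W.pk (W.ballF x R) (2 * n) x x ≤ A / W.vol x R) →
      ∀ n : ℕ, ε * W.E x (2 ^ q * R) ≤ 2 * n →
        W.pk (W.ballF x (2 ^ q * R)) (2 * n) x x ≤ A / W.vol x (2 ^ q * R) := by
    intro x R hR hind n hn
    have hR0 : 0 < R := by linarith
    have hqR : 0 < 2 ^ q * R := by positivity
    have hE1 := W.one_le_E hp x hR0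
    have hE' := W.E_pos hp x hqR
    have hV1 := W.vol_pos hp (x := x) hR0
    have hV2 := W.vol_pos hp (x := x) hqR
    have hn0 : (0 : ℝ) < n := by
      have : 0 < ε * W.E x (2 ^ q * R) := by positivity
      linarith
    obtain ⟨j, hj⟩ : ∃ j, j = ⌈ε * W.E x R / 2⌉₊ := ⟨_, rfl⟩
    have hj1 : ε * W.E x R / 2 ≤ j := by rw [hj]; exact Nat.le_ceil _
    have hj2 : (j : ℝ) ≤ ε * W.E x R / 2 + 1 := by
      rw [hj]; exact (Nat.ceil_lt_add_one (by positivity)).le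
    have hinner : ∀ i ∈ Finset.Ioc (n / 2) n,
        W.pk (W.ballF x R) (2 * i) x x ≤ A / 4 / W.vol x (2 ^ q * R) := by
      intro i hi
      rw [Finset.mem_Ioc] at hi
      have hi' : (n : ℝ) ≤ 2 * i := by exact_mod_cast (by omega : n ≤ 2 * i)
      have h1 := hdecay x R (q * a + k₀) i j hR0 (by
        have := hscale x R hR
        linarith)
      have h2 := hind j (by linarith)
      have h3 := hvol x x (2 ^ q * R) R hR0 (by nlinarith) (W.self_mem_ballF hp (by linarith))
      rw [mul_div_assoc, div_self hR0.ne', mul_one, ← pow_mul] at h3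
      refine h1.trans ((mul_le_mul_of_nonneg_left h2 (by positivity)).trans ?_)
      rw [mul_div_assoc', div_le_div_iff₀ hV1 hV2]
      have h4 : (1 / 4 : ℝ) ^ (q * a + k₀) * (D * 2 ^ (q * a)) ≤ 1 / 4 := by
        have h5 : (1 / 4 : ℝ) ^ (q * a) * 2 ^ (q * a) ≤ 1 := by
          rw [← mul_pow]
          exact pow_le_one₀ (by norm_num) (by norm_num)
        have h6 : (1 / 4 : ℝ) ^ k₀ * D ≤ 1 / 4 := by
          rw [div_pow, one_pow, one_div_mul_eq_div, div_le_iff₀ (by positivity)]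
          linarith
        calc (1 / 4 : ℝ) ^ (q * a + k₀) * (D * 2 ^ (q * a))
            = ((1 / 4 : ℝ) ^ (q * a) * 2 ^ (q * a)) * ((1 / 4 : ℝ) ^ k₀ * D) := by
              rw [pow_add]; ring
          _ ≤ 1 * (1 / 4) := by gcongr
          _ = 1 / 4 := one_mul _
      calc (1 / 4 : ℝ) ^ (q * a + k₀) * A * W.vol x (2 ^ q * R)
          ≤ (1 / 4 : ℝ) ^ (q * a + k₀) * A * (D * 2 ^ (q * a) * W.vol x R) := by gcongr
        _ = (1 / 4 : ℝ) ^ (q * a + k₀) * (D * 2 ^ (q * a)) * (A * W.vol x R) := by ring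
        _ ≤ 1 / 4 * (A * W.vol x R) := by gcongr
        _ = A / 4 * W.vol x R := by ring
    have hsum := hdiff x R hR (Finset.Ioc (n / 2) n)
    rw [Finset.sum_sub_distrib] at hsum
    have hin := Finset.sum_le_card_nsmul _ _ _ hinner
    have hout := Finset.card_nsmul_le_sum (Finset.Ioc (n / 2) n)
      (fun i => W.pk (W.ballF x (2 ^ q * R)) (2 * i) x x)
      (W.pk (W.ballF x (2 ^ q * R)) (2 * n) x x)
      fun i hi => W.pk_two_mul_antitone _ x (Finset.mem_Ioc.1 hi).2
    rw [Nat.card_Ioc, nsmul_eq_mul] at hin hout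
    obtain ⟨N, hN⟩ : ∃ N : ℝ, N = (n - n / 2 : ℕ) := ⟨_, rfl⟩
    rw [← hN] at hin hout
    have hN2 : (n : ℝ) ≤ 2 * N := by
      rw [hN]
      exact_mod_cast (by omega : n ≤ 2 * (n - n / 2))
    have hN0 : 0 < N := by linarith
    have h1 : C₂ * W.E x (2 ^ q * R) / W.vol x (2 ^ q * R)
        ≤ N * (A / 2 / W.vol x (2 ^ q * R)) := by
      rw [mul_div_assoc', div_le_div_iff_of_pos_right hV2]
      have h2 : 8 * C₂ ≤ A * ε := (div_le_iff₀ hε).1 hA2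
      have h3 : ε * W.E x (2 ^ q * R) ≤ 4 * N := by linarith
      have h4 : 8 * C₂ * W.E x (2 ^ q * R) ≤ A * (4 * N) := by
        calc 8 * C₂ * W.E x (2 ^ q * R) ≤ A * ε * W.E x (2 ^ q * R) := by gcongr
          _ = A * (ε * W.E x (2 ^ q * R)) := by ring
          _ ≤ A * (4 * N) := by gcongr
      linarith
    have h2 : N * W.pk (W.ballF x (2 ^ q * R)) (2 * n) x x
        ≤ N * (A / W.vol x (2 ^ q * R)) := by
      have h3 : A / W.vol x (2 ^ q * R) = A / 2 / W.vol x (2 ^ q * R)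
          + A / 4 / W.vol x (2 ^ q * R) + A / 4 / W.vol x (2 ^ q * R) := by ring
      have h4 : 0 ≤ N * (A / 4 / W.vol x (2 ^ q * R)) := by positivity
      rw [h3, mul_add, mul_add]
      linarith
    exact le_of_mul_le_mul_left h2 hN0
  have hall : ∀ (s : ℕ) (x : Γ) (R : ℝ) (n : ℕ), 0 < R → R ≤ (2 ^ q) ^ s →
      ε * W.E x R ≤ 2 * n → W.pk (W.ballF x R) (2 * n) x x ≤ A / W.vol x R := by
    intro s
    induction s with
    | zero => exact fun x R n hR hRs _ => hsmall x R n hR (hRs.trans (by simpa using h2q))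
    | succ s ih =>
      intro x R n hR hRs hn
      rcases le_or_gt R (2 ^ q) with h | h
      · exact hsmall x R n hR h
      have h0 : (0 : ℝ) < 2 ^ q := by positivity
      have hR' : R = 2 ^ q * (R / 2 ^ q) := by field_simp
      have h1 : 1 ≤ R / 2 ^ q := (one_le_div h0).2 h.le
      rw [hR'] at hn ⊢
      refine hstep x (R / 2 ^ q) h1 (fun n hn => ih x _ n (by positivity) ?_ hn) n hn
      rw [div_le_iff₀ h0, ← pow_succ]
      exact hRs
  refine ⟨A, hA0, fun x R n hR hn => ?_⟩
  obtain ⟨s, hs⟩ := pow_unbounded_of_one_lt R (show (1 : ℝ) < 2 ^ q from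
    one_lt_pow₀ (by norm_num) (by omega))
  exact hall s x R n hR hs.le hn

end WeightedGraph
end

noncomputable section

namespace WeightedGraph

variable {Γ : Type*} (W : WeightedGraph Γ)

/-! ### Consequences of the skewed parabolic mean value inequality -/

/-- The maximal mean exit time from `A`. -/
def maxExit (A : Finset Γ) : ℝ := ⨆ z : A, W.meanExit A z

theorem meanExit_le_maxExit (A : Finset Γ) {z : Γ} (hz : z ∈ A) : W.meanExit A z ≤ W.maxExit A :=
  le_ciSup (f := fun z : A => W.meanExit A z) (Set.finite_range _).bddAbove ⟨z, hz⟩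

theorem exists_meanExit_eq_maxExit {A : Finset Γ} (hA : A.Nonempty) :
    ∃ z ∈ A, W.meanExit A z = W.maxExit A := by
  have : Nonempty A := hA.to_subtype
  obtain ⟨z, hz⟩ := exists_eq_ciSup_of_finite (f := fun z : A => W.meanExit A z)
  exact ⟨z, z.2, hz⟩

variable [Infinite Γ] [Countable Γ] [MeasurableSpace Γ] [MeasurableSingletonClass Γ]
variable (hp : W.ControlledWeights)
include hp

theorem E_le_maxExit (x : Γ) {R : ℝ} (hR : 0 < R) : W.E x R ≤ W.maxExit (W.ballF x R) := by
  rw [W.E_eq_meanExit hp x hR]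
  exact W.meanExit_le_maxExit _ (W.self_mem_ballF hp hR)

theorem maxExit_pos (x : Γ) {R : ℝ} (hR : 0 < R) : 0 < W.maxExit (W.ballF x R) :=
  (W.E_pos hp x hR).trans_le (W.E_le_maxExit hp x hR)

theorem exists_maxExit_le_E (x : Γ) {R : ℝ} (hR : 0 < R) : ∃ z ∈ W.ballF x R,
    W.meanExit (W.ballF x R) z = W.maxExit (W.ballF x R) ∧
      W.maxExit (W.ballF x R) ≤ W.E z (2 * R) := by
  obtain ⟨z, hz, h⟩ := W.exists_meanExit_eq_maxExit ⟨x, W.self_mem_ballF hp hR⟩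
  exact ⟨z, hz, h, h ▸ W.meanExit_le_E hp hR hz⟩

theorem maxExit_le {x : Γ} {R M : ℝ} (hR : 0 < R)
    (h : ∀ z ∈ W.ballF x R, W.E z (2 * R) ≤ M) : W.maxExit (W.ballF x R) ≤ M := by
  obtain ⟨z, hz, -, h1⟩ := W.exists_maxExit_le_E hp x hR
  exact h1.trans (h z hz)

omit [Countable Γ] [MeasurableSpace Γ] [MeasurableSingletonClass Γ] in
theorem vol_le_vol_of_mem {x y : Γ} {R : ℝ} (hy : y ∈ W.ballF x R) :
    W.vol x R ≤ W.vol y (2 * R) := by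
  rw [two_mul]
  exact W.vol_mono_of_subset hp (W.ballF_subset_of_mem hp hy)

/-- The inequality with constants ε/2 and ε is tested on the killed kernel with pole w, started at
time j so that the final time is N. By reversibility its total mass never exceeds μ(w), so the right
side is at most the number of times multiplied by μ(w). -/
theorem SkewedPMV.exists_ker_le (hS : W.SkewedPMV) {ε : ℝ} (hε : 0 < ε) : ∃ C : ℝ, 1 ≤ C ∧
    ∀ (x y w : Γ) (R : ℝ) (N : ℕ), 0 < R → y ∈ W.ballF x R → ⌊ε * W.E x R⌋₊ ≤ N →
      W.ker (W.ballF x R) N x w * (W.vol y (2 * R) * W.E y (2 * R)) ≤ C * W.E x R * W.mu w := by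
  obtain ⟨C, hC, h⟩ := hS (ε / 2) ε (by positivity) (by linarith)
  refine ⟨C * (ε + 1), one_le_mul_of_one_le_of_one_le hC (by linarith),
    fun x y w R N hR hy hN => ?_⟩
  obtain ⟨j, rfl⟩ := Nat.exists_eq_add_of_le' hN
  have h1 := h R hR x y ((W.mem_ball_iff hp).2 hy) _ (W.isDirichletSolution_ker hp x w R j _)
  have hE := W.one_le_E hp x hR
  have hμ := W.mu_pos w
  have hpos : 0 < W.vol y (2 * R) * W.E y (2 * R) :=
    mul_pos (W.vol_pos hp (by linarith)) (W.E_pos hp y (by linarith))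
  rw [div_mul_eq_mul_div, le_div_iff₀ hpos] at h1
  refine h1.trans ?_
  rw [mul_assoc C, mul_assoc C]
  refine mul_le_mul_of_nonneg_left ?_ (by linarith)
  have h2 : ∀ i, ∑' z : W.ball x R, W.ker (W.ballF x R) (j + i) z w * W.mu z ≤ W.mu w := by
    intro i
    rw [W.tsum_ball hp x R fun z => W.ker (W.ballF x R) (j + i) z w * W.mu z, W.sum_ker_mul_mu]
    exact mul_le_of_le_one_right hμ.le (W.surv_le_one _ _ _)
  refine (Finset.sum_le_sum fun i _ => h2 i).trans ?_
  rw [Finset.sum_const, nsmul_eq_mul, Nat.card_Icc]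
  refine mul_le_mul_of_nonneg_right ?_ hμ.le
  have h3 : ((⌊ε * W.E x R⌋₊ + 1 - ⌊ε / 2 * W.E x R⌋₊ : ℕ) : ℝ) ≤ ⌊ε * W.E x R⌋₊ + 1 := by
    exact_mod_cast Nat.sub_le _ _
  have h4 : (⌊ε * W.E x R⌋₊ : ℝ) ≤ ε * W.E x R := Nat.floor_le (by positivity)
  linarith

/-- The pole is summed only over the smaller ball B(x,r), so its volume appears on the right. This
asymmetry is used in `SkewedPMV.exists_maxExit_le`. -/
theorem SkewedPMV.exists_surv_mul_le (hS : W.SkewedPMV) {ε : ℝ} (hε : 0 < ε) : ∃ C : ℝ, 1 ≤ C ∧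
    ∀ (x y : Γ) (r R : ℝ) (N : ℕ), 0 < R → r ≤ R → y ∈ W.ballF x R → ⌊ε * W.E x R⌋₊ ≤ N →
      W.surv (W.ballF x r) N x * (W.vol y (2 * R) * W.E y (2 * R))
        ≤ C * W.E x R * W.vol x r := by
  obtain ⟨C, hC, h⟩ := SkewedPMV.exists_ker_le W hp hS hε
  refine ⟨C, hC, fun x y r R N hR hr hy hN => ?_⟩
  have hpos : 0 ≤ W.vol y (2 * R) * W.E y (2 * R) :=
    mul_nonneg (W.vol_pos hp (by linarith)).le (W.E_nonneg y _)
  rw [surv, W.vol_eq hp x r, Finset.sum_mul, Finset.mul_sum]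
  refine Finset.sum_le_sum fun w _ => ?_
  refine le_trans ?_ (h x y w R N hR hy hN)
  exact mul_le_mul_of_nonneg_right (W.ker_mono (W.ballF_mono hp hr) N x w) hpos

theorem SkewedPMV.exists_surv_mul_E_le (hS : W.SkewedPMV) {ε : ℝ} (hε : 0 < ε) : ∃ C : ℝ, 1 ≤ C ∧
    ∀ (x y : Γ) (R : ℝ) (N : ℕ), 0 < R → y ∈ W.ballF x R → ⌊ε * W.E x R⌋₊ ≤ N →
      W.surv (W.ballF x R) N x * W.E y (2 * R) ≤ C * W.E x R := by
  obtain ⟨C, hC, h⟩ := SkewedPMV.exists_surv_mul_le W hp hS hε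
  refine ⟨C, hC, fun x y R N hR hy hN => ?_⟩
  have h1 := h x y R R N hR le_rfl hy hN
  have h2 := W.vol_pos hp (x := x) hR
  have h3 := W.vol_le_vol_of_mem hp hy
  have h4 : 0 ≤ W.surv (W.ballF x R) N x * W.E y (2 * R) :=
    mul_nonneg (W.surv_nonneg _ _ _) (W.E_nonneg y _)
  refine le_of_mul_le_mul_right ?_ h2
  calc W.surv (W.ballF x R) N x * W.E y (2 * R) * W.vol x R
      ≤ W.surv (W.ballF x R) N x * W.E y (2 * R) * W.vol y (2 * R) := by gcongr
    _ = W.surv (W.ballF x R) N x * (W.vol y (2 * R) * W.E y (2 * R)) := by ring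
    _ ≤ _ := h1

/-- Surviving E(x,R)/2 steps has probability at least E(x,R)/(2M), where M is the maximal mean exit
time of the ball; E(x,R) then cancels. -/
theorem SkewedPMV.exists_vol_mul_E_le (hS : W.SkewedPMV) : ∃ C : ℝ, 1 ≤ C ∧
    ∀ (x y : Γ) (R : ℝ), 0 < R → y ∈ W.ballF x R →
      W.vol y (2 * R) * W.E y (2 * R) ≤ C * (W.vol x R * W.maxExit (W.ballF x R)) := by
  obtain ⟨C, hC, h⟩ := SkewedPMV.exists_surv_mul_le W hp hS (ε := 1 / 2) (by norm_num)
  refine ⟨2 * C, by linarith, fun x y R hR hy => ?_⟩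
  have h1 := h x y R R _ hR le_rfl hy le_rfl
  have h2 := W.sub_le_surv_mul hp (fun z hz => W.meanExit_le_maxExit (W.ballF x R) hz) x
    ⌊1 / 2 * W.E x R⌋₊
  rw [← W.E_eq_meanExit hp x hR] at h2
  have hE := W.E_pos hp x hR
  have hM := W.maxExit_pos hp x hR
  have h3 : (⌊1 / 2 * W.E x R⌋₊ : ℝ) ≤ 1 / 2 * W.E x R := Nat.floor_le (by positivity)
  have hpos : 0 < W.vol y (2 * R) * W.E y (2 * R) :=
    mul_pos (W.vol_pos hp (by linarith)) (W.E_pos hp y (by linarith))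
  generalize W.vol y (2 * R) * W.E y (2 * R) = Q at *
  generalize W.surv (W.ballF x R) ⌊1 / 2 * W.E x R⌋₊ x = s at *
  generalize W.maxExit (W.ballF x R) = M at *
  refine le_of_mul_le_mul_left ?_ hE
  calc W.E x R * Q ≤ 2 * (s * M) * Q := by
        refine mul_le_mul_of_nonneg_right ?_ hpos.le
        linarith
    _ = 2 * M * (s * Q) := by ring
    _ ≤ 2 * M * (C * W.E x R * W.vol x R) := by gcongr
    _ = _ := by ring

/-- From the maximiser z the walk survives M/2 steps with probability at least 1/2. The choice of ε
places the test time of the ball B(z,S) below M/2, so the skewed inequality there has a definite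
left side. -/
theorem SkewedPMV.exists_E_le_of_E_le (hS : W.SkewedPMV) {C₀ : ℝ} (hC₀ : 1 ≤ C₀) : ∃ C : ℝ, 1 ≤ C ∧
    ∀ (x z : Γ) (R S : ℝ), 0 < R → z ∈ W.ballF x R →
      W.meanExit (W.ballF x R) z = W.maxExit (W.ballF x R) → 2 * R ≤ S →
      W.E z S ≤ C₀ * W.maxExit (W.ballF x R) → ∀ y ∈ W.ballF z S,
        W.E y (2 * S) ≤ C * W.maxExit (W.ballF x R) := by
  have hC₀0 : 0 < C₀ := by linarith
  obtain ⟨C, hC, h⟩ := SkewedPMV.exists_surv_mul_E_le W hp hS (ε := 1 / (2 * C₀)) (by positivity)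
  refine ⟨2 * (C * C₀), ?_, fun x z R S hR hz hzM hRS hE y hy => ?_⟩
  · have := one_le_mul_of_one_le_of_one_le hC hC₀
    linarith
  obtain ⟨N, hN⟩ : ∃ N, N = ⌊1 / (2 * C₀) * W.E z S⌋₊ := ⟨_, rfl⟩
  have h1 := h z y S N (by linarith) hy hN.ge
  have hM := W.maxExit_pos hp x hR
  have hE0 := W.E_nonneg z S
  have h2 : (N : ℝ) ≤ W.maxExit (W.ballF x R) / 2 := by
    have h3 : (N : ℝ) ≤ 1 / (2 * C₀) * W.E z S := by rw [hN]; exact Nat.floor_le (by positivity)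
    refine h3.trans ?_
    rw [one_div_mul_eq_div, div_le_iff₀ (by positivity)]
    linarith
  have h3 := W.sub_le_surv_mul hp (fun z hz => W.meanExit_le_maxExit (W.ballF x R) hz) z N
  rw [hzM] at h3
  have h4 : 1 / 2 ≤ W.surv (W.ballF x R) N z := by
    refine le_of_mul_le_mul_right ?_ hM
    linarith
  have h5 : W.surv (W.ballF x R) N z ≤ W.surv (W.ballF z S) N z :=
    W.surv_mono ((W.ballF_subset_of_mem hp hz).trans (W.ballF_mono hp (by linarith))) N z
  have h6 := W.E_nonneg y (2 * S)
  have h7 : 1 / 2 * W.E y (2 * S) ≤ C * W.E z S :=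
    (mul_le_mul_of_nonneg_right (h4.trans h5) h6).trans h1
  have h8 : C * W.E z S ≤ C * (C₀ * W.maxExit (W.ballF x R)) := by gcongr
  linarith

/-- The volume comparison bounds E(z,2R), and the preceding lemma is then applied with S = 2R and S
= 4R. -/
theorem SkewedPMV.exists_E_le_maxExit (hS : W.SkewedPMV) : ∃ C : ℝ, 1 ≤ C ∧
    ∀ (x z : Γ) (R : ℝ), 0 < R → z ∈ W.ballF x R →
      W.meanExit (W.ballF x R) z = W.maxExit (W.ballF x R) →
      (∀ y ∈ W.ballF z (2 * R), W.E y (4 * R) ≤ C * W.maxExit (W.ballF x R)) ∧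
      ∀ y ∈ W.ballF z (4 * R), W.E y (8 * R) ≤ C * W.maxExit (W.ballF x R) := by
  obtain ⟨C₁, hC₁, h₁⟩ := SkewedPMV.exists_vol_mul_E_le W hp hS
  obtain ⟨C₂, hC₂, h₂⟩ := SkewedPMV.exists_E_le_of_E_le W hp hS hC₁
  obtain ⟨C₃, hC₃, h₃⟩ := SkewedPMV.exists_E_le_of_E_le W hp hS hC₂
  refine ⟨max C₂ C₃, hC₂.trans (le_max_left _ _), fun x z R hR hz hzM => ?_⟩
  have hM := W.maxExit_pos hp x hR
  have h4 : W.E z (2 * R) ≤ C₁ * W.maxExit (W.ballF x R) := by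
    have h5 := h₁ x z R hR hz
    have h6 := W.vol_le_vol_of_mem hp hz
    have h7 := W.vol_pos hp (x := z) (R := 2 * R) (by linarith)
    refine le_of_mul_le_mul_left ?_ h7
    calc W.vol z (2 * R) * W.E z (2 * R) ≤ C₁ * (W.vol x R * W.maxExit (W.ballF x R)) := h5
      _ ≤ C₁ * (W.vol z (2 * R) * W.maxExit (W.ballF x R)) := by gcongr
      _ = _ := by ring
  have h5 := h₂ x z R (2 * R) hR hz hzM le_rfl h4
  have h6 := h₃ x z R (2 * (2 * R)) hR hz hzM (by linarith)
    (h5 z (W.self_mem_ballF hp (by linarith)))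
  have e4 : 2 * (2 * R) = 4 * R := by ring
  have e8 : 2 * (4 * R) = 8 * R := by ring
  rw [e4] at h5 h6
  rw [e8] at h6
  exact ⟨fun y hy => (h5 y hy).trans (by gcongr; exact le_max_left _ _),
    fun y hy => (h6 y hy).trans (by gcongr; exact le_max_right _ _)⟩

theorem SkewedPMV.exists_E_eight_mul_le (hS : W.SkewedPMV) : ∃ C : ℝ, 1 ≤ C ∧
    ∀ (x y : Γ) (R : ℝ), 0 < R → y ∈ W.ballF x (2 * R) →
      W.E y (8 * R) ≤ C * W.maxExit (W.ballF x R) := by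
  obtain ⟨C, hC, h⟩ := SkewedPMV.exists_E_le_maxExit W hp hS
  refine ⟨C, hC, fun x y R hR hy => ?_⟩
  obtain ⟨z, hz, hzM, -⟩ := W.exists_maxExit_le_E hp x hR
  refine (h x z R hR hz hzM).2 y (W.ballF_mono hp ?_ (W.ballF_subset_of_mem hp hz hy))
  linarith

theorem SkewedPMV.exists_maxExit_two_mul_le (hS : W.SkewedPMV) : ∃ C : ℝ, 1 ≤ C ∧
    ∀ (x : Γ) (R : ℝ), 0 < R →
      W.maxExit (W.ballF x (2 * R)) ≤ C * W.maxExit (W.ballF x R) := by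
  obtain ⟨C, hC, h⟩ := SkewedPMV.exists_E_eight_mul_le W hp hS
  refine ⟨C, hC, fun x R hR => W.maxExit_le hp (by linarith) fun z hz => ?_⟩
  exact (W.E_mono hp z (by linarith)).trans (h x z R hR hz)

/-! ### Volume doubling and the local estimate from the skewed inequality -/

theorem VD_of_skewedPMV (hS : W.SkewedPMV) : W.VD := by
  obtain ⟨C, hC, h⟩ := SkewedPMV.exists_E_le_maxExit W hp hS
  obtain ⟨C₁, hC₁, h₁⟩ := SkewedPMV.exists_vol_mul_E_le W hp hS
  refine ⟨C₁ * C * C₁, by positivity, fun x R hR => ?_⟩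
  obtain ⟨z, hz, hzM, hzE⟩ := W.exists_maxExit_le_E hp x hR
  have h2R : 0 < 2 * R := by linarith
  have hsub : W.vol x (2 * R) ≤ W.vol z (2 * (2 * R)) :=
    W.vol_mono_of_subset hp ((W.ballF_subset_of_mem hp hz).trans (W.ballF_mono hp (by linarith)))
  have hE4 : W.E z (2 * R) ≤ W.E z (2 * (2 * R)) := W.E_mono hp z (by linarith)
  have hE2 := W.E_pos hp z h2R
  have hV1 := W.vol_pos hp (x := x) hR
  have hV2 := W.vol_pos hp (x := z) h2R
  -- At z the maximal exit time of B(z,2R) is comparable to the exit time E(z,4R) itself, so it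
  -- cancels and volume doubling remains.
  have h2 : W.vol z (2 * (2 * R)) ≤ C₁ * C * W.vol z (2 * R) := by
    have h3 := h₁ z z (2 * R) h2R (W.self_mem_ballF hp h2R)
    have h4 : W.maxExit (W.ballF z (2 * R)) ≤ C * W.E z (2 * (2 * R)) := by
      refine (W.maxExit_le hp (M := C * W.maxExit (W.ballF x R)) h2R fun y hy => ?_).trans ?_
      · have e4 : 2 * (2 * R) = 4 * R := by ring
        rw [e4]
        exact (h x z R hR hz hzM).1 y hy
      · exact mul_le_mul_of_nonneg_left (hzE.trans hE4) (by linarith)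
    refine le_of_mul_le_mul_right ?_ (hE2.trans_le hE4)
    calc W.vol z (2 * (2 * R)) * W.E z (2 * (2 * R))
        ≤ C₁ * (W.vol z (2 * R) * W.maxExit (W.ballF z (2 * R))) := h3
      _ ≤ C₁ * (W.vol z (2 * R) * (C * W.E z (2 * (2 * R)))) := by gcongr
      _ = _ := by ring
  have h3 : W.vol z (2 * R) ≤ C₁ * W.vol x R := by
    refine le_of_mul_le_mul_right ?_ hE2
    calc W.vol z (2 * R) * W.E z (2 * R) ≤ C₁ * (W.vol x R * W.maxExit (W.ballF x R)) :=
          h₁ x z R hR hz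
      _ ≤ C₁ * (W.vol x R * W.E z (2 * R)) := by gcongr
      _ = _ := by ring
  calc W.vol x (2 * R) ≤ C₁ * C * W.vol z (2 * R) := hsub.trans h2
    _ ≤ C₁ * C * (C₁ * W.vol x R) := by gcongr
    _ = _ := by ring

theorem localDUE_of_skewedPMV (hS : W.SkewedPMV) : W.LocalDUE := by
  intro ε hε
  obtain ⟨C, hC, h⟩ := SkewedPMV.exists_ker_le W hp hS hε
  refine ⟨C, hC, fun x R n hR hn => ?_⟩
  have hE := W.E_pos hp x hR
  have hV := W.vol_pos hp (x := x) hR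
  have hN : ⌊ε * W.E x R⌋₊ ≤ 2 * n := by
    refine Nat.floor_le_of_le ?_
    push_cast
    exact hn
  have h1 := h x x x R (2 * n) hR (W.self_mem_ballF hp hR) hN
  have h2 := W.vol_mono hp (x := x) (show R ≤ 2 * R by linarith)
  have h3 := W.E_mono hp x (show R ≤ 2 * R by linarith)
  have h4 := W.ker_nonneg (W.ballF x R) (2 * n) x x
  rw [pk, div_le_div_iff₀ (W.mu_pos x) hV]
  refine le_of_mul_le_mul_right ?_ hE
  calc W.ker (W.ballF x R) (2 * n) x x * W.vol x R * W.E x R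
      = W.ker (W.ballF x R) (2 * n) x x * (W.vol x R * W.E x R) := by ring
    _ ≤ W.ker (W.ballF x R) (2 * n) x x * (W.vol x (2 * R) * W.E x (2 * R)) :=
      mul_le_mul_of_nonneg_left (mul_le_mul h2 h3 hE.le (hV.le.trans h2)) h4
    _ ≤ C * W.E x R * W.mu x := h1
    _ = _ := by ring

omit [Countable Γ] [MeasurableSpace Γ] [MeasurableSingletonClass Γ] in
/-- Reverse volume doubling. -/
theorem VD.exists_reverse (hV : W.VD) : ∃ θ : ℝ, 1 < θ ∧ ∀ (x : Γ) (R : ℝ), 1 / 2 ≤ R →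
    θ * W.vol x R ≤ W.vol x (8 * R) := by
  classical
  obtain ⟨D, hD, h⟩ := VD.exists_le W hp hV
  have hD0 : 0 < D := by linarith
  refine ⟨1 + 1 / D ^ 3, by
    have : 0 < 1 / D ^ 3 := by positivity
    linarith, fun x R hR => ?_⟩
  -- A ball of radius R around y is disjoint from B(x,R), lies in B(x,8R), and by doubling has
  -- comparable volume.
  obtain ⟨y, hy⟩ := W.exists_dist_eq hp x ⌈2 * R⌉₊
  have hR0 : 0 < R := by linarith
  have h1 : 2 * R ≤ W.dist x y := by rw [hy]; exact Nat.le_ceil _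
  have h2 : (W.dist x y : ℝ) ≤ 2 * R + 1 := by
    rw [hy]; exact (Nat.ceil_lt_add_one (by linarith)).le
  have hdisj : Disjoint (W.ballF x R) (W.ballF y R) := by
    rw [Finset.disjoint_left]
    intro z hz hz'
    rw [W.mem_ballF hp] at hz hz'
    have h3 := W.dist_triangle_real x z y
    rw [W.dist_comm z y] at h3
    linarith
  have h3 : W.vol x R + W.vol y R ≤ W.vol x (8 * R) := by
    rw [W.vol_eq hp, W.vol_eq hp, W.vol_eq hp, ← Finset.sum_union hdisj]
    refine Finset.sum_le_sum_of_subset_of_nonneg (Finset.union_subset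
      (W.ballF_mono hp (by linarith)) (W.ballF_subset hp (by linarith)))
      fun z _ _ => (W.mu_pos z).le
  have h4 : W.vol x R ≤ D ^ 3 * W.vol y R := by
    have h5 : W.vol x R ≤ W.vol y (2 ^ 3 * R) :=
      W.vol_le_vol hp (by rw [W.dist_comm]; linarith)
    exact h5.trans (doubling_iterate (f := W.vol y) hD0.le (fun r hr => h y r hr) hR0 3)
  have h5 : 1 / D ^ 3 * W.vol x R ≤ W.vol y R := by
    rw [one_div_mul_eq_div, div_le_iff₀ (by positivity)]
    linarith
  linarith

omit [Countable Γ] [MeasurableSpace Γ] [MeasurableSingletonClass Γ] in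
theorem VD.exists_vol_lt (hV : W.VD) (K : ℝ) : ∃ a : ℕ, ∀ (x : Γ) (R : ℝ), 1 / 2 ≤ R →
    K * W.vol x R < W.vol x (2 ^ a * R) := by
  obtain ⟨θ, hθ, h⟩ := VD.exists_reverse W hp hV
  obtain ⟨k, hk⟩ := pow_unbounded_of_one_lt K hθ
  have h1 : ∀ (k : ℕ) (x : Γ) (R : ℝ), 1 / 2 ≤ R → θ ^ k * W.vol x R ≤ W.vol x (8 ^ k * R) := by
    intro k x R hR
    induction k with
    | zero => simp
    | succ k ih =>
      have h8 : (1 : ℝ) ≤ 8 ^ k := one_le_pow₀ (by norm_num)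
      have h2 := h x (8 ^ k * R) (by nlinarith)
      calc θ ^ (k + 1) * W.vol x R = θ * (θ ^ k * W.vol x R) := by ring
        _ ≤ θ * W.vol x (8 ^ k * R) := by gcongr
        _ ≤ W.vol x (8 * (8 ^ k * R)) := h2
        _ = W.vol x (8 ^ (k + 1) * R) := by ring_nf
  refine ⟨3 * k, fun x R hR => ?_⟩
  have h2 := h1 k x R hR
  have h3 := W.vol_pos hp (x := x) (show 0 < R by linarith)
  rw [pow_mul]
  norm_num only
  exact (mul_lt_mul_of_pos_right hk h3).trans_le h2

/-! ### The time comparison principle from the skewed inequality -/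

theorem SkewedPMV.exists_E_le_surv_mul (hS : W.SkewedPMV) : ∃ η : ℝ, 0 < η ∧
    ∀ (x : Γ) (R : ℝ) (n : ℕ), 0 < R → n ≤ η * W.maxExit (W.ballF x R) →
      W.E x R ≤ 4 * (W.surv (W.ballF x R) n x * W.maxExit (W.ballF x R)) := by
  obtain ⟨C, hC, h⟩ := SkewedPMV.exists_surv_mul_E_le W hp hS (ε := 1 / 2) (by norm_num)
  refine ⟨1 / (4 * C), by positivity, fun x R n hR hn => ?_⟩
  obtain ⟨z, hz, -, hzE⟩ := W.exists_maxExit_le_E hp x hR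
  have hM := W.maxExit_pos hp x hR
  have hE := W.E_pos hp x hR
  obtain ⟨k, hk⟩ : ∃ k, k = ⌊1 / 2 * W.E x R⌋₊ := ⟨_, rfl⟩
  have hk2 : (k : ℝ) ≤ 1 / 2 * W.E x R := by rw [hk]; exact Nat.floor_le (by positivity)
  have h1 := W.meanExit_le_sum_add hp
    (fun z hz => W.meanExit_le_maxExit (W.ballF x R) hz) x n
  rw [← W.E_eq_meanExit hp x hR] at h1
  -- After E(x,R)/2 steps survival has dropped to order E/M, so the first n ≤ η M terms of the mean
  -- exit time add up to at most E/2 + E/4. At least E/4 must come from survival beyond n.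
  have h2 : ∀ i ≥ k, W.surv (W.ballF x R) i x ≤ C * W.E x R / W.maxExit (W.ballF x R) := by
    intro i hi
    rw [le_div_iff₀ hM]
    refine le_trans ?_ (h x z R i hR hz (hk ▸ hi))
    exact mul_le_mul_of_nonneg_left hzE (W.surv_nonneg _ _ _)
  have h3 : ∑ i ∈ Finset.range n, W.surv (W.ballF x R) i x
      ≤ k + n * (C * W.E x R / W.maxExit (W.ballF x R)) := by
    have h4 : ∑ i ∈ Finset.range n, W.surv (W.ballF x R) i x
        ≤ ∑ i ∈ Finset.range n, ((if i < k then 1 else 0) +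
          C * W.E x R / W.maxExit (W.ballF x R)) := by
      refine Finset.sum_le_sum fun i _ => ?_
      have h0 : 0 ≤ C * W.E x R / W.maxExit (W.ballF x R) := by positivity
      by_cases hi : i < k
      · rw [if_pos hi]
        have := W.surv_le_one (W.ballF x R) i x
        linarith
      · rw [if_neg hi, zero_add]
        exact h2 i (not_lt.1 hi)
    refine h4.trans ?_
    rw [Finset.sum_add_distrib, Finset.sum_const, Finset.card_range, nsmul_eq_mul,
      ← Finset.sum_filter, Finset.sum_const, nsmul_eq_mul, mul_one]
    gcongr
    have h5 : Finset.filter (· < k) (Finset.range n) ⊆ Finset.range k := fun i hi =>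
      Finset.mem_range.2 (Finset.mem_filter.1 hi).2
    simpa using Finset.card_le_card h5
  have h4 : n * (C * W.E x R / W.maxExit (W.ballF x R)) ≤ W.E x R / 4 := by
    rw [mul_div_assoc', div_le_iff₀ hM]
    rw [one_div_mul_eq_div, le_div_iff₀ (by positivity)] at hn
    have := mul_le_mul_of_nonneg_right hn hE.le
    linarith
  linarith

theorem SkewedPMV.exists_maxExit_le (hS : W.SkewedPMV) : ∃ c : ℝ, 0 < c ∧
    ∀ (x : Γ) (R : ℝ), 0 < R → c * W.maxExit (W.ballF x R) ≤ W.E x R := by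
  obtain ⟨η, hη, hsurv⟩ := SkewedPMV.exists_E_le_surv_mul W hp hS
  obtain ⟨C, hC, h⟩ := SkewedPMV.exists_surv_mul_le W hp hS (ε := 1 / 2) (by norm_num)
  obtain ⟨C₁, hC₁, hdb⟩ := SkewedPMV.exists_maxExit_two_mul_le W hp hS
  -- The scale ratio 2 ^ a is fixed so that the volume grows by more than the factor 4 C which a
  -- failure of the claim would allow.
  obtain ⟨a, ha⟩ := VD.exists_vol_lt W hp (W.VD_of_skewedPMV hp hS) (4 * C)
  have hC₁a : 1 ≤ C₁ ^ a := one_le_pow₀ hC₁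
  have hdba : ∀ (x : Γ) (R : ℝ), 0 < R →
      W.maxExit (W.ballF x (2 ^ a * R)) ≤ C₁ ^ a * W.maxExit (W.ballF x R) := fun x R hR =>
    doubling_iterate (f := fun r => W.maxExit (W.ballF x r)) (by linarith)
      (fun r hr => hdb x r hr) hR a
  obtain ⟨c, hc0, hc1, hcη⟩ : ∃ c : ℝ, 0 < c ∧ c * C₁ ^ a ≤ 1 ∧ c * C₁ ^ a ≤ 2 * η := by
    refine ⟨min 1 (2 * η) / C₁ ^ a, div_pos (lt_min one_pos (by positivity)) (by positivity), ?_⟩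
    rw [div_mul_cancel₀ _ (by positivity)]
    exact ⟨min_le_left _ _, min_le_right _ _⟩
  have hone : ∀ (x : Γ) (R : ℝ), 0 < R → R ≤ 1 → W.maxExit (W.ballF x R) = W.E x R := by
    intro x R hR hR1
    refine le_antisymm ?_ (W.E_le_maxExit hp x hR)
    obtain ⟨z, hz, hzM, -⟩ := W.exists_maxExit_le_E hp x hR
    rw [W.ballF_one hp hR hR1, Finset.mem_singleton] at hz
    rw [← hzM, hz, W.E_eq_meanExit hp x hR]
  have hstep : ∀ (x : Γ) (R : ℝ), 0 < R → c * W.maxExit (W.ballF x R) ≤ W.E x R →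
      c * W.maxExit (W.ballF x (2 ^ a * R)) ≤ W.E x (2 ^ a * R) := by
    intro x R hR hind
    have h2a : (1 : ℝ) ≤ 2 ^ a := one_le_pow₀ (by norm_num)
    obtain ⟨J, hJ⟩ : ∃ J, J = 2 ^ a * R := ⟨_, rfl⟩
    have hJR : R ≤ J := by rw [hJ]; nlinarith
    have hJ0 : 0 < J := by linarith
    have hdbJ := hdba x R hR
    rw [← hJ] at hdbJ ⊢
    have hMR := W.maxExit_pos hp x hR
    have hMJ := W.maxExit_pos hp x hJ0
    have hER := W.E_mono hp x hJR
    have hEJ := W.E_pos hp x hJ0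
    rcases le_or_gt (1 / 2) R with hR2 | hR2
    swap
    · rw [hone x R hR (by linarith)] at hdbJ
      calc c * W.maxExit (W.ballF x J) ≤ c * (C₁ ^ a * W.E x R) := by gcongr
        _ = c * C₁ ^ a * W.E x R := by ring
        _ ≤ 1 * W.E x J := mul_le_mul hc1 hER (W.E_nonneg x R) zero_le_one
        _ = W.E x J := one_mul _
    obtain ⟨n, hn⟩ : ∃ n, n = ⌊1 / 2 * W.E x J⌋₊ := ⟨_, rfl⟩
    have hn2 : (n : ℝ) ≤ 1 / 2 * W.E x J := by rw [hn]; exact Nat.floor_le (by positivity)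
    -- If n exceeds η times the smaller maximum, E(x,J) is already large enough by doubling of the
    -- maximum.
    rcases le_or_gt (n : ℝ) (η * W.maxExit (W.ballF x R)) with hnη | hnη
    swap
    · calc c * W.maxExit (W.ballF x J) ≤ c * (C₁ ^ a * W.maxExit (W.ballF x R)) := by gcongr
        _ = c * C₁ ^ a * W.maxExit (W.ballF x R) := by ring
        _ ≤ 2 * η * W.maxExit (W.ballF x R) := by gcongr
        _ ≤ W.E x J := by linarith
    -- The inductive bound makes survival in the small ball up to time n at least c/4. The skewed
    -- inequality on the large ball, with poles in the small one, would then force V(x,J) ≤ 4 C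
    -- V(x,R).
    by_contra! hlt
    obtain ⟨z, hz, -, hzE⟩ := W.exists_maxExit_le_E hp x hJ0
    have h1 := h x z R J n hJ0 hJR hz hn.ge
    have h2 := hsurv x R n hR hnη
    have h3 := W.vol_le_vol_of_mem hp hz
    have h4 := ha x R hR2
    rw [← hJ] at h4
    have hVJ := W.vol_pos hp (x := x) hJ0
    have hVR := W.vol_pos hp (x := x) hR
    have hs0 := W.surv_nonneg (W.ballF x R) n x
    generalize W.surv (W.ballF x R) n x = s at *
    generalize W.maxExit (W.ballF x R) = MR at *
    generalize W.maxExit (W.ballF x J) = MJ at *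
    have h5 : s * (W.vol x J * MJ) ≤ C * W.E x J * W.vol x R := by
      refine le_trans ?_ h1
      gcongr
      exact (W.vol_pos hp (by linarith)).le
    have h6 : c ≤ 4 * s := by
      refine le_of_mul_le_mul_right ?_ hMR
      linarith
    have h7 : c * W.vol x J * MJ ≤ c * (4 * C * W.vol x R) * MJ := by
      calc c * W.vol x J * MJ ≤ 4 * s * W.vol x J * MJ := by gcongr
        _ = 4 * (s * (W.vol x J * MJ)) := by ring
        _ ≤ 4 * (C * W.E x J * W.vol x R) := by gcongr
        _ ≤ 4 * (C * (c * MJ) * W.vol x R) := by gcongr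
        _ = _ := by ring
    have h8 := le_of_mul_le_mul_left (le_of_mul_le_mul_right h7 hMJ) hc0
    linarith
  have ha0 : a ≠ 0 := by
    rintro rfl
    obtain ⟨x⟩ := (inferInstance : Nonempty Γ)
    have h1 := ha x 1 (by norm_num)
    have h2 := W.vol_pos hp (x := x) one_pos
    rw [pow_zero, one_mul] at h1
    nlinarith
  have hcle : c ≤ 1 := le_trans (le_mul_of_one_le_right hc0.le hC₁a) hc1
  have hall : ∀ (s : ℕ) (x : Γ) (R : ℝ), 0 < R → R ≤ (2 ^ a) ^ s →
      c * W.maxExit (W.ballF x R) ≤ W.E x R := by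
    intro s
    induction s with
    | zero =>
      intro x R hR hRs
      rw [hone x R hR (by simpa using hRs)]
      exact mul_le_of_le_one_left (W.E_nonneg x R) hcle
    | succ s ih =>
      intro x R hR hRs
      have h0 : (0 : ℝ) < 2 ^ a := by positivity
      have h1 := hstep x (R / 2 ^ a) (by positivity) (ih x _ (by positivity) (by
        rw [div_le_iff₀ h0, ← pow_succ]
        exact hRs))
      rwa [mul_div_cancel₀ R h0.ne'] at h1
  refine ⟨c, hc0, fun x R hR => ?_⟩
  obtain ⟨s, hs⟩ := pow_unbounded_of_one_lt R (show (1 : ℝ) < 2 ^ a from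
    one_lt_pow₀ (by norm_num) ha0)
  exact hall s x R hR hs.le

theorem TC_of_skewedPMV (hS : W.SkewedPMV) : W.TC := by
  obtain ⟨c, hc, h⟩ := SkewedPMV.exists_maxExit_le W hp hS
  obtain ⟨C, hC, h'⟩ := SkewedPMV.exists_E_eight_mul_le W hp hS
  refine ⟨1 + C / c, by
    have : 0 < C / c := by positivity
    linarith, fun x R hR y hy => ?_⟩
  rw [W.mem_ball_iff hp] at hy
  have hE := W.E_pos hp y hR
  -- The maximal exit time of B(y,R) bounds E(x,8R) because x lies in B(y,2R); the previous lemma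
  -- returns it to the centre y.
  have h1 : x ∈ W.ballF y (2 * R) := W.ballF_mono hp (by linarith) ((W.mem_ballF_comm hp).1 hy)
  have h2 := (W.E_mono hp x (show 2 * R ≤ 8 * R by linarith)).trans (h' y x R hR h1)
  have h3 := h y R hR
  rw [div_le_iff₀ hE]
  have h4 : C * W.maxExit (W.ballF y R) ≤ C / c * W.E y R := by
    calc C * W.maxExit (W.ballF y R) = C / c * (c * W.maxExit (W.ballF y R)) := by field_simp
      _ ≤ _ := by gcongr
  linarith

end WeightedGraph
end

theorem mainTheorem2 {Γ : Type*} [Countable Γ] [Infinite Γ]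
    [MeasurableSpace Γ] [MeasurableSingletonClass Γ]
    (W : WeightedGraph Γ) (hp₀ : W.ControlledWeights) :
    List.TFAE [
      W.SkewedPMV,
      W.VD ∧ W.TC ∧ W.MV,
      W.VD ∧ W.TC ∧ W.DUE,
      W.VD ∧ W.TC ∧ W.UE] := by
  tfae_have 1 → 3 := fun h =>
    have hV := W.VD_of_skewedPMV hp₀ h
    have hT := W.TC_of_skewedPMV hp₀ h
    ⟨hV, hT, W.DUE_of_localDUE hp₀ hV hT (W.localDUE_of_skewedPMV hp₀ h)⟩
  tfae_have 3 → 4 := fun ⟨hV, hT, hD⟩ => ⟨hV, hT, W.UE_of_DUE hp₀ hV hT hD⟩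
  tfae_have 4 → 2 := fun ⟨hV, hT, hU⟩ => ⟨hV, hT, W.MV_of_UE hp₀ hV hT hU⟩
  tfae_have 2 → 3 := fun ⟨hV, hT, hM⟩ =>
    ⟨hV, hT, W.DUE_of_localDUE hp₀ hV hT (W.localDUE_of_MV hp₀ hV hT hM)⟩
  tfae_have 3 → 1 := fun ⟨hV, hT, hD⟩ => W.skewedPMV_of_DUE hp₀ hV hT hD
  tfae_finish
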